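/- **Setting.** Let $(\Omega,\mathscr F,P)$ be a probability space with a filtration $(\mathscr F_t)_{t=0,\dots,T}$, $T\in\mathbb N$, and let $p,q\in[1,\infty]$ with $1/p+1/q=1$. Random variables are identified, and relations between them understood, $P$-almost surely; $L^0(\mathscr F_t)$ and $\bar L^0(\mathscr F_t)$ are the real and the $[-\infty,\infty]$-valued $\mathscr F_t$-measurable random variables; $\infty-\infty:=-\infty$, $0\cdot\pm\infty:=0$. $L^{t,p}$ denotes random variables $Y$ with a.s. finite conditional norm $\|Y\|_{t,p}=E[|Y|^p\mid\mathscr F_t]^{1/p}$ (for $p=\infty$: the least $\mathscr F_t$-measurable bound of $|Y|$). For extended $f$, $E_Q[f\mid\mathscr F_t]:=E_Q[f^+\mid\mathscr F_t]-E_Q[f^-\mid\mathscr F_t]$. For an adapted process $X$ let $X_{[s,r]}=X1_{[s,r]}$. $L^{t,p}(\mathscr O_{[t,T]})$ is the set of $(V_s)_{t\le s\le T}$ with $V_s\in L^{t,p}$ $\mathscr F_s$-measurable; it carries the topology of the conditional norm if $p<\infty$ and the conditional weak topology $\sigma(L^{t,\infty},L^{t,1})$ if $p=\infty$ (neighbourhood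 radii $\varepsilon\in L^0(\mathscr F_t)$, $\varepsilon>0$). $\mathcal X^p_t$ is the set of adapted $X$ with $X_{[t,T]}\in L^{t,p}(\mathscr O_{[t,T]})$. **Indices.** For $t=0,\dots,T$ let $\alpha_t:\mathcal X^p_t\to\bar L^0(\mathscr F_t)$ be such that for every adapted past path $\bar X_{[0,t-1]}$ the map $\varphi(V)=\alpha_t(\bar X_{[0,t-1]}+V)$ on $L^{t,p}(\mathscr O_{[t,T]})$ is $\mathscr F_t$-local, $L^0(\mathscr F_t)$-quasiconcave, monotone for a.s. dominance and upper semicontinuous (closed sets $\{\varphi\ge a\}$ for all $a\in\bar L^0(\mathscr F_t)$), and, with $\kappa=1_{[t,T]}$: * (bounded) for every $V$ with all $V_s\in L^p$ there are $m_1,m_2\in L^p(\mathscr F_t)$ with $\varphi(m_1\kappa)<\varphi(V)\le\varphi(m_2\kappa)$; * (strictly increasing) for $A\in\mathscr F_t$ and $m,m'\in L^0(\mathscr F_t)$, $m>m'$ on $A$ implies $\varphi(m\kappa)>\varphi(m'\kappa)$ on $A$; * (sensitive) for $A\in\mathscr F_t$, $m\in L^0(\mathscr F_t)$ and $V$ with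 $\varphi(m\kappa)>\varphi(V)$ on $A$ there is $\varepsilon\in L^0(\mathscr F_t)$, $\varepsilon\ge0$, $\varepsilon>0$ on $A$, with $\varphi((m-\varepsilon)\kappa)\ge\varphi(V)$ on $A$. Assume strong time consistency: for $t<T$ and $X,Y\in\mathcal X^p_t$ with $X_{[0,t]}=Y_{[0,t]}$, $\alpha_{t+1}(X)\ge\alpha_{t+1}(Y)$ implies $\alpha_t(X)\ge\alpha_t(Y)$. Let $$C_t(X)=\operatorname{ess\,inf}\{m\in L^0(\mathscr F_t):\alpha_t(X_{[0,t-1]}+m1_{[t,T]})\ge\alpha_t(X)\},\qquad X\in\mathcal X_t^p .$$ **One-step risk functions.** For $t<T$ let $\mathcal{MD}_t^{t+1}$ be the set of the measures $Q\otimes D$ on $\Omega\times\{t,t+1\}$ with density $\big(1-D,\,D\,\tfrac{dQ}{dP}\big)$, where $Q\ll P$ is a probability measure on $\mathscr F_{t+1}$ with $Q=P$ on $\mathscr F_t$ and $\frac{dQ}{dP}\in L^{t,q}$, and $D$ is $\mathscr F_t$-measurable with $0\le D\le1$; let $\mathcal{MD}_T^{T+1}=\{1\}$ be a one-point set. Put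 $\langle Q\otimes D,(x,Y)\rangle=E_Q[D(Y-x)+x\mid\mathscr F_t]$ for $x\in L^0(\mathscr F_t)$ and $\mathscr F_{t+1}$-measurable $Y\in L^{t,p}$. A *minimal risk function* at time $t$ is a map $\rho:\mathcal{MD}_t^{t+1}\times\bar L^0(\mathscr F_t)\to\bar L^0(\mathscr F_t)$ that is jointly local, increasing and right-continuous in the second argument, jointly $L^0(\mathscr F_t)$-quasiconvex, has a uniform asymptotic maximum ($\operatorname{ess\,sup}_{s\in L^0(\mathscr F_t)}\rho(Q\otimes D,s)$ does not depend on $Q\otimes D$), and whose left-continuous version in $s$ has closed sets $\{(Q\otimes D,s):\rho^-(Q\otimes D,s)\le a\}$, $s\in L^0(\mathscr F_t)$, for all $a\in\bar L^0(\mathscr F_t)$ (in the conditional weak topology of the above duality times the $L^0(\mathscr F_t)$-topology). Here $\rho^+(s)=\operatorname{ess\,inf}\{\rho(n): n>s\text{ on }\{s<\infty\}\}$ on $\{s<\infty\}$, $\rho^+(s)=\infty$ on $\{s=\infty\}$; $\rho^-(s)=\operatorname{ess\,sup}\{\rho(n): n<s\text{ on }\{s>-\infty\}\}$ on $\{s>-\infty\}$,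 $\rho^-(s)=-\infty$ on $\{s=-\infty\}$; right-continuous means $\rho=\rho^+$. A *family of one-step minimal risk functions corresponding to $C$* is a family $R_{t,t+1}(X_{[0,t-1]},\cdot,\cdot)$, $t<T$, of minimal risk functions, indexed by adapted past paths, with, for all $x\in L^0(\mathscr F_t)$ and $\mathscr F_{t+1}$-measurable $Y\in L^{t,p}$, $$C_t\big(X_{[0,t-1]}+x1_{\{t\}}+Y1_{[t+1,T]}\big)=\operatorname*{ess\,inf}_{Q\otimes D\in\mathcal{MD}_t^{t+1}}R_{t,t+1}\big(X_{[0,t-1]},Q\otimes D,E_Q[D(Y-x)+x\mid\mathscr F_t]\big).$$ **Theorem.** Such a family exists. For every such family, every $t\in\{0,\dots,T\}$ and every $X\in\mathcal X^p_t$, $$C_t(X)=\operatorname*{ess\,inf}_{Q\otimes D\in\mathcal{MD}_t^{t+1}}F_t(Q\otimes D,X),$$ where $F_T(Q\otimes D,X)=X_T$ and, for $t\le T-1$, $$F_t(Q\otimes D,X)=\operatorname*{ess\,inf}_{\bar Q\otimes\bar D\in\mathcal{MD}_{t+1}^{t+2}}R_{t,t+1}\Big(X_{[0,t-1]},Q\otimes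 D,E_Q\big[D\big(F_{t+1}(\bar Q\otimes\bar D,X)-X_t\big)+X_t\mid\mathscr F_t\big]\Big).$$ -/

import Mathlib

open MeasureTheory Filter
open scoped ENNReal

noncomputable section

namespace DynIndex

/-! ### Essential infima and suprema of families of extended random variables -/

section EssInf

variable {Ω : Type*}

/-- `g` is (a version of) the essential infimum of the family `S` in `L̄⁰(m)`. -/
def IsEssInf (m : MeasurableSpace Ω) {m0 : MeasurableSpace Ω} (P : Measure Ω)
    (S : Set (Ω → EReal)) (g : Ω → EReal) : Prop :=
  Measurable[m] g ∧ (∀ f ∈ S, g ≤ᵐ[P] f) ∧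
    ∀ h : Ω → EReal, Measurable[m] h → (∀ f ∈ S, h ≤ᵐ[P] f) → h ≤ᵐ[P] g

/-- `g` is (a version of) the essential supremum of the family `S` in `L̄⁰(m)`. -/
def IsEssSup (m : MeasurableSpace Ω) {m0 : MeasurableSpace Ω} (P : Measure Ω)
    (S : Set (Ω → EReal)) (g : Ω → EReal) : Prop :=
  Measurable[m] g ∧ (∀ f ∈ S, f ≤ᵐ[P] g) ∧
    ∀ h : Ω → EReal, Measurable[m] h → (∀ f ∈ S, f ≤ᵐ[P] h) → g ≤ᵐ[P] h

/-- A version of the essential infimum, unique up to a.s. equality; it exists for every family of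
`m`-measurable functions by `exists_isEssInf`. -/
def essInf (m : MeasurableSpace Ω) {m0 : MeasurableSpace Ω} (P : Measure Ω)
    (S : Set (Ω → EReal)) : Ω → EReal :=
  Classical.epsilon (IsEssInf m P S)

/-- A version of the essential supremum, see `exists_isEssSup`. -/
def essSup (m : MeasurableSpace Ω) {m0 : MeasurableSpace Ω} (P : Measure Ω)
    (S : Set (Ω → EReal)) : Ω → EReal :=
  Classical.epsilon (IsEssSup m P S)

theorem exists_isEssInf (m : MeasurableSpace Ω) {m0 : MeasurableSpace Ω}
    (P : Measure Ω) [IsProbabilityMeasure P]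
    (hm : m ≤ m0) (S : Set (Ω → EReal)) (hS : ∀ f ∈ S, Measurable[m] f) :
    ∃ g, IsEssInf m P S g := by
  classical
  let u : EReal → ℝ≥0∞ := fun x => (1 + EReal.exp x)⁻¹
  have hu_anti : StrictAnti u := by
    intro x y hxy
    have h1 : EReal.exp x < EReal.exp y := EReal.exp_strictMono hxy
    exact ENNReal.inv_lt_inv.2 (ENNReal.add_lt_add_left ENNReal.one_ne_top h1)
  have hu_meas : Measurable u := hu_anti.antitone.measurable
  have hu_le : ∀ x, u x ≤ 1 := fun x => ENNReal.inv_le_one.2 le_self_add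
  let I : Set (Ω → EReal) → ℝ≥0∞ := fun c => ∫⁻ ω, u (⨅ f ∈ c, f ω) ∂P
  have hI_le : ∀ c, I c ≤ 1 := fun c => by
    calc I c ≤ ∫⁻ _, 1 ∂P := lintegral_mono fun ω => hu_le _
      _ = 1 := by simp
  have hI_mono : ∀ c d, c ⊆ d → I c ≤ I d := fun c d hcd =>
    lintegral_mono fun ω => hu_anti.antitone (biInf_mono hcd)
  have hmeas : ∀ c : Set (Ω → EReal), c.Countable → c ⊆ S →
      Measurable[m] (fun ω => ⨅ f ∈ c, f ω) := fun c hc hcS =>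
    Measurable.biInf c hc fun f hf => hS f (hcS hf)
  let J : Set ℝ≥0∞ := I '' {c | c.Countable ∧ c ⊆ S}
  have hJne : J.Nonempty := ⟨_, ∅, ⟨Set.countable_empty, Set.empty_subset _⟩, rfl⟩
  obtain ⟨v, -, hv, hvJ⟩ := exists_seq_tendsto_sSup hJne (OrderTop.bddAbove J)
  choose c hc hcI using hvJ
  let d : Set (Ω → EReal) := ⋃ n, c n
  have hd : d.Countable := Set.countable_iUnion fun n => (hc n).1
  have hdS : d ⊆ S := Set.iUnion_subset fun n => (hc n).2
  have hdI : sSup J ≤ I d := le_of_tendsto' hv fun n => by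
    rw [← hcI n]; exact hI_mono _ _ (Set.subset_iUnion c n)
  refine ⟨fun ω => ⨅ f ∈ d, f ω, hmeas d hd hdS, ?_, ?_⟩
  · intro f hf
    have hins : insert f d ⊆ S := Set.insert_subset hf hdS
    have hle : I (insert f d) ≤ I d :=
      (le_sSup (show I (insert f d) ∈ J from ⟨_, ⟨hd.insert f, hins⟩, rfl⟩)).trans hdI
    have hae := ae_eq_of_ae_le_of_lintegral_le (μ := P)
      (f := fun ω => u (⨅ f ∈ d, f ω)) (g := fun ω => u (⨅ g ∈ insert f d, g ω))
      (Eventually.of_forall fun ω => hu_anti.antitone (biInf_mono (Set.subset_insert f d)))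
      (ne_top_of_le_ne_top ENNReal.one_ne_top (hI_le d))
      ((hu_meas.comp ((hmeas _ (hd.insert f) hins).mono hm le_rfl)).aemeasurable) hle
    filter_upwards [hae] with ω hω
    have := hu_anti.injective hω
    rw [this]
    exact biInf_le (fun g : Ω → EReal => g ω) (Set.mem_insert f d)
  · intro h _ hh
    have : ∀ᵐ ω ∂P, ∀ f ∈ d, h ω ≤ f ω := (ae_ball_iff hd).2 fun f hf => hh f (hdS hf)
    filter_upwards [this] with ω hω
    exact le_iInf₂ hω

theorem exists_isEssSup (m : MeasurableSpace Ω) {m0 : MeasurableSpace Ω}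
    (P : Measure Ω) [IsProbabilityMeasure P]
    (hm : m ≤ m0) (S : Set (Ω → EReal)) (hS : ∀ f ∈ S, Measurable[m] f) :
    ∃ g, IsEssSup m P S g := by
  obtain ⟨g, hg, h1, h2⟩ := exists_isEssInf m P hm {f | -f ∈ S} (fun f hf => by
    have := (measurable_neg (G := EReal)).comp (hS _ hf)
    simpa [Function.comp_def] using this)
  refine ⟨-g, hg.neg, fun f hf => ?_, fun h hh hf => ?_⟩
  · filter_upwards [h1 (-f) (by simpa using hf)] with ω hω
    exact EReal.le_neg_of_le_neg hω
  · filter_upwards [h2 (-h) hh.neg (fun f hfS => by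
      filter_upwards [hf _ hfS] with ω hω
      exact EReal.neg_le_of_neg_le hω)] with ω hω
    exact EReal.neg_le_of_neg_le hω

end EssInf

/-! ### Conditional expectations and conditional `Lᵖ` spaces -/

section Conditional

variable {Ω : Type*}

/-- Generalized conditional expectation `E_Q[f | m] = E_Q[f⁺ | m] - E_Q[f⁻ | m]` of an extended
random variable, with the convention `∞ - ∞ = -∞` (which is that of `EReal`). -/
def condE (m : MeasurableSpace Ω) {m0 : MeasurableSpace Ω} (Q : Measure Ω) (f : Ω → EReal) :
    Ω → EReal := fun ω =>
  (condLExp m Q (fun ω => (f ω).toENNReal) ω : EReal) -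
    (condLExp m Q (fun ω => (-f ω).toENNReal) ω : EReal)

/-- For nonnegative `ξ`: the conditional norm satisfies `‖f‖_{m,p} ≤ ξ` a.s., where
`‖f‖_{m,p} = E[|f|ᵖ | m]^{1/p}` for `p < ∞`, and `‖f‖_{m,∞}` is the smallest `m`-measurable
random variable that dominates `|f|`. -/
def CondNormLE (m : MeasurableSpace Ω) {m0 : MeasurableSpace Ω} (P : Measure Ω) (p : ℝ≥0∞)
    (f ξ : Ω → ℝ) : Prop :=
  (p = ∞ → ∀ᵐ ω ∂P, |f ω| ≤ ξ ω) ∧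
  (p ≠ ∞ → ∀ᵐ ω ∂P, condLExp m P (fun ω => ENNReal.ofReal |f ω| ^ p.toReal) ω ≤
      ENNReal.ofReal (ξ ω) ^ p.toReal)

/-- The conditional norm `‖f‖_{m,p}` is a.s. finite. -/
def MemCondLp (m : MeasurableSpace Ω) {m0 : MeasurableSpace Ω} (P : Measure Ω) (p : ℝ≥0∞)
    (f : Ω → ℝ) : Prop :=
  ∃ ξ : Ω → ℝ, Measurable[m] ξ ∧ (∀ ω, 0 ≤ ξ ω) ∧ CondNormLE m P p f ξ

end Conditional

/-! ### Processes on `{0, …, T}`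

A process is a map `X : ℕ → Ω → ℝ`, of which only the values at times `0, …, T` matter. -/

section Processes

variable {Ω : Type*} {m0 : MeasurableSpace Ω}

/-- `X` is adapted up to time `T`. -/
def AdaptedUpTo (𝓕 : Filtration ℕ m0) (T : ℕ) (X : ℕ → Ω → ℝ) : Prop :=
  ∀ s ≤ T, Measurable[𝓕 s] (X s)

/-- `V` gives a path `V_{[0,t-1]}` of an adapted process before time `t`. -/
def IsPast (𝓕 : Filtration ℕ m0) (t : ℕ) (V : ℕ → Ω → ℝ) : Prop :=
  ∀ s < t, Measurable[𝓕 s] (V s)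

/-- `V_{[t,T]}` belongs to the conditional space `L^{t,p}(𝒪_{[t,T]})`. -/
def MemFuture (𝓕 : Filtration ℕ m0) (P : Measure Ω) (T : ℕ) (p : ℝ≥0∞) (t : ℕ)
    (V : ℕ → Ω → ℝ) : Prop :=
  ∀ s, t ≤ s → s ≤ T → Measurable[𝓕 s] (V s) ∧ MemCondLp (𝓕 t) P p (V s)

/-- `V_{[t,T]}` belongs to the (unconditional) space `L^p(𝒪_{[t,T]})`. -/
def MemFutureLp (𝓕 : Filtration ℕ m0) (P : Measure Ω) (T : ℕ) (p : ℝ≥0∞) (t : ℕ)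
    (V : ℕ → Ω → ℝ) : Prop :=
  ∀ s, t ≤ s → s ≤ T → Measurable[𝓕 s] (V s) ∧ MemLp (V s) p P

/-- The space `𝒳ₜᵖ`. -/
def MemX (𝓕 : Filtration ℕ m0) (P : Measure Ω) (T : ℕ) (p : ℝ≥0∞) (t : ℕ)
    (X : ℕ → Ω → ℝ) : Prop :=
  AdaptedUpTo 𝓕 T X ∧ MemFuture 𝓕 P T p t X

/-- The process `X_{[0,t-1]} + V_{[t,T]}`. -/
def glue (t : ℕ) (X V : ℕ → Ω → ℝ) : ℕ → Ω → ℝ := fun s => if s < t then X s else V s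

/-- The constant-in-time process with value `m`; glued at `t` it gives `m 1_{[t,T]}`. -/
def cash (m : Ω → ℝ) : ℕ → Ω → ℝ := fun _ => m

/-- The duality `E[∑_{s=t}^T Z_s V_s | 𝓕ₜ]` between `L^{t,1}(𝒪_{[t,T]})` and
`L^{t,∞}(𝒪_{[t,T]})`. -/
def pairing (𝓕 : Filtration ℕ m0) (P : Measure Ω) (T t : ℕ) (Z V : ℕ → Ω → ℝ) : Ω → ℝ := fun ω =>
  (condE (𝓕 t) P (fun ω => ((∑ s ∈ Finset.Icc t T, Z s ω * V s ω : ℝ) : EReal)) ω).toReal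

/-- `𝒜` is closed in `L^{t,p}(𝒪_{[t,T]})`, for the topology of the conditional norm
`‖·‖_{t,p}` if `p < ∞`, and for the conditional weak* topology
`σ(L^{t,∞}, L^{t,1})` if `p = ∞`. Neighbourhoods have radii `ε ∈ L⁰₊₊(𝓕ₜ)`. -/
def IsCondClosed (𝓕 : Filtration ℕ m0) (P : Measure Ω) (T : ℕ) (p : ℝ≥0∞) (t : ℕ)
    (𝒜 : Set (ℕ → Ω → ℝ)) : Prop :=
  ∀ V, MemFuture 𝓕 P T p t V →
    (p ≠ ∞ → ∀ ε : Ω → ℝ, Measurable[𝓕 t] ε → (∀ ω, 0 < ε ω) →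
      ∃ U ∈ 𝒜, MemFuture 𝓕 P T p t U ∧
        ∀ s, t ≤ s → s ≤ T → CondNormLE (𝓕 t) P p (fun ω => U s ω - V s ω) ε) →
    (p = ∞ → ∀ (n : ℕ) (Z : Fin n → ℕ → Ω → ℝ), (∀ i, MemFuture 𝓕 P T 1 t (Z i)) →
      ∀ ε : Ω → ℝ, Measurable[𝓕 t] ε → (∀ ω, 0 < ε ω) →
      ∃ U ∈ 𝒜, MemFuture 𝓕 P T p t U ∧
        ∀ i, ∀ᵐ ω ∂P, |pairing 𝓕 P T t (Z i) (fun s ω => U s ω - V s ω) ω| ≤ ε ω) →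
    V ∈ 𝒜

end Processes

/-! ### Assessment indices -/

section Indices

variable {Ω : Type*} {m0 : MeasurableSpace Ω}

/-- `φ` is an upper semicontinuous conditional assessment index on the `L⁰(𝓕ₜ)`-module
`L^{t,p}(𝒪_{[t,T]})` ordered by a.s. dominance, with values in `L̄⁰(𝓕ₜ)`. Locality is written as
"if two elements agree on `A`, so do the values", which contains invariance under
a.s. equality. -/
structure IsUSCAssessmentIndex (𝓕 : Filtration ℕ m0) (P : Measure Ω) (T : ℕ) (p : ℝ≥0∞) (t : ℕ)
    (φ : (ℕ → Ω → ℝ) → Ω → EReal) : Prop where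
  measurable : ∀ V, MemFuture 𝓕 P T p t V → Measurable[𝓕 t] (φ V)
  localProp : ∀ V W, MemFuture 𝓕 P T p t V → MemFuture 𝓕 P T p t W →
    ∀ A, MeasurableSet[𝓕 t] A →
      (∀ s, t ≤ s → s ≤ T → ∀ᵐ ω ∂P, ω ∈ A → V s ω = W s ω) →
      ∀ᵐ ω ∂P, ω ∈ A → φ V ω = φ W ω
  quasiconcave : ∀ V W, MemFuture 𝓕 P T p t V → MemFuture 𝓕 P T p t W →
    ∀ l : Ω → ℝ, Measurable[𝓕 t] l → (∀ ω, 0 ≤ l ω ∧ l ω ≤ 1) →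
      ∀ᵐ ω ∂P, min (φ V ω) (φ W ω) ≤ φ (fun s ω => l ω * V s ω + (1 - l ω) * W s ω) ω
  monotone : ∀ V W, MemFuture 𝓕 P T p t V → MemFuture 𝓕 P T p t W →
    (∀ s, t ≤ s → s ≤ T → W s ≤ᵐ[P] V s) → φ W ≤ᵐ[P] φ V
  usc : ∀ a : Ω → EReal, Measurable[𝓕 t] a → IsCondClosed 𝓕 P T p t {V | a ≤ᵐ[P] φ V}

/-- The certainty-equivalent assumptions on `φ` in the direction of the cash position `1_{[t,T]}`:
boundedness (with bounds in `L^p(𝓕ₜ)` for positions in `L^p`), strict monotonicity,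
sensitivity. -/
structure HasCertaintyAssumptions (𝓕 : Filtration ℕ m0) (P : Measure Ω) (T : ℕ) (p : ℝ≥0∞) (t : ℕ)
    (φ : (ℕ → Ω → ℝ) → Ω → EReal) : Prop where
  bounded : ∀ V, MemFutureLp 𝓕 P T p t V → ∃ m₁ m₂ : Ω → ℝ,
    Measurable[𝓕 t] m₁ ∧ MemLp m₁ p P ∧ Measurable[𝓕 t] m₂ ∧ MemLp m₂ p P ∧
      ∀ᵐ ω ∂P, φ (cash m₁) ω < φ V ω ∧ φ V ω ≤ φ (cash m₂) ω
  strictlyIncreasing : ∀ m m' : Ω → ℝ, Measurable[𝓕 t] m → Measurable[𝓕 t] m' →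
    ∀ A, MeasurableSet[𝓕 t] A → (∀ᵐ ω ∂P, ω ∈ A → m' ω < m ω) →
      ∀ᵐ ω ∂P, ω ∈ A → φ (cash m') ω < φ (cash m) ω
  sensitive : ∀ (m : Ω → ℝ) V, Measurable[𝓕 t] m → MemFuture 𝓕 P T p t V →
    ∀ A, MeasurableSet[𝓕 t] A → (∀ᵐ ω ∂P, ω ∈ A → φ V ω < φ (cash m) ω) →
      ∃ ε : Ω → ℝ, Measurable[𝓕 t] ε ∧ (∀ ω, 0 ≤ ε ω) ∧ (∀ᵐ ω ∂P, ω ∈ A → 0 < ε ω) ∧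
        ∀ᵐ ω ∂P, ω ∈ A → φ V ω ≤ φ (cash fun ω => m ω - ε ω) ω

/-- `a : 𝒳ₜᵖ → L̄⁰(𝓕ₜ)` is an upper semicontinuous path dependent assessment index. The first
field says that `a` is a function of classes of processes modulo a.s. equality. -/
structure IsPathDependentIndex (𝓕 : Filtration ℕ m0) (P : Measure Ω) (T : ℕ) (p : ℝ≥0∞) (t : ℕ)
    (a : (ℕ → Ω → ℝ) → Ω → EReal) : Prop where
  congr : ∀ X Y, MemX 𝓕 P T p t X → MemX 𝓕 P T p t Y → (∀ s ≤ T, X s =ᵐ[P] Y s) → a X =ᵐ[P] a Y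
  index : ∀ X, IsPast 𝓕 t X → IsUSCAssessmentIndex 𝓕 P T p t (fun V => a (glue t X V))

/-- Strong time consistency of a dynamic path dependent assessment index. -/
def StronglyTimeConsistent (𝓕 : Filtration ℕ m0) (P : Measure Ω) (T : ℕ) (p : ℝ≥0∞)
    (α : ℕ → (ℕ → Ω → ℝ) → Ω → EReal) : Prop :=
  ∀ t < T, ∀ X Y, MemX 𝓕 P T p t X → MemX 𝓕 P T p t Y → (∀ s ≤ t, X s =ᵐ[P] Y s) →
    α (t + 1) Y ≤ᵐ[P] α (t + 1) X → α t Y ≤ᵐ[P] α t X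

/-- The certainty equivalent
`Cₜ(X) = essinf {m ∈ L⁰(𝓕ₜ) : αₜ(X_{[0,t-1]} + m 1_{[t,T]}) ≥ αₜ(X)}`. -/
def certEquiv (𝓕 : Filtration ℕ m0) (P : Measure Ω) (α : ℕ → (ℕ → Ω → ℝ) → Ω → EReal) (t : ℕ)
    (X : ℕ → Ω → ℝ) : Ω → EReal :=
  essInf (𝓕 t) P {g | ∃ m : Ω → ℝ, Measurable[𝓕 t] m ∧ α t X ≤ᵐ[P] α t (glue t X (cash m)) ∧
    g = fun ω => (m ω : EReal)}

end Indices

/-! ### One-step measures, minimal risk functions, and the recursion -/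

section Recursion

variable {Ω : Type*} {m0 : MeasurableSpace Ω}

/-- A pair `(Q, D)`, where `Q` is given through its density `Z = dQ/dP`. -/
structure QD (Ω : Type*) where
  /-- the density of `Q` -/
  Z : Ω → ℝ
  /-- the one-step discount factor -/
  D : Ω → ℝ

/-- The measure `Q` with density `Z`. -/
def QD.Q (w : QD Ω) (P : Measure Ω) : Measure Ω := P.withDensity fun ω => ENNReal.ofReal (w.Z ω)

/-- The measure `Q ⊗ D` on `Ω × {t, t+1}`, as its density `(1 - D, Z D)` with respect to the product
of `P` and the counting measure. -/
def QD.tensor (w : QD Ω) : Ω → ℝ × ℝ := fun ω => (1 - w.D ω, w.Z ω * w.D ω)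

/-- The pairs `(Q, D)` at time `t`. For `t < T`: `Q` is a probability measure on `𝓕_{t+1}`,
absolutely continuous with respect to `P`, equal to `P` on `𝓕ₜ`, whose density has finite
conditional `q`-norm given `𝓕ₜ`, and `D` is `𝓕ₜ`-measurable with `0 ≤ D ≤ 1`.
For `t = T` the set consists of one trivial element. -/
def MD (𝓕 : Filtration ℕ m0) (P : Measure Ω) (T : ℕ) (q : ℝ≥0∞) (t : ℕ) : Set (QD Ω) :=
  {w | if t < T then
      Measurable[𝓕 (t + 1)] w.Z ∧ (∀ ω, 0 ≤ w.Z ω) ∧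
      (∀ A, MeasurableSet[𝓕 t] A → w.Q P A = P A) ∧ MemCondLp (𝓕 t) P q w.Z ∧
      Measurable[𝓕 t] w.D ∧ (∀ ω, 0 ≤ w.D ω ∧ w.D ω ≤ 1)
    else w = ⟨fun _ => 1, fun _ => 1⟩}

/-- `E_Q[D (Y - x) + x | 𝓕ₜ]`. -/
def QD.expect (w : QD Ω) (𝓕 : Filtration ℕ m0) (P : Measure Ω) (t : ℕ) (x : Ω → ℝ)
    (Y : Ω → EReal) : Ω → EReal :=
  condE (𝓕 t) (w.Q P) fun ω => (w.D ω : EReal) * (Y ω - (x ω : EReal)) + (x ω : EReal)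

/-- The right-continuous version of `G : L̄⁰(m) → L̄⁰(m)`. -/
def rightVersion (m : MeasurableSpace Ω) {m0 : MeasurableSpace Ω} (P : Measure Ω)
    (G : (Ω → EReal) → Ω → EReal) (s : Ω → EReal) : Ω → EReal := fun ω =>
  open Classical in
  if s ω < ⊤ then
    essInf m P {g | ∃ n : Ω → EReal, Measurable[m] n ∧ (∀ᵐ ω ∂P, s ω < ⊤ → s ω < n ω) ∧ g = G n} ω
  else ⊤

/-- The left-continuous version of `G : L̄⁰(m) → L̄⁰(m)`. -/
def leftVersion (m : MeasurableSpace Ω) {m0 : MeasurableSpace Ω} (P : Measure Ω)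
    (G : (Ω → EReal) → Ω → EReal) (s : Ω → EReal) : Ω → EReal := fun ω =>
  open Classical in
  if ⊥ < s ω then
    essSup m P {g | ∃ n : Ω → EReal, Measurable[m] n ∧ (∀ᵐ ω ∂P, ⊥ < s ω → n ω < s ω) ∧ g = G n} ω
  else ⊥

/-- `x ∈ L⁰(𝓕ₜ)` and `Y ∈ L^{t,p}(𝓕_{t+1})`. -/
def MemTwoStep (𝓕 : Filtration ℕ m0) (P : Measure Ω) (p : ℝ≥0∞) (t : ℕ) (x Y : Ω → ℝ) : Prop :=
  Measurable[𝓕 t] x ∧ Measurable[𝓕 (t + 1)] Y ∧ MemCondLp (𝓕 t) P p Y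

/-- `ρ` is a conditional minimal risk function on the normalized polar cone `𝓜𝓓_t^{t+1}` of the
`L⁰(𝓕ₜ)`-module of the two-step positions `(x, Y)`, `x ∈ L⁰(𝓕ₜ)`, `Y ∈ L^{t,p}(𝓕_{t+1})`, under the
duality `⟨Q ⊗ D, (x, Y)⟩ = E_Q[D (Y - x) + x | 𝓕ₜ]`. -/
structure IsMinimalRiskFunction (𝓕 : Filtration ℕ m0) (P : Measure Ω) (T : ℕ) (p q : ℝ≥0∞) (t : ℕ)
    (ρ : (Ω → ℝ × ℝ) → (Ω → EReal) → Ω → EReal) : Prop where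
  measurable : ∀ w ∈ MD 𝓕 P T q t, ∀ s, Measurable[𝓕 t] s → Measurable[𝓕 t] (ρ w.tensor s)
  /-- joint locality -/
  localProp : ∀ w ∈ MD 𝓕 P T q t, ∀ w' ∈ MD 𝓕 P T q t, ∀ s s', Measurable[𝓕 t] s →
    Measurable[𝓕 t] s' → ∀ A, MeasurableSet[𝓕 t] A →
      (∀ᵐ ω ∂P, ω ∈ A → w.tensor ω = w'.tensor ω ∧ s ω = s' ω) →
      ∀ᵐ ω ∂P, ω ∈ A → ρ w.tensor s ω = ρ w'.tensor s' ω
  increasing : ∀ w ∈ MD 𝓕 P T q t, ∀ s s', Measurable[𝓕 t] s → Measurable[𝓕 t] s' →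
    s ≤ᵐ[P] s' → ρ w.tensor s ≤ᵐ[P] ρ w.tensor s'
  rightContinuous : ∀ w ∈ MD 𝓕 P T q t, ∀ s, Measurable[𝓕 t] s →
    ρ w.tensor s =ᵐ[P] rightVersion (𝓕 t) P (ρ w.tensor) s
  /-- joint quasiconvexity -/
  quasiconvex : ∀ w ∈ MD 𝓕 P T q t, ∀ w' ∈ MD 𝓕 P T q t, ∀ w'' ∈ MD 𝓕 P T q t,
    ∀ s s', Measurable[𝓕 t] s → Measurable[𝓕 t] s' →
    ∀ l : Ω → ℝ, Measurable[𝓕 t] l → (∀ ω, 0 ≤ l ω ∧ l ω ≤ 1) →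
      (∀ᵐ ω ∂P, w''.tensor ω = l ω • w.tensor ω + (1 - l ω) • w'.tensor ω) →
      ∀ᵐ ω ∂P, ρ w''.tensor
          (fun ω => (l ω : EReal) * s ω + ((1 - l ω : ℝ) : EReal) * s' ω) ω ≤
        max (ρ w.tensor s ω) (ρ w'.tensor s' ω)
  /-- uniform asymptotic maximum -/
  asymptoticMax : ∀ w ∈ MD 𝓕 P T q t, ∀ w' ∈ MD 𝓕 P T q t,
    essSup (𝓕 t) P {g | ∃ s : Ω → ℝ, Measurable[𝓕 t] s ∧ g = ρ w.tensor fun ω => (s ω : EReal)}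
      =ᵐ[P]
    essSup (𝓕 t) P {g | ∃ s : Ω → ℝ, Measurable[𝓕 t] s ∧ g = ρ w'.tensor fun ω => (s ω : EReal)}
  /-- joint lower semicontinuity of the left-continuous version, for the conditional weak topology
  on the measures `Q ⊗ D` and the `L⁰`-topology on the second argument -/
  lsc : ∀ a : Ω → EReal, Measurable[𝓕 t] a →
    ∀ w ∈ MD 𝓕 P T q t, ∀ s : Ω → ℝ, Measurable[𝓕 t] s →
    (∀ (n : ℕ) (x Y : Fin n → Ω → ℝ), (∀ i, MemTwoStep 𝓕 P p t (x i) (Y i)) →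
      ∀ ε : Ω → ℝ, Measurable[𝓕 t] ε → (∀ ω, 0 < ε ω) →
      ∃ w' ∈ MD 𝓕 P T q t, ∃ s' : Ω → ℝ, Measurable[𝓕 t] s' ∧
        (∀ i, ∀ᵐ ω ∂P, |(w'.expect 𝓕 P t (x i) (fun ω => (Y i ω : EReal)) ω).toReal -
            (w.expect 𝓕 P t (x i) (fun ω => (Y i ω : EReal)) ω).toReal| ≤ ε ω) ∧
        (∀ᵐ ω ∂P, |s' ω - s ω| ≤ ε ω) ∧
        leftVersion (𝓕 t) P (ρ w'.tensor) (fun ω => (s' ω : EReal)) ≤ᵐ[P] a) →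
    leftVersion (𝓕 t) P (ρ w.tensor) (fun ω => (s ω : EReal)) ≤ᵐ[P] a

/-- The process `X_{[0,t-1]} + x 1_{{t}} + Y 1_{[t+1,T]}`. -/
def twoStep (t : ℕ) (X : ℕ → Ω → ℝ) (x Y : Ω → ℝ) : ℕ → Ω → ℝ :=
  fun s => if s < t then X s else if s = t then x else Y

/-- `R t X (Q ⊗ D) s` is the one-step minimal risk function
`R_{t,t+1}(X_{[0,t-1]}, Q ⊗ D, s)` corresponding to `Cₜ`: it depends on `X` through
`X_{[0,t-1]}` only, it is a minimal risk function for every past path, and it represents `Cₜ` on the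
two-step positions. -/
structure IsOneStepRisk (𝓕 : Filtration ℕ m0) (P : Measure Ω) (T : ℕ) (p q : ℝ≥0∞)
    (C : ℕ → (ℕ → Ω → ℝ) → Ω → EReal)
    (R : ℕ → (ℕ → Ω → ℝ) → (Ω → ℝ × ℝ) → (Ω → EReal) → Ω → EReal) : Prop where
  past : ∀ t < T, ∀ X X', IsPast 𝓕 t X → IsPast 𝓕 t X' → (∀ s < t, X s =ᵐ[P] X' s) →
    ∀ w ∈ MD 𝓕 P T q t, ∀ s, Measurable[𝓕 t] s → R t X w.tensor s =ᵐ[P] R t X' w.tensor s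
  minimal : ∀ t < T, ∀ X, IsPast 𝓕 t X → IsMinimalRiskFunction 𝓕 P T p q t (R t X)
  represents : ∀ t < T, ∀ X, IsPast 𝓕 t X → ∀ x Y, MemTwoStep 𝓕 P p t x Y →
    IsEssInf (𝓕 t) P
      {g | ∃ w ∈ MD 𝓕 P T q t,
        g = R t X w.tensor (w.expect 𝓕 P t x fun ω => (Y ω : EReal))}
      (C t (twoStep t X x Y))

/-- Backward recursion with `n = T - t` remaining steps:
`F_T(Q ⊗ D, X) = X_T` and `F_t(Q ⊗ D, X) =
essinf_{Q' ⊗ D'} R_{t,t+1}(X_{[0,t-1]}, Q ⊗ D, E_Q[D (F_{t+1}(Q' ⊗ D', X) - X_t) + X_t | 𝓕ₜ])`. -/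
def recF (𝓕 : Filtration ℕ m0) (P : Measure Ω) (T : ℕ) (q : ℝ≥0∞)
    (R : ℕ → (ℕ → Ω → ℝ) → (Ω → ℝ × ℝ) → (Ω → EReal) → Ω → EReal) (X : ℕ → Ω → ℝ) :
    (n : ℕ) → (t : ℕ) → QD Ω → Ω → EReal
  | 0, t, _ => fun ω => (X t ω : EReal)
  | n + 1, t, w => essInf (𝓕 t) P
      {g | ∃ w' ∈ MD 𝓕 P T q (t + 1),
        g = R t X w.tensor (w.expect 𝓕 P t (X t) (recF 𝓕 P T q R X n (t + 1) w'))}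

/-- `F_t(Q ⊗ D, X)`, for `t ≤ T`. -/
def FVal (𝓕 : Filtration ℕ m0) (P : Measure Ω) (T : ℕ) (q : ℝ≥0∞)
    (R : ℕ → (ℕ → Ω → ℝ) → (Ω → ℝ × ℝ) → (Ω → EReal) → Ω → EReal) (t : ℕ) (w : QD Ω)
    (X : ℕ → Ω → ℝ) : Ω → EReal :=
  recF 𝓕 P T q R X (T - t) t w

end Recursion

end DynIndex

end

/-! Certainty equivalents translate indices into cash. Boundedness, upper semicontinuity and
sensitivity make `C_t(X)` a real random variable, as integrable as the position, and cash of this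
amount is exactly as good as `X` (`exists_certainty`). Strong time consistency then allows the
future of `X` from `t + 1` on to be replaced by its certainty equivalent `y` at `t + 1` without
changing `C_t` (`certEquiv_eq_twoStep`). So `C_t(X)` is the value of the two-step position `(X_t,
y)`, to which the one-step representation applies.

The recursion then asks whether the infimum that produces `y` may be moved inside the expectation
and inside `R`. Monotonicity gives one inequality. For the other, near-minimizers are pasted along a
countable 𝓕_{t+1}-partition into one pair with value at most `y + ε`; the price rises by at most
`ε`, and right continuity of `R` absorbs it (`recF_succ_eq`). Backward induction concludes
(`isEssInf_recF_certEquiv`).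

For existence, the risk of `Q ⊗ D` at level `s` is the right-continuous version of the supremum of
`C_t` over the positions with price below `s`. The axioms of a minimal risk function follow formally
(`isMinimalRiskFunction_risk`). The representation needs a separation: a position with `C_t < a` on
a set has to be separated, on a non-null part of it, from the positions at least as good as cash `a`
(`isEssInf_risk`). Those in `Lᵖ` form a convex, upward closed set, and Hahn–Banach separates in the
mean (`exists_densities`): by `L^q` densities if `p < ∞`, and through finitely many conditional
functionals with values in `L²` if `p = ∞`. Locality upgrades this to a conditional separation
(`exists_conditional_separation`), and normalizing the densities yields a one-step measure
(`exists_MD_of_lt`).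

Conditional spaces are handled throughout by cutting into countably many pieces on which ordinary
`Lᵖ` theory applies (`memCondLp_iff`) and pasting by locality. -/

namespace DynIndex

section Tools

variable {Ω : Type*} {m m' m0 : MeasurableSpace Ω} {P : Measure Ω}

/-! ### Countable concatenations -/

theorem exists_measurable_index {B : ℕ → Set Ω} (hB : ∀ j, MeasurableSet[m] (B j))
    (h : ∀ᵐ ω ∂P, ∃ j, ω ∈ B j) :
    ∃ j : Ω → ℕ, Measurable[m] j ∧ ∀ᵐ ω ∂P, ω ∈ B (j ω) := by
  classical
  -- The second alternative makes the search for a least index total: on the exceptional null set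
  -- every `N` qualifies and the index is 0.
  have hp : ∀ ω, ∃ N, ω ∈ B N ∨ ∀ k, ω ∉ B k := fun ω => by
    by_cases h : ∃ k, ω ∈ B k
    · exact h.imp fun k hk => Or.inl hk
    · exact ⟨0, Or.inr (not_exists.1 h)⟩
  refine ⟨fun ω => Nat.find (hp ω), ?_, ?_⟩
  · refine @measurable_find Ω m _ _ hp fun k => ?_
    have : {ω | ω ∈ B k ∨ ∀ k, ω ∉ B k} = B k ∪ ⋂ k, (B k)ᶜ := by
      ext ω; simp
    rw [this]
    exact (hB k).union (MeasurableSet.iInter fun k => (hB k).compl)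
  · filter_upwards [h] with ω hω
    rcases Nat.find_spec (hp ω) with h | h
    · exact h
    · exact absurd hω (not_exists.2 h)

theorem measurableSet_index {j : Ω → ℕ} (hj : Measurable[m] j) (n : ℕ) :
    MeasurableSet[m] {ω | j ω = n} := hj (measurableSet_singleton n)

theorem measurableSet_index_le {j : Ω → ℕ} (hj : Measurable[m] j) (n : ℕ) :
    MeasurableSet[m] {ω | j ω ≤ n} := hj measurableSet_Iic

/-- The partition is measurable for the smaller σ-algebra, the pieces only for the larger one, as
when 𝓕_{t+1}-measurable positions are pasted along 𝓕ₜ-measurable sets. -/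
theorem measurable_concat {β : Type*} [MeasurableSpace β] (hm : m ≤ m') {j : Ω → ℕ}
    (hj : Measurable[m] j) {f : ℕ → Ω → β} (hf : ∀ n, Measurable[m'] (f n)) :
    Measurable[m'] fun ω => f (j ω) ω := by
  intro S hS
  have : (fun ω => f (j ω) ω) ⁻¹' S = ⋃ n, {ω | j ω = n} ∩ f n ⁻¹' S := by
    ext ω; simp
  rw [this]
  exact MeasurableSet.iUnion fun n => (hm _ (measurableSet_index hj n)).inter (hf n hS)

/-- To prove a property almost surely it suffices to do so on each piece of a countable
partition. -/
theorem ae_of_index (j : Ω → ℕ) {p : Ω → Prop} (h : ∀ n, ∀ᵐ ω ∂P, j ω = n → p ω) :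
    ∀ᵐ ω ∂P, p ω := by
  filter_upwards [ae_all_iff.2 h] with ω hω
  exact hω _ rfl

/-- The first rational, in a fixed enumeration, that fits strictly in between. It replaces extended
levels by finite ones, which can be compared with prices and subtracted. -/
theorem exists_measurable_between {s n : Ω → EReal} (hs : Measurable[m] s)
    (hn : Measurable[m] n) :
    ∃ r : Ω → ℝ, Measurable[m] r ∧ ∀ ω, s ω < n ω → s ω < r ω ∧ (r ω : EReal) < n ω := by
  obtain ⟨q, hq⟩ := exists_surjective_nat ℚ
  have hmeas : ∀ j, MeasurableSet[m] {ω | s ω < n ω → s ω < ((q j : ℝ) : EReal) ∧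
      ((q j : ℝ) : EReal) < n ω} := fun j => by
    have : {ω | s ω < n ω → s ω < ((q j : ℝ) : EReal) ∧ ((q j : ℝ) : EReal) < n ω} =
      {ω | s ω < n ω}ᶜ ∪ ({ω | s ω < ((q j : ℝ) : EReal)} ∩
        {ω | ((q j : ℝ) : EReal) < n ω}) := by
      ext ω; simp [imp_iff_not_or]
    rw [this]
    exact (measurableSet_lt hs hn).compl.union
      ((measurableSet_lt hs measurable_const).inter (measurableSet_lt measurable_const hn))
  have hex : ∀ ω, ∃ j, ω ∈ {ω | s ω < n ω → s ω < ((q j : ℝ) : EReal) ∧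
      ((q j : ℝ) : EReal) < n ω} := fun ω => by
    by_cases h : s ω < n ω
    · obtain ⟨r, hr1, hr2⟩ := EReal.lt_iff_exists_rat_btwn.1 h
      obtain ⟨j, rfl⟩ := hq r
      exact ⟨j, fun _ => ⟨hr1, hr2⟩⟩
    · exact ⟨0, fun h' => absurd h' h⟩
  classical
  refine ⟨fun ω => (q (Nat.find (hex ω)) : ℝ), ?_, fun ω => Nat.find_spec (hex ω)⟩
  have h1 : Measurable[m] fun ω => Nat.find (hex ω) := @measurable_find Ω m _ _ hex hmeas
  exact (measurable_from_top (f := fun i : ℕ => ((q i : ℚ) : ℝ))).comp h1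

/-! ### Essential infima and suprema -/

theorem IsEssInf.unique {S : Set (Ω → EReal)} {g g' : Ω → EReal} (h : IsEssInf m P S g)
    (h' : IsEssInf m P S g') : g =ᵐ[P] g' :=
  (h'.2.2 g h.1 h.2.1).antisymm (h.2.2 g' h'.1 h'.2.1)

theorem isEssInf_essInf [IsProbabilityMeasure P] (hm : m ≤ m0) {S : Set (Ω → EReal)}
    (hS : ∀ f ∈ S, Measurable[m] f) : IsEssInf m P S (essInf m P S) :=
  Classical.epsilon_spec (exists_isEssInf m P hm S hS)

theorem isEssSup_essSup [IsProbabilityMeasure P] (hm : m ≤ m0) {S : Set (Ω → EReal)}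
    (hS : ∀ f ∈ S, Measurable[m] f) : IsEssSup m P S (essSup m P S) :=
  Classical.epsilon_spec (exists_isEssSup m P hm S hS)

/-- Families that are a.s. coinitial in each other have the same lower bounds. -/
theorem IsEssInf.congr {S S' : Set (Ω → EReal)} {g g' : Ω → EReal} (h : IsEssInf m P S g)
    (hg' : Measurable[m] g') (hg : g =ᵐ[P] g') (h1 : ∀ f ∈ S', ∃ f' ∈ S, f' ≤ᵐ[P] f)
    (h2 : ∀ f ∈ S, ∃ f' ∈ S', f' ≤ᵐ[P] f) : IsEssInf m P S' g' := by
  refine ⟨hg', fun f hf => ?_, fun k hk hkf => ?_⟩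
  · obtain ⟨f', hf', hle⟩ := h1 f hf
    exact hg.symm.le.trans ((h.2.1 f' hf').trans hle)
  · refine (h.2.2 k hk fun f hf => ?_).trans hg.le
    obtain ⟨f', hf', hle⟩ := h2 f hf
    exact (hkf f' hf').trans hle

/-- An upper bound on a set of positive measure, valid off that set for trivial reasons. -/
theorem IsEssSup.le_on {S : Set (Ω → EReal)} {g h : Ω → EReal} (hg : IsEssSup m P S g)
    {A : Set Ω} (hA : MeasurableSet[m] A) (hh : Measurable[m] h)
    (H : ∀ f ∈ S, ∀ᵐ ω ∂P, ω ∈ A → f ω ≤ h ω) : ∀ᵐ ω ∂P, ω ∈ A → g ω ≤ h ω := by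
  classical
  have := hg.2.2 (A.piecewise h fun _ => ⊤) (hh.piecewise hA measurable_const) fun f hf => by
    filter_upwards [H f hf] with ω hω
    by_cases hωA : ω ∈ A <;> simp [hωA, hω]
  filter_upwards [this] with ω hω hωA
  simpa [hωA] using hω

theorem IsEssInf.ge_on {S : Set (Ω → EReal)} {g h : Ω → EReal} (hg : IsEssInf m P S g)
    {A : Set Ω} (hA : MeasurableSet[m] A) (hh : Measurable[m] h)
    (H : ∀ f ∈ S, ∀ᵐ ω ∂P, ω ∈ A → h ω ≤ f ω) : ∀ᵐ ω ∂P, ω ∈ A → h ω ≤ g ω := by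
  classical
  have := hg.2.2 (A.piecewise h fun _ => ⊥) (hh.piecewise hA measurable_const) fun f hf => by
    filter_upwards [H f hf] with ω hω
    by_cases hωA : ω ∈ A <;> simp [hωA, hω]
  filter_upwards [this] with ω hω hωA
  simpa [hωA] using hω

/-- For fixed `f'`, every `f` is at least `h` where `f' < h`, hence so is `g`; then the same
argument runs over `f'`. This carries quasiconvexity through two independent essential infima. -/
theorem le_max_essInf {S S' : Set (Ω → EReal)} {g g' h : Ω → EReal} (hg : IsEssInf m P S g)
    (hg' : IsEssInf m P S' g') (hS' : ∀ f ∈ S', Measurable[m] f) {A : Set Ω}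
    (hA : MeasurableSet[m] A) (hh : Measurable[m] h)
    (H : ∀ f ∈ S, ∀ f' ∈ S', ∀ᵐ ω ∂P, ω ∈ A → h ω ≤ max (f ω) (f' ω)) :
    ∀ᵐ ω ∂P, ω ∈ A → h ω ≤ max (g ω) (g' ω) := by
  have h1 : ∀ f' ∈ S', ∀ᵐ ω ∂P, ω ∈ A → h ω ≤ max (g ω) (f' ω) := fun f' hf' => by
    have := hg.ge_on (hA.inter (measurableSet_lt (hS' f' hf') hh)) hh fun f hf => by
      filter_upwards [H f hf f' hf'] with ω hω hωA
      exact (le_max_iff.1 (hω hωA.1)).resolve_right (not_le.2 hωA.2)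
    filter_upwards [this] with ω hω hωA
    by_cases hlt : f' ω < h ω
    · exact (hω ⟨hωA, hlt⟩).trans (le_max_left _ _)
    · exact (not_lt.1 hlt).trans (le_max_right _ _)
  have := hg'.ge_on (hA.inter (measurableSet_lt hg.1 hh)) hh fun f' hf' => by
      filter_upwards [h1 f' hf'] with ω hω hωA
      exact (le_max_iff.1 (hω hωA.1)).resolve_left (not_le.2 hωA.2)
  filter_upwards [this] with ω hω hωA
  by_cases hlt : g ω < h ω
  · exact (hω ⟨hωA, hlt⟩).trans (le_max_right _ _)
  · exact (not_lt.1 hlt).trans (le_max_left _ _)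

/-- A family lies above its essential infimum in no uniform way: if `h` exceeds the infimum on a
set, then almost every point of it sees one of countably many members below `h`. -/
theorem IsEssInf.exists_seq_lt [IsFiniteMeasure P] (hm : m ≤ m0) {S : Set (Ω → EReal)}
    {g h : Ω → EReal}
    (hg : IsEssInf m P S g) (hS : ∀ f ∈ S, Measurable[m] f) (hne : S.Nonempty)
    (hh : Measurable[m] h) :
    ∃ f : ℕ → Ω → EReal, (∀ j, f j ∈ S) ∧ ∀ᵐ ω ∂P, g ω < h ω → ∃ j, f j ω < h ω := by
  -- Exhaustion: the selection `G` below maximizes the probability that some member lies under `h`.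
  -- Then no member lies under `h` on a non-null part of the complement, so `h ≤ g` there.
  let μ : (ℕ → S) → ℝ≥0∞ := fun f => P (⋃ j, {ω | (f j : Ω → EReal) ω < h ω})
  obtain ⟨f0, hf0⟩ := hne
  have hmf : ∀ f : S, MeasurableSet[m0] {ω | (f : Ω → EReal) ω < h ω} := fun f =>
    hm _ (measurableSet_lt (hS _ f.2) hh)
  obtain ⟨v, -, hv, hvJ⟩ := exists_seq_tendsto_sSup (S := Set.range μ)
    ⟨_, (fun _ => ⟨f0, hf0⟩), rfl⟩ (OrderTop.bddAbove _)
  choose F hF using hvJ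
  -- Pairing of indices runs through all members of a maximizing sequence of selections, so the
  -- supremum is attained by one selection.
  let G : ℕ → S := fun k => F k.unpair.1 k.unpair.2
  have hFG : ∀ n, μ (F n) ≤ μ G := fun n => measure_mono <| Set.iUnion_subset fun j ω hω =>
    Set.mem_iUnion.2 ⟨Nat.pair n j, by simpa [G] using hω⟩
  have hsup : sSup (Set.range μ) ≤ μ G := le_of_tendsto' hv fun n => by
    rw [← hF n]; exact hFG n
  refine ⟨fun k => G k, fun k => (G k).2, ?_⟩
  let N : Set Ω := (⋃ j, {ω | (G j : Ω → EReal) ω < h ω})ᶜ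
  have hN : MeasurableSet[m] N :=
    (MeasurableSet.iUnion fun j => measurableSet_lt (hS _ (G j).2) hh).compl
  have key := hg.ge_on hN hh fun f hf => by
    let G' : ℕ → S := fun k => Nat.casesOn k ⟨f, hf⟩ G
    have hG' : (⋃ j, {ω | (G' j).1 ω < h ω}) =
        {ω | f ω < h ω} ∪ ⋃ j, {ω | (G j : Ω → EReal) ω < h ω} := by
      ext ω
      simp only [Set.mem_iUnion, Set.mem_ofPred_eq, Set.mem_union]
      constructor
      · rintro ⟨_ | k, hk⟩
        exacts [Or.inl hk, Or.inr ⟨k, hk⟩]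
      · rintro (hk | ⟨k, hk⟩)
        exacts [⟨0, hk⟩, ⟨k + 1, hk⟩]
    have hle : μ G' ≤ μ G := (le_sSup (Set.mem_range_self G')).trans hsup
    have h0 : P ({ω | f ω < h ω} \ ⋃ j, {ω | (G j : Ω → EReal) ω < h ω}) = 0 := by
      have h2 := measure_union_le (μ := P) ({ω | f ω < h ω}) (⋃ j, {ω | (G j : Ω → EReal) ω < h ω})
      have h3 : P (⋃ j, {ω | (G j : Ω → EReal) ω < h ω}) +
          P ({ω | f ω < h ω} \ ⋃ j, {ω | (G j : Ω → EReal) ω < h ω}) ≤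
          P (⋃ j, {ω | (G j : Ω → EReal) ω < h ω}) + 0 := by
        rw [← measure_union' Set.disjoint_sdiff_right (MeasurableSet.iUnion fun j => hmf (G j)),
          Set.union_sdiff_self, Set.union_comm, add_zero, ← hG']
        exact hle
      exact le_zero_iff.1 ((ENNReal.add_le_add_iff_left (measure_ne_top _ _)).1 h3)
    have h1 := measure_eq_zero_iff_ae_notMem.1 h0
    filter_upwards [h1] with ω hω hωN
    by_contra hlt
    exact hω ⟨not_le.1 hlt, hωN⟩
  filter_upwards [key] with ω hω hlt
  by_contra hex
  refine absurd (hω ?_) (not_le.2 hlt)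
  simpa [N] using hex

end Tools

/-! ### Conditional `Lᵖ` spaces by localization -/

section LocLp

variable {Ω : Type*} {m m' m0 : MeasurableSpace Ω} {P : Measure Ω}

/-- `f` belongs to `Lᵖ` on each of countably many `m`-measurable pieces. -/
def LocLp (m : MeasurableSpace Ω) {m0 : MeasurableSpace Ω} (P : Measure Ω) (p : ℝ≥0∞)
    (f : Ω → ℝ) : Prop :=
  ∃ k : Ω → ℕ, Measurable[m] k ∧ ∀ n, MemLp ({ω | k ω ≤ n}.indicator f) p P

variable {p q : ℝ≥0∞} {f g : Ω → ℝ}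

theorem LocLp.of_memLp (hf : MemLp f p P) : LocLp m P p f :=
  ⟨fun _ => 0, measurable_const, fun n => by simpa using hf⟩

theorem LocLp.mono_sigma (hmm : m ≤ m') (h : LocLp m P p f) : LocLp m' P p f := by
  obtain ⟨k, hk, h⟩ := h
  exact ⟨k, hk.mono hmm le_rfl, h⟩

/-- A larger index has smaller sublevel sets, so two localizations are merged by taking the maximum
of their indices. -/
theorem memLp_indicator_le (hm : m ≤ m0) {k l : Ω → ℕ} (hl : Measurable[m] l)
    (hkl : ∀ ω, k ω ≤ l ω) {n : ℕ} (h : MemLp ({ω | k ω ≤ n}.indicator f) p P) :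
    MemLp ({ω | l ω ≤ n}.indicator f) p P := by
  have := h.indicator (hm _ (measurableSet_index_le hl n))
  rwa [Set.indicator_indicator, Set.inter_eq_left.2] at this
  exact fun ω hω => (hkl ω).trans hω

theorem LocLp.add (hm : m ≤ m0) (hf : LocLp m P p f) (hg : LocLp m P p g) :
    LocLp m P p (fun ω => f ω + g ω) := by
  obtain ⟨k, hk, hf⟩ := hf
  obtain ⟨l, hl, hg⟩ := hg
  have hkl : Measurable[m] (k ⊔ l) := hk.sup hl
  refine ⟨k ⊔ l, hkl, fun n => ?_⟩
  have h1 := memLp_indicator_le hm hkl (fun ω => le_max_left _ _) (hf n)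
  have h2 := memLp_indicator_le hm hkl (fun ω => le_max_right _ _) (hg n)
  have := h1.add h2
  rwa [← Set.indicator_add'] at this

theorem LocLp.of_le (hf : AEStronglyMeasurable f P) (hm : m ≤ m0) (hg : LocLp m P p g)
    (h : ∀ᵐ ω ∂P, |f ω| ≤ |g ω|) : LocLp m P p f := by
  obtain ⟨k, hk, hg⟩ := hg
  refine ⟨k, hk, fun n => (hg n).of_le (hf.indicator (hm _ (measurableSet_index_le hk n))) ?_⟩
  filter_upwards [h] with ω hω
  by_cases hk : k ω ≤ n <;> simp [hk, hω]

theorem LocLp.congr (hg : LocLp m P p g) (h : f =ᵐ[P] g) : LocLp m P p f := by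
  obtain ⟨k, hk, hg⟩ := hg
  refine ⟨k, hk, fun n => (memLp_congr_ae ?_).2 (hg n)⟩
  filter_upwards [h] with ω hω
  by_cases hk : k ω ≤ n <;> simp [hk, hω]

theorem LocLp.neg (hg : LocLp m P p g) : LocLp m P p (fun ω => -g ω) := by
  obtain ⟨k, hk, hg⟩ := hg
  refine ⟨k, hk, fun n => ?_⟩
  have := (hg n).neg
  rwa [← Set.indicator_neg'] at this

theorem LocLp.abs (hg : LocLp m P p g) : LocLp m P p (fun ω => |g ω|) := by
  obtain ⟨k, hk, hg⟩ := hg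
  refine ⟨k, hk, fun n => ?_⟩
  convert (hg n).norm using 1
  ext ω
  by_cases h : k ω ≤ n <;> simp [h]

theorem LocLp.of_measurable [IsFiniteMeasure P] (hm : m ≤ m0) (hf : Measurable[m] f) :
    LocLp m P p f := by
  refine ⟨fun ω => ⌈|f ω|⌉₊, ?_, fun n => ?_⟩
  · exact Nat.measurable_ceil.comp (continuous_abs.measurable.comp hf)
  · have h1 : Measurable[m] fun ω => ⌈|f ω|⌉₊ :=
      Nat.measurable_ceil.comp (continuous_abs.measurable.comp hf)
    refine MemLp.of_bound ((hf.mono hm le_rfl).indicator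
      (hm _ (measurableSet_index_le h1 n))).aestronglyMeasurable n (ae_of_all _ fun ω => ?_)
    by_cases h : ⌈|f ω|⌉₊ ≤ n
    · rw [Set.indicator_of_mem (by exact h)]
      exact Nat.ceil_le.1 h
    · rw [Set.indicator_of_notMem (by exact h)]
      simp

theorem LocLp.mul {r : ℝ≥0∞} [ENNReal.HolderTriple p q r] (hm : m ≤ m0) (hf : LocLp m P p f)
    (hg : LocLp m P q g) : LocLp m P r (fun ω => f ω * g ω) := by
  obtain ⟨k, hk, hf⟩ := hf
  obtain ⟨l, hl, hg⟩ := hg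
  have hkl : Measurable[m] (k ⊔ l) := hk.sup hl
  refine ⟨k ⊔ l, hkl, fun n => ?_⟩
  have h1 := memLp_indicator_le hm hkl (fun ω => le_max_left _ _) (hf n)
  have h2 := memLp_indicator_le hm hkl (fun ω => le_max_right _ _) (hg n)
  convert h2.mul h1 (r := r) using 1
  exact Set.indicator_mul _ f g

/-- An `m`-measurable factor is bounded on its own sublevel pieces, so these spaces are modules over
`L⁰(m)`. -/
theorem LocLp.measurable_mul [IsFiniteMeasure P] (hm : m ≤ m0) (hf : Measurable[m] f)
    (hg : LocLp m P p g) : LocLp m P p (fun ω => f ω * g ω) :=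
  (LocLp.of_measurable (p := ∞) hm hf).mul hm hg

theorem LocLp.mono_exponent [IsFiniteMeasure P] (hpq : q ≤ p) (hf : LocLp m P p f) :
    LocLp m P q f := by
  obtain ⟨k, hk, hf⟩ := hf
  exact ⟨k, hk, fun n => (hf n).mono_exponent hpq⟩

theorem LocLp.sum {ι : Type*} [IsFiniteMeasure P] (hm : m ≤ m0) (s : Finset ι) {F : ι → Ω → ℝ}
    (hF : ∀ i ∈ s, LocLp m P p (F i)) : LocLp m P p (fun ω => ∑ i ∈ s, F i ω) := by
  classical
  induction s using Finset.induction_on with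
  | empty => simpa using LocLp.of_measurable (f := fun _ => (0 : ℝ)) hm measurable_const
  | insert a s ha ih =>
    simp only [Finset.sum_insert ha]
    exact (hF _ (Finset.mem_insert_self _ _)).add hm
      (ih fun i hi => hF i (Finset.mem_insert_of_mem hi))

/-- Where the maximum of `j` and the index of the chosen member is at most `n`, only the first `n +
1` members occur, each on a piece where it is in `Lᵖ`; there the concatenation is a finite sum. -/
theorem LocLp.concat (hm : m ≤ m0) {j : Ω → ℕ} (hj : Measurable[m] j)
    {F : ℕ → Ω → ℝ} (hF : ∀ n, LocLp m P p (F n)) : LocLp m P p (fun ω => F (j ω) ω) := by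
  choose k hk hF using hF
  have hK : Measurable[m] fun ω => max (j ω) (k (j ω) ω) :=
    hj.sup (measurable_concat (f := fun n ω => k n ω) le_rfl hj hk)
  refine ⟨fun ω => max (j ω) (k (j ω) ω), hK, fun n => ?_⟩
  have : ({ω | max (j ω) (k (j ω) ω) ≤ n}.indicator fun ω => F (j ω) ω) =
      fun ω => ∑ i ∈ Finset.range (n + 1),
        {ω | j ω = i}.indicator ({ω | k i ω ≤ n}.indicator (F i)) ω := by
    ext ω
    by_cases h : max (j ω) (k (j ω) ω) ≤ n
    · rw [Set.indicator_of_mem (by exact h), Finset.sum_eq_single (j ω)]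
      · rw [Set.indicator_of_mem (by exact rfl),
          Set.indicator_of_mem (by exact (le_max_right _ _).trans h)]
      · intro i _ hi
        exact Set.indicator_of_notMem (show ω ∉ {ω | j ω = i} from fun h => hi (Eq.symm h)) _
      · intro h'
        exact absurd (Finset.mem_range_succ_iff.2 ((le_max_left _ _).trans h)) h'
    · rw [Set.indicator_of_notMem (by exact h), eq_comm]
      refine Finset.sum_eq_zero fun i hi => ?_
      by_cases hji : j ω = i
      · rw [Set.indicator_of_mem (by exact hji), Set.indicator_of_notMem]
        intro (h' : k i ω ≤ n)
        subst hji
        exact h (max_le (Finset.mem_range_succ_iff.1 hi) h')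
      · exact Set.indicator_of_notMem (by exact hji) _
  rw [this]
  exact memLp_finsetSum _ fun i _ => (hF i n).indicator (hm _ (measurableSet_index hj i))

/-- Membership in `LocLp` with a common localizing sequence. -/
theorem LocLp.exists_common (hm : m ≤ m0) {F : ℕ → Ω → ℝ} (s : Finset ℕ)
    (hF : ∀ i ∈ s, LocLp m P p (F i)) :
    ∃ k : Ω → ℕ, Measurable[m] k ∧ ∀ i ∈ s, ∀ n, MemLp ({ω | k ω ≤ n}.indicator (F i)) p P := by
  classical
  induction s using Finset.induction_on with
  | empty => exact ⟨fun _ => 0, measurable_const, by simp⟩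
  | insert a s ha ih =>
    obtain ⟨k, hk, h⟩ := ih fun i hi => hF i (Finset.mem_insert_of_mem hi)
    obtain ⟨l, hl, h'⟩ := hF a (Finset.mem_insert_self _ _)
    have hkl : Measurable[m] (k ⊔ l) := hk.sup hl
    refine ⟨k ⊔ l, hkl, fun i hi n => ?_⟩
    rcases Finset.mem_insert.1 hi with rfl | hi
    · exact memLp_indicator_le hm hkl (fun ω => le_max_right _ _) (h' n)
    · exact memLp_indicator_le hm hkl (fun ω => le_max_left _ _) (h i hi n)

/-! ### Conditional expectations of real random variables, and their locality -/

theorem condE_of_integrable (hf : Integrable f P) :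
    condE m P (fun ω => (f ω : EReal)) =ᵐ[P] fun ω => ((P[f|m] ω : ℝ) : EReal) := by
  have e1 : (fun ω => ((f ω : EReal)).toENNReal) = fun ω => ENNReal.ofReal (max (f ω) 0) := by
    ext ω
    rw [EReal.toENNReal_of_ne_top (by simp)]
    simp
  have e2 : (fun ω => (-(f ω : EReal)).toENNReal) = fun ω => ENNReal.ofReal (max (-f ω) 0) := by
    ext ω
    rw [← EReal.coe_neg, EReal.toENNReal_of_ne_top (by simp)]
    simp
  have h3 : P[fun ω => max (f ω) 0|m] - P[fun ω => max (-f ω) 0|m] =ᵐ[P] P[f|m] := by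
    refine (condExp_sub hf.pos_part hf.neg_part m).symm.trans ?_
    refine Eventually.of_forall fun ω => ?_
    congr 2
    ext ω
    simp only [Pi.sub_apply]
    rcases le_total (f ω) 0 with h | h <;> simp [h]
  have p1 : (0 : Ω → ℝ) ≤ᵐ[P] fun ω => max (f ω) 0 := ae_of_all _ fun ω => le_max_right _ _
  have p2 : (0 : Ω → ℝ) ≤ᵐ[P] fun ω => max (-f ω) 0 := ae_of_all _ fun ω => le_max_right _ _
  filter_upwards [condLExp_ofReal m hf.pos_part p1, condLExp_ofReal m hf.neg_part p2, h3,
    condExp_nonneg p1 (m := m), condExp_nonneg p2 (m := m)] with ω h1 h2 h3 p1 p2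
  simp only [condE, e1, e2, h1, h2, ← h3, Pi.sub_apply]
  rw [EReal.coe_ennreal_ofReal, EReal.coe_ennreal_ofReal]
  exact congrArg₂ (fun a b : ℝ => (a : EReal) - (b : EReal)) (max_eq_left p1) (max_eq_left p2)

/-- The generalized conditional expectation of a real random variable, as a real random
variable. -/
noncomputable def cE (m : MeasurableSpace Ω) {m0 : MeasurableSpace Ω} (P : Measure Ω)
    (f : Ω → ℝ) : Ω → ℝ := fun ω => (condE m P (fun ω => (f ω : EReal)) ω).toReal

theorem cE_of_integrable (hf : Integrable f P) : cE m P f =ᵐ[P] P[f|m] := by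
  filter_upwards [condE_of_integrable (m := m) hf] with ω hω
  simp [cE, hω]

variable [IsProbabilityMeasure P]

/-- Locality comes from uniqueness: the function pasted from both sides has the right integrals over
`s ∩ A` and over `s \ A`. -/
theorem condLExp_congr_on (hm : m ≤ m0) {F G : Ω → ℝ≥0∞} {A : Set Ω} (hA : MeasurableSet[m] A)
    (h : ∀ᵐ ω ∂P, ω ∈ A → F ω = G ω) :
    ∀ᵐ ω ∂P, ω ∈ A → condLExp m P F ω = condLExp m P G ω := by
  classical
  have : A.piecewise (condLExp m P F) (condLExp m P G) =ᵐ[P] condLExp m P G := by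
    refine ae_eq_condLExp hm P G
      ((measurable_condLExp m P F).piecewise hA (measurable_condLExp m P G)) fun s hs => ?_
    rw [← lintegral_inter_add_sdiff _ s (hm A hA), ← lintegral_inter_add_sdiff (G) s (hm A hA)]
    congr 1
    · calc _ = ∫⁻ ω in s ∩ A, condLExp m P F ω ∂P :=
            setLIntegral_congr_fun (hm _ (hs.inter hA)) fun ω hω => by simp [hω.2]
        _ = ∫⁻ ω in s ∩ A, F ω ∂P := setLIntegral_condLExp hm P F (hs.inter hA)
        _ = _ := setLIntegral_congr_fun_ae (hm _ (hs.inter hA)) <| by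
            filter_upwards [h] with ω hω hωA using hω hωA.2
    · calc _ = ∫⁻ ω in s \ A, condLExp m P G ω ∂P :=
            setLIntegral_congr_fun (hm _ (hs.diff hA)) fun ω hω => by simp [hω.2]
        _ = ∫⁻ ω in s \ A, G ω ∂P := setLIntegral_condLExp hm P G (hs.diff hA)
  filter_upwards [this] with ω hω hωA
  simpa [hωA] using hω

/-- Cutting at the integer levels of a conditional bound gives pieces on which `f` is in `Lᵖ`;
conversely, on a localizing piece the conditional moment is that of an ordinary `Lᵖ` variable, hence
finite. From here on, conditional `Lᵖ` questions are ordinary ones on countably many pieces. -/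
theorem memCondLp_iff (hm : m ≤ m0) (hf : Measurable f) (hp : p ≠ 0) :
    MemCondLp m P p f ↔ LocLp m P p f := by
  constructor
  · rintro ⟨ξ, hξ, hξ0, h1, h2⟩
    have hk : Measurable[m] fun ω => ⌈ξ ω⌉₊ := Nat.measurable_ceil.comp hξ
    refine ⟨_, hk, fun n => ?_⟩
    have hA := measurableSet_index_le hk n
    have hmeas : AEStronglyMeasurable ({ω | ⌈ξ ω⌉₊ ≤ n}.indicator f) P :=
      (hf.indicator (hm _ hA)).aestronglyMeasurable
    by_cases hpt : p = ∞
    · refine MemLp.of_bound hmeas n ?_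
      filter_upwards [h1 hpt] with ω hω
      by_cases h : ⌈ξ ω⌉₊ ≤ n
      · rw [Set.indicator_of_mem (by exact h)]
        exact hω.trans (Nat.ceil_le.1 h)
      · rw [Set.indicator_of_notMem (by exact h)]
        simp
    · refine ⟨hmeas, ?_⟩
      rw [eLpNorm_lt_top_iff_lintegral_rpow_enorm_lt_top hp hpt]
      have hp0 : 0 < p.toReal := ENNReal.toReal_pos hp hpt
      calc ∫⁻ ω, ‖{ω | ⌈ξ ω⌉₊ ≤ n}.indicator f ω‖ₑ ^ p.toReal ∂P
          = ∫⁻ ω in {ω | ⌈ξ ω⌉₊ ≤ n}, ENNReal.ofReal |f ω| ^ p.toReal ∂P := by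
            rw [← lintegral_indicator (hm _ hA)]
            refine lintegral_congr fun ω => ?_
            by_cases h : ⌈ξ ω⌉₊ ≤ n
            · rw [Set.indicator_of_mem (by exact h), Set.indicator_of_mem (by exact h),
                Real.enorm_eq_ofReal_abs]
            · rw [Set.indicator_of_notMem (by exact h), Set.indicator_of_notMem (by exact h)]
              simp [hp0]
        _ = ∫⁻ ω in {ω | ⌈ξ ω⌉₊ ≤ n},
              condLExp m P (fun ω => ENNReal.ofReal |f ω| ^ p.toReal) ω ∂P :=
            (setLIntegral_condLExp hm P _ hA).symm
        _ ≤ ∫⁻ ω in {ω | ⌈ξ ω⌉₊ ≤ n}, (n : ℝ≥0∞) ^ p.toReal ∂P := by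
            refine setLIntegral_mono_ae' (hm _ hA) ?_
            filter_upwards [h2 hpt] with ω hω hωA
            refine hω.trans (ENNReal.rpow_le_rpow ?_ hp0.le)
            have := Nat.ceil_le.1 (show ⌈ξ ω⌉₊ ≤ n from hωA)
            exact (ENNReal.ofReal_le_ofReal this).trans (by simp)
        _ < ∞ := by
            rw [setLIntegral_const]
            exact ENNReal.mul_lt_top (ENNReal.rpow_lt_top_of_nonneg hp0.le (by simp))
              (measure_lt_top _ _)
  · rintro ⟨k, hk, h⟩
    by_cases hpt : p = ∞
    · subst hpt
      -- The bound at `ω` is the essential supremum of `|f|` over the piece of level `k ω`; being a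
      -- function of `k`, it is `m`-measurable.
      refine ⟨fun ω => (eLpNorm ({ω' | k ω' ≤ k ω}.indicator f) ∞ P).toReal,
        (measurable_from_top (f := fun n =>
          (eLpNorm ({ω' | k ω' ≤ n}.indicator f) ∞ P).toReal)).comp hk,
        fun ω => ENNReal.toReal_nonneg, fun _ => ae_of_index k fun n => ?_, by simp⟩
      filter_upwards [ae_le_eLpNormEssSup (f := {ω' | k ω' ≤ n}.indicator f) (μ := P)]
        with ω hω hn
      have hω' := (ENNReal.toReal_le_toReal (by simp) (by
        rw [← eLpNorm_exponent_top]; exact (h n).eLpNorm_ne_top)).2 hω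
      rw [Set.indicator_of_mem (by exact hn.le)] at hω'
      rw [hn, eLpNorm_exponent_top]
      simpa using hω'
    · have hp0 : 0 < p.toReal := ENNReal.toReal_pos hp hpt
      let F : Ω → ℝ≥0∞ := fun ω => ENNReal.ofReal |f ω| ^ p.toReal
      have hfin : ∀ᵐ ω ∂P, condLExp m P F ω ≠ ∞ := ae_of_index k fun n => by
        let G : Ω → ℝ≥0∞ := fun ω => ‖{ω | k ω ≤ n}.indicator f ω‖ₑ ^ p.toReal
        have h1 : ∀ᵐ ω ∂P, ω ∈ {ω | k ω ≤ n} → F ω = G ω := ae_of_all _ fun ω hω => by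
          simp only [F, G]
          rw [Set.indicator_of_mem hω, Real.enorm_eq_ofReal_abs]
        have h2 : ∫⁻ ω, G ω ∂P ≠ ∞ :=
          ((eLpNorm_lt_top_iff_lintegral_rpow_enorm_lt_top hp hpt).1 (h n).2).ne
        filter_upwards [condLExp_congr_on hm (measurableSet_index_le hk n) h1,
          condLExp_ne_top h2 (mΩ := m)] with ω hω hω' hn
        rw [hω hn.le]
        exact hω'
      refine ⟨fun ω => (condLExp m P F ω).toReal ^ (p.toReal)⁻¹,
        (measurable_condLExp m P F).ennreal_toReal.pow_const _,
        fun ω => Real.rpow_nonneg ENNReal.toReal_nonneg _, fun h => absurd h hpt, fun _ => ?_⟩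
      filter_upwards [hfin] with ω hω
      rw [ENNReal.ofReal_rpow_of_nonneg (Real.rpow_nonneg ENNReal.toReal_nonneg _) hp0.le,
        Real.rpow_inv_rpow ENNReal.toReal_nonneg hp0.ne', ENNReal.ofReal_toReal hω]

/-! ### The conditional expectation of conditionally integrable random variables -/

theorem measurable_condE (m : MeasurableSpace Ω) {m0 : MeasurableSpace Ω} (P : Measure Ω)
    (f : Ω → EReal) : Measurable[m] (condE m P f) := by
  have h1 := measurable_coe_ennreal_ereal.comp
    (measurable_condLExp m P (fun ω => (f ω).toENNReal))
  have h2 := measurable_coe_ennreal_ereal.comp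
    (measurable_condLExp m P (fun ω => (-f ω).toENNReal))
  exact h1.sub h2

theorem measurable_cE (m : MeasurableSpace Ω) {m0 : MeasurableSpace Ω} (P : Measure Ω)
    (f : Ω → ℝ) : Measurable[m] (cE m P f) :=
  measurable_ereal_toReal.comp (measurable_condE m P _)

theorem condE_congr_on (hm : m ≤ m0) {F G : Ω → EReal} {A : Set Ω} (hA : MeasurableSet[m] A)
    (h : ∀ᵐ ω ∂P, ω ∈ A → F ω = G ω) : ∀ᵐ ω ∂P, ω ∈ A → condE m P F ω = condE m P G ω := by
  have h1 := condLExp_congr_on (P := P) hm (F := fun ω => (F ω).toENNReal)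
    (G := fun ω => (G ω).toENNReal) hA (by
      filter_upwards [h] with ω hω hωA; simp [hω hωA])
  have h2 := condLExp_congr_on (P := P) hm (F := fun ω => (-F ω).toENNReal)
    (G := fun ω => (-G ω).toENNReal) hA (by
      filter_upwards [h] with ω hω hωA; simp [hω hωA])
  filter_upwards [h1, h2] with ω h1 h2 hω
  simp only [condE, h1 hω, h2 hω]

theorem cE_congr_on (hm : m ≤ m0) {A : Set Ω} (hA : MeasurableSet[m] A)
    (h : ∀ᵐ ω ∂P, ω ∈ A → f ω = g ω) : ∀ᵐ ω ∂P, ω ∈ A → cE m P f ω = cE m P g ω := by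
  filter_upwards [condE_congr_on hm hA (F := fun ω => (f ω : EReal)) (G := fun ω => (g ω : EReal))
    (by filter_upwards [h] with ω hω hA; rw [hω hA])] with ω hω hωA
  simp only [cE, hω hωA]

theorem cE_congr (hm : m ≤ m0) (h : f =ᵐ[P] g) : cE m P f =ᵐ[P] cE m P g := by
  filter_upwards [cE_congr_on hm MeasurableSet.univ (h.mono fun ω hω _ => hω)] with ω hω
  exact hω trivial

/-- On the localizing pieces the generalized conditional expectation is the usual one. -/
theorem LocLp.cE_eq (hm : m ≤ m0) (hf : LocLp m P 1 f) :
    ∃ k : Ω → ℕ, Measurable[m] k ∧ (∀ n, Integrable ({ω | k ω ≤ n}.indicator f) P) ∧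
      ∀ n, ∀ᵐ ω ∂P, k ω ≤ n → cE m P f ω = P[{ω | k ω ≤ n}.indicator f|m] ω ∧
        condE m P (fun ω => (f ω : EReal)) ω = (cE m P f ω : EReal) := by
  obtain ⟨k, hk, h⟩ := hf
  have hi : ∀ n, Integrable ({ω | k ω ≤ n}.indicator f) P := fun n => memLp_one_iff_integrable.1 (h n)
  refine ⟨k, hk, hi, fun n => ?_⟩
  have h1 := condE_congr_on (P := P) hm (measurableSet_index_le hk n) (F := fun ω => (f ω : EReal))
    (G := fun ω => (({ω | k ω ≤ n}.indicator f ω : ℝ) : EReal)) (ae_of_all _ fun ω hω => by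
      rw [Set.indicator_of_mem hω])
  filter_upwards [h1, condE_of_integrable (m := m) (hi n)] with ω h1 h2 hω
  simp only [cE, h1 hω, h2]
  simp

/-- On each piece the positive and negative parts both have finite conditional expectation, so `∞ -
∞` does not occur and `toReal` loses nothing. -/
theorem LocLp.condE_eq (hm : m ≤ m0) (hf : LocLp m P 1 f) :
    condE m P (fun ω => (f ω : EReal)) =ᵐ[P] fun ω => (cE m P f ω : EReal) := by
  obtain ⟨k, -, -, h⟩ := hf.cE_eq hm
  refine ae_of_index k fun n => ?_
  filter_upwards [h n] with ω hω hn
  exact (hω hn.le).2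

theorem cE_eq_on (hm : m ≤ m0) {A : Set Ω} (hA : MeasurableSet[m] A)
    (hf : Integrable (A.indicator f) P) :
    ∀ᵐ ω ∂P, ω ∈ A → cE m P f ω = P[A.indicator f|m] ω := by
  filter_upwards [cE_congr_on hm hA (f := f) (g := A.indicator f)
    (ae_of_all _ fun ω hω => by rw [Set.indicator_of_mem hω]), cE_of_integrable (m := m) hf]
    with ω h1 h2 hω
  rw [h1 hω, h2]

theorem cE_add (hm : m ≤ m0) (hf : LocLp m P 1 f) (hg : LocLp m P 1 g) :
    cE m P (fun ω => f ω + g ω) =ᵐ[P] fun ω => cE m P f ω + cE m P g ω := by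
  obtain ⟨k, hk, hf⟩ := hf
  obtain ⟨l, hl, hg⟩ := hg
  have hkl : Measurable[m] (k ⊔ l) := hk.sup hl
  refine ae_of_index (k ⊔ l) fun n => ?_
  have hA := measurableSet_index_le hkl n
  have i1 := memLp_one_iff_integrable.1
    (memLp_indicator_le hm hkl (fun ω => le_max_left _ _) (hf n))
  have i2 := memLp_one_iff_integrable.1
    (memLp_indicator_le hm hkl (fun ω => le_max_right _ _) (hg n))
  have e : ({ω | (k ⊔ l) ω ≤ n}.indicator fun ω => f ω + g ω) =
    {ω | (k ⊔ l) ω ≤ n}.indicator f + {ω | (k ⊔ l) ω ≤ n}.indicator g :=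
    Set.indicator_add' _ f g
  filter_upwards [cE_eq_on hm hA i1, cE_eq_on hm hA i2, cE_eq_on hm hA (e ▸ i1.add i2),
    condExp_add i1 i2 m] with ω h1 h2 h3 h4 hn
  rw [h1 hn.le, h2 hn.le, h3 hn.le, e, h4]
  rfl

theorem cE_measurable_mul (hm : m ≤ m0) (hh : Measurable[m] f) (hg : LocLp m P 1 g) :
    cE m P (fun ω => f ω * g ω) =ᵐ[P] fun ω => f ω * cE m P g ω := by
  obtain ⟨k, hk, hi⟩ := hg
  obtain ⟨l, hl, hf⟩ := LocLp.of_measurable (p := ∞) (P := P) hm hh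
  have hkl : Measurable[m] (k ⊔ l) := hk.sup hl
  refine ae_of_index (k ⊔ l) fun n => ?_
  have hA := measurableSet_index_le hkl n
  have i1 := memLp_one_iff_integrable.1
    (memLp_indicator_le hm hkl (fun ω => le_max_left _ _) (hi n))
  have i2 := memLp_indicator_le hm hkl (fun ω => le_max_right _ _) (hf n)
  have i3 : Integrable ({ω | (k ⊔ l) ω ≤ n}.indicator f * {ω | (k ⊔ l) ω ≤ n}.indicator g) P :=
    memLp_one_iff_integrable.1 ((memLp_one_iff_integrable.2 i1).mul i2)
  have e : ({ω | (k ⊔ l) ω ≤ n}.indicator fun ω => f ω * g ω) =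
    {ω | (k ⊔ l) ω ≤ n}.indicator f * {ω | (k ⊔ l) ω ≤ n}.indicator g :=
    Set.indicator_mul _ f g
  filter_upwards [cE_eq_on hm hA i1, cE_eq_on hm hA (e ▸ i3),
    condExp_mul_of_stronglyMeasurable_left (hh.indicator hA).stronglyMeasurable i3 i1]
    with ω h1 h2 h3 hn
  rw [h1 hn.le, h2 hn.le, e, h3, Pi.mul_apply, Set.indicator_of_mem (by exact hn.le)]

theorem cE_of_measurable (hm : m ≤ m0) (hf : Measurable[m] f) : cE m P f =ᵐ[P] f := by
  have h1 : cE m P (fun _ => (1 : ℝ)) =ᵐ[P] fun _ => 1 := by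
    refine (cE_of_integrable (integrable_const 1)).trans ?_
    rw [condExp_const hm]
  have h2 := cE_measurable_mul (P := P) hm hf
    (LocLp.of_measurable (f := fun _ => (1 : ℝ)) (p := 1) hm measurable_const)
  simp only [mul_one] at h2
  filter_upwards [h1, h2] with ω h1 h2
  rw [h2, h1, mul_one]

theorem cE_neg (hm : m ≤ m0) (hf : LocLp m P 1 f) :
    cE m P (fun ω => -f ω) =ᵐ[P] fun ω => -cE m P f ω := by
  have := cE_measurable_mul hm (f := fun _ => -1) measurable_const hf
  simpa using this

theorem cE_sub (hm : m ≤ m0) (hf : LocLp m P 1 f) (hg : LocLp m P 1 g) :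
    cE m P (fun ω => f ω - g ω) =ᵐ[P] fun ω => cE m P f ω - cE m P g ω := by
  simp only [sub_eq_add_neg]
  filter_upwards [cE_add hm hf hg.neg, cE_neg hm hg] with ω h1 h2
  rw [h1, h2]

theorem cE_mono (hm : m ≤ m0) (hf : LocLp m P 1 f) (hg : LocLp m P 1 g) (h : f ≤ᵐ[P] g) :
    cE m P f ≤ᵐ[P] cE m P g := by
  obtain ⟨k, hk, hf⟩ := hf
  obtain ⟨l, hl, hg⟩ := hg
  have hkl : Measurable[m] (k ⊔ l) := hk.sup hl
  refine ae_of_index (k ⊔ l) fun n => ?_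
  have hA := measurableSet_index_le hkl n
  have i1 := memLp_one_iff_integrable.1
    (memLp_indicator_le hm hkl (fun ω => le_max_left _ _) (hf n))
  have i2 := memLp_one_iff_integrable.1
    (memLp_indicator_le hm hkl (fun ω => le_max_right _ _) (hg n))
  filter_upwards [cE_eq_on hm hA i1, cE_eq_on hm hA i2,
    condExp_mono (m := m) i1 i2 (by
      filter_upwards [h] with ω hω
      exact Set.indicator_le_indicator hω)] with ω h1 h2 h3 hn
  rw [h1 hn.le, h2 hn.le]
  exact h3

end LocLp

/-! ### Certainty equivalents -/

section Certainty

variable {Ω : Type*} {m0 : MeasurableSpace Ω} {𝓕 : Filtration ℕ m0} {P : Measure Ω}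
  [IsProbabilityMeasure P] {T t : ℕ} {p : ℝ≥0∞} {φ : (ℕ → Ω → ℝ) → Ω → EReal}
  {V W : ℕ → Ω → ℝ}

theorem memFuture_iff (hp : 1 ≤ p) : MemFuture 𝓕 P T p t V ↔
    ∀ s, t ≤ s → s ≤ T → Measurable[𝓕 s] (V s) ∧ LocLp (𝓕 t) P p (V s) := by
  refine forall₃_congr fun s _ _ => and_congr_right fun h => ?_
  exact memCondLp_iff (𝓕.le t) (h.mono (𝓕.le s) le_rfl) (one_pos.trans_le hp).ne'

theorem memFuture_cash (hp : 1 ≤ p) {m : Ω → ℝ} (hm : Measurable[𝓕 t] m) :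
    MemFuture 𝓕 P T p t (cash m) :=
  (memFuture_iff hp).2 fun _ hs _ =>
    ⟨hm.mono (𝓕.mono hs) le_rfl, LocLp.of_measurable (𝓕.le t) hm⟩

theorem MemFuture.concat (hp : 1 ≤ p) {j : Ω → ℕ} (hj : Measurable[𝓕 t] j)
    {U : ℕ → ℕ → Ω → ℝ} (hU : ∀ n, MemFuture 𝓕 P T p t (U n)) :
    MemFuture 𝓕 P T p t fun s ω => U (j ω) s ω :=
  (memFuture_iff hp).2 fun s hs hsT =>
    ⟨measurable_concat (𝓕.mono hs) hj fun n => (hU n s hs hsT).1,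
      LocLp.concat (𝓕.le t) hj fun n => ((memFuture_iff hp).1 (hU n) s hs hsT).2⟩

theorem measurable_ite_index {m : MeasurableSpace Ω} {A : Set Ω} (hA : MeasurableSet[m] A)
    [DecidablePred (· ∈ A)] : Measurable[m] fun ω => if ω ∈ A then 0 else 1 :=
  Measurable.ite hA measurable_const measurable_const

open Classical in
/-- The position equal to `V` on `A` and to `W` off `A`. -/
noncomputable def paste (A : Set Ω) (V W : ℕ → Ω → ℝ) : ℕ → Ω → ℝ :=
  fun s ω => if ω ∈ A then V s ω else W s ω

theorem paste_of_mem {A : Set Ω} {ω : Ω} (h : ω ∈ A) (s : ℕ) : paste A V W s ω = V s ω :=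
  if_pos h

theorem paste_of_notMem {A : Set Ω} {ω : Ω} (h : ω ∉ A) (s : ℕ) : paste A V W s ω = W s ω :=
  if_neg h

theorem MemFuture.paste (hp : 1 ≤ p) {A : Set Ω} (hA : MeasurableSet[𝓕 t] A)
    (hV : MemFuture 𝓕 P T p t V) (hW : MemFuture 𝓕 P T p t W) :
    MemFuture 𝓕 P T p t (paste A V W) := by
  classical
  have := MemFuture.concat (p := p) (T := T) (P := P) hp (measurable_ite_index hA)
    (U := fun n => Nat.casesOn n V fun _ => W) (fun n => by cases n; exacts [hV, hW])
  convert this using 3 with s ω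
  by_cases h : ω ∈ A <;> simp [DynIndex.paste, h]

namespace IsUSCAssessmentIndex

/-- Locality on each set `{j = n}`. Together with a measurable choice of `j`, it combines countably
many positions into one. -/
theorem concat (hφ : IsUSCAssessmentIndex 𝓕 P T p t φ) (hp : 1 ≤ p) {j : Ω → ℕ}
    (hj : Measurable[𝓕 t] j) {U : ℕ → ℕ → Ω → ℝ} (hU : ∀ n, MemFuture 𝓕 P T p t (U n)) :
    ∀ᵐ ω ∂P, φ (fun s ω => U (j ω) s ω) ω = φ (U (j ω)) ω := by
  refine ae_of_index j fun n => ?_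
  filter_upwards [hφ.localProp _ _ (MemFuture.concat hp hj hU) (hU n) {ω | j ω = n}
    (measurableSet_index hj n) fun s _ _ => ae_of_all _ fun ω (hω : j ω = n) => by rw [hω]]
    with ω hω hn
  rw [hω hn, hn]

theorem paste_eq (hφ : IsUSCAssessmentIndex 𝓕 P T p t φ) (hp : 1 ≤ p) {A : Set Ω}
    (hA : MeasurableSet[𝓕 t] A) (hV : MemFuture 𝓕 P T p t V) (hW : MemFuture 𝓕 P T p t W) :
    (∀ᵐ ω ∂P, ω ∈ A → φ (paste A V W) ω = φ V ω) ∧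
      ∀ᵐ ω ∂P, ω ∉ A → φ (paste A V W) ω = φ W ω :=
  ⟨hφ.localProp _ _ (hV.paste hp hA hW) hV A hA fun _ _ _ =>
      ae_of_all _ fun _ hω => paste_of_mem hω _,
    hφ.localProp _ _ (hV.paste hp hA hW) hW Aᶜ hA.compl fun _ _ _ =>
      ae_of_all _ fun _ hω => paste_of_notMem hω _⟩

/-- `V` on `A` pasted with `W` off `A` dominates `W` everywhere; locality then replaces it by `V` on
`A`. -/
theorem mono_on (hφ : IsUSCAssessmentIndex 𝓕 P T p t φ) (hp : 1 ≤ p)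
    (hV : MemFuture 𝓕 P T p t V) (hW : MemFuture 𝓕 P T p t W) {A : Set Ω}
    (hA : MeasurableSet[𝓕 t] A)
    (h : ∀ s, t ≤ s → s ≤ T → ∀ᵐ ω ∂P, ω ∈ A → W s ω ≤ V s ω) :
    ∀ᵐ ω ∂P, ω ∈ A → φ W ω ≤ φ V ω := by
  have h1 := hφ.monotone (paste A V W) W (hV.paste hp hA hW) hW fun s hs hsT => by
    filter_upwards [h s hs hsT] with ω hω
    by_cases hA : ω ∈ A
    · rw [paste_of_mem hA]; exact hω hA
    · rw [paste_of_notMem hA]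
  filter_upwards [h1, (hφ.paste_eq hp hA hV hW).1] with ω h1 h2 hω
  rw [← h2 hω]
  exact h1

theorem cash_mono_on (hφ : IsUSCAssessmentIndex 𝓕 P T p t φ) (hp : 1 ≤ p) {m m' : Ω → ℝ}
    (hm : Measurable[𝓕 t] m) (hm' : Measurable[𝓕 t] m') :
    ∀ᵐ ω ∂P, m ω ≤ m' ω → φ (cash m) ω ≤ φ (cash m') ω :=
  hφ.mono_on hp (memFuture_cash hp hm') (memFuture_cash hp hm)
    (A := {ω | m ω ≤ m' ω}) (measurableSet_le hm hm') fun _ _ _ => ae_of_all _ fun _ h => h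

/-- Strict monotonicity gives one direction and monotonicity the other. Comparisons of index values
thereby become comparisons of cash amounts. -/
theorem cash_lt_iff (hφ : IsUSCAssessmentIndex 𝓕 P T p t φ)
    (hC : HasCertaintyAssumptions 𝓕 P T p t φ) (hp : 1 ≤ p) {m m' : Ω → ℝ}
    (hm : Measurable[𝓕 t] m) (hm' : Measurable[𝓕 t] m') :
    ∀ᵐ ω ∂P, φ (cash m) ω < φ (cash m') ω ↔ m ω < m' ω := by
  have h := hC.strictlyIncreasing m' m hm' hm {ω | m ω < m' ω} (measurableSet_lt hm hm')
    (ae_of_all _ fun _ h => h)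
  filter_upwards [h, hφ.cash_mono_on hp hm' hm] with ω h1 h2
  exact ⟨fun h => not_le.1 fun hle => not_lt.2 (h2 hle) h, fun h => h1 h⟩

/-- For cash positions both topologies reduce to approximation of the amounts: the conditional norm
of an 𝓕ₜ-measurable difference is its absolute value, and pairing with `Z` multiplies it by the
𝓕ₜ-measurable factor `E[∑ Z_s | 𝓕ₜ]`. -/
theorem cash_mem_of_isCondClosed (hp : 1 ≤ p) {𝒜 : Set (ℕ → Ω → ℝ)}
    (h𝒜 : IsCondClosed 𝓕 P T p t 𝒜) {y : Ω → ℝ} (hy : Measurable[𝓕 t] y)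
    (h : ∀ ε : Ω → ℝ, Measurable[𝓕 t] ε → (∀ ω, 0 < ε ω) → ∃ m : Ω → ℝ, Measurable[𝓕 t] m ∧
      cash m ∈ 𝒜 ∧ ∀ᵐ ω ∂P, |m ω - y ω| ≤ ε ω) : cash y ∈ 𝒜 := by
  refine h𝒜 _ (memFuture_cash hp hy) (fun hpt ε hε hε0 => ?_) fun hpt n Z hZ ε hε hε0 => ?_
  · obtain ⟨m, hm, hmA, hle⟩ := h ε hε hε0
    refine ⟨_, hmA, memFuture_cash hp hm, fun s _ _ => ⟨fun h => absurd h hpt, fun _ => ?_⟩⟩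
    have hmeas : Measurable[𝓕 t] fun ω => ENNReal.ofReal (ε ω) ^ p.toReal :=
      (ENNReal.measurable_ofReal.comp hε).pow_const _
    have := condLExp_mono (P := P) (mΩ := 𝓕 t)
      (X := fun ω => ENNReal.ofReal |cash m s ω - cash y s ω| ^ p.toReal)
      (Y := fun ω => ENNReal.ofReal (ε ω) ^ p.toReal) (by
        filter_upwards [hle] with ω hω
        exact ENNReal.rpow_le_rpow (ENNReal.ofReal_le_ofReal hω) ENNReal.toReal_nonneg)
    rwa [condLExp_eq_self (𝓕.le t) P hmeas] at this
  · have hZ1 : ∀ i, LocLp (𝓕 t) P 1 fun ω => ∑ s ∈ Finset.Icc t T, Z i s ω := fun i =>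
      LocLp.sum (𝓕.le t) _ fun s hs =>
        ((memFuture_iff le_rfl).1 (hZ i) s (Finset.mem_Icc.1 hs).1 (Finset.mem_Icc.1 hs).2).2
    -- `c` dominates the factors of all `n` functionals, so approximation within `ε / c` is
    -- approximation within `ε` under each pairing.
    let c : Ω → ℝ := fun ω => 1 + ∑ i, |cE (𝓕 t) P (fun ω => ∑ s ∈ Finset.Icc t T, Z i s ω) ω|
    have hc : Measurable[𝓕 t] c := measurable_const.add <|
      Finset.measurable_fun_sum _ fun i _ => continuous_abs.measurable.comp (measurable_cE _ _ _)
    have hc0 : ∀ ω, 0 < c ω := fun ω =>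
      add_pos_of_pos_of_nonneg one_pos (Finset.sum_nonneg fun i _ => abs_nonneg _)
    obtain ⟨m, hm, hmA, hle⟩ := h (fun ω => ε ω / c ω) (hε.div hc) fun ω => div_pos (hε0 ω) (hc0 ω)
    refine ⟨_, hmA, memFuture_cash hp hm, fun i => ?_⟩
    have e : pairing 𝓕 P T t (Z i) (fun s ω => cash m s ω - cash y s ω) =
        cE (𝓕 t) P fun ω => (m ω - y ω) * ∑ s ∈ Finset.Icc t T, Z i s ω := by
      unfold pairing cE
      simp only [cash, ← Finset.sum_mul]
      simp only [mul_comm]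
    rw [e]
    filter_upwards [cE_measurable_mul (𝓕.le t) (hm.sub hy) (hZ1 i), hle] with ω h1 h2
    rw [Pi.sub_apply] at h1
    simp only [Pi.sub_apply] at h1
    rw [h1, abs_mul]
    have h3 : |cE (𝓕 t) P (fun ω => ∑ s ∈ Finset.Icc t T, Z i s ω) ω| ≤ c ω :=
      (Finset.single_le_sum (f := fun i =>
        |cE (𝓕 t) P (fun ω => ∑ s ∈ Finset.Icc t T, Z i s ω) ω|)
        (fun i _ => abs_nonneg _) (Finset.mem_univ i)).trans (le_add_of_nonneg_left zero_le_one)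
    calc _ ≤ ε ω / c ω * c ω := mul_le_mul h2 h3 (abs_nonneg _) (div_pos (hε0 ω) (hc0 ω)).le
      _ = ε ω := div_mul_cancel₀ _ (hc0 ω).ne'

/-- Bounds for the certainty equivalent which inherit the integrability of the position. -/
theorem exists_cash_bounds (hφ : IsUSCAssessmentIndex 𝓕 P T p t φ)
    (hC : HasCertaintyAssumptions 𝓕 P T p t φ) (hp : 1 ≤ p) {r : ℕ} (hr : r ≤ t)
    (hV : ∀ s, t ≤ s → s ≤ T → Measurable[𝓕 s] (V s) ∧ LocLp (𝓕 r) P p (V s)) :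
    ∃ m₁ m₂ : Ω → ℝ, Measurable[𝓕 t] m₁ ∧ LocLp (𝓕 r) P p m₁ ∧ Measurable[𝓕 t] m₂ ∧
      LocLp (𝓕 r) P p m₂ ∧ ∀ᵐ ω ∂P, φ (cash m₁) ω < φ V ω ∧ φ V ω ≤ φ (cash m₂) ω := by
  -- Boundedness is available for positions in `Lᵖ` only; it is applied to each truncation and the
  -- bounds are pasted along `k`. The localization is at the earlier time `r`: with the index taken
  -- at time `r + 1` the bounds lie in `L^{r,p}`, as the second entry of a two-step position at time
  -- `r` must.
  obtain ⟨k, hk, hkV⟩ := LocLp.exists_common (P := P) (p := p) (𝓕.le r) (Finset.Icc t T)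
    (F := V) fun s hs => (hV s (Finset.mem_Icc.1 hs).1 (Finset.mem_Icc.1 hs).2).2
  have hVt : MemFuture 𝓕 P T p t V := (memFuture_iff hp).2 fun s hs hsT =>
    ⟨(hV s hs hsT).1, (hV s hs hsT).2.mono_sigma (𝓕.mono hr)⟩
  let U : ℕ → ℕ → Ω → ℝ := fun n s => {ω | k ω ≤ n}.indicator (V s)
  have hU : ∀ n, MemFutureLp 𝓕 P T p t (U n) := fun n s hs hsT =>
    ⟨(hV s hs hsT).1.indicator (𝓕.mono (hr.trans hs) _ (measurableSet_index_le hk n)),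
      hkV s (Finset.mem_Icc.2 ⟨hs, hsT⟩) n⟩
  choose m₁ m₂ h1 h1' h2 h2' h using fun n => hC.bounded (U n) (hU n)
  have hkt : Measurable[𝓕 t] k := hk.mono (𝓕.mono hr) le_rfl
  refine ⟨fun ω => m₁ (k ω) ω, fun ω => m₂ (k ω) ω, measurable_concat le_rfl hkt h1,
    LocLp.concat (𝓕.le r) hk fun n => .of_memLp (h1' n), measurable_concat le_rfl hkt h2,
    LocLp.concat (𝓕.le r) hk fun n => .of_memLp (h2' n), ?_⟩
  have c1 := hφ.concat hp hkt fun n => memFuture_cash (T := T) (P := P) hp (h1 n)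
  have c2 := hφ.concat hp hkt fun n => memFuture_cash (T := T) (P := P) hp (h2 n)
  have c3 : ∀ᵐ ω ∂P, φ (U (k ω)) ω = φ V ω := ae_of_index k fun n => by
    filter_upwards [hφ.localProp (U n) V ((memFuture_iff hp).2 fun s hs hsT =>
      ⟨(hU n s hs hsT).1, .of_memLp (hU n s hs hsT).2⟩) hVt {ω | k ω ≤ n}
      (measurableSet_index_le hkt n) fun s _ _ => ae_of_all _ fun ω hω =>
        Set.indicator_of_mem hω _] with ω hω hn
    rw [hn]
    exact hω hn.le
  filter_upwards [c1, c2, c3, ae_all_iff.2 h] with ω c1 c2 c3 h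
  have := h (k ω)
  rw [c3] at this
  exact ⟨c1.trans_lt this.1, this.2.trans_eq c2.symm⟩

/-- The certainty equivalent is a real random variable, as integrable as the position, and makes
the cash position as good as the position. -/
theorem exists_certainty (hφ : IsUSCAssessmentIndex 𝓕 P T p t φ)
    (hC : HasCertaintyAssumptions 𝓕 P T p t φ) (hp : 1 ≤ p) {r : ℕ} (hr : r ≤ t)
    (hV : ∀ s, t ≤ s → s ≤ T → Measurable[𝓕 s] (V s) ∧ LocLp (𝓕 r) P p (V s)) :
    ∃ y : Ω → ℝ, Measurable[𝓕 t] y ∧ LocLp (𝓕 r) P p y ∧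
      IsEssInf (𝓕 t) P {g | ∃ m : Ω → ℝ, Measurable[𝓕 t] m ∧ φ V ≤ᵐ[P] φ (cash m) ∧
        g = fun ω => (m ω : EReal)} (fun ω => (y ω : EReal)) ∧
      φ (cash y) =ᵐ[P] φ V := by
  obtain ⟨m₁, m₂, h1, h1', h2, h2', hb⟩ := hφ.exists_cash_bounds hC hp hr hV
  have hVt : MemFuture 𝓕 P T p t V := (memFuture_iff hp).2 fun s hs hsT =>
    ⟨(hV s hs hsT).1, (hV s hs hsT).2.mono_sigma (𝓕.mono hr)⟩
  let S : Set (Ω → EReal) := {g | ∃ m : Ω → ℝ, Measurable[𝓕 t] m ∧ φ V ≤ᵐ[P] φ (cash m) ∧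
        g = fun ω => (m ω : EReal)}
  have hSm : ∀ f ∈ S, Measurable[𝓕 t] f := by
    rintro _ ⟨m, hm, -, rfl⟩
    exact hm.coe_real_ereal
  have hS2 : (fun ω => (m₂ ω : EReal)) ∈ S := ⟨m₂, h2, hb.mono fun _ h => h.2, rfl⟩
  have hg := isEssInf_essInf (P := P) (𝓕.le t) hSm
  set g := essInf (𝓕 t) P S
  have hg2 : ∀ᵐ ω ∂P, g ω ≤ m₂ ω := hg.2.1 _ hS2
  -- `m₁` is strictly worse than `V`, hence below every amount that is at least as good; so the
  -- infimum is finite.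
  have hg1 : ∀ᵐ ω ∂P, (m₁ ω : EReal) ≤ g ω := hg.2.2 _ h1.coe_real_ereal (by
    rintro _ ⟨m, hm, hVm, rfl⟩
    filter_upwards [hb, hVm, hφ.cash_lt_iff hC hp h1 hm] with ω hb hVm hiff
    exact EReal.coe_le_coe_iff.2 (hiff.1 (hb.1.trans_le hVm)).le)
  let y : Ω → ℝ := fun ω => (g ω).toReal
  have hy : Measurable[𝓕 t] y := hg.1.ereal_toReal
  have hgy : ∀ᵐ ω ∂P, g ω = y ω := by
    filter_upwards [hg1, hg2] with ω h1 h2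
    exact (EReal.coe_toReal (h2.trans_lt (EReal.coe_lt_top _)).ne
      ((EReal.bot_lt_coe _).trans_le h1).ne').symm
  have hey : IsEssInf (𝓕 t) P S (fun ω => (y ω : EReal)) :=
    hg.congr hy.coe_real_ereal hgy (fun f hf => ⟨f, hf, EventuallyLE.rfl⟩)
      fun f hf => ⟨f, hf, EventuallyLE.rfl⟩
  -- Pasted admissible amounts approximate `y` from above within any `ε`, and the superlevel set at
  -- `φ V` is closed.
  have hge : φ V ≤ᵐ[P] φ (cash y) := by
    refine cash_mem_of_isCondClosed hp (hφ.usc (φ V) (hφ.measurable V hVt)) hy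
      fun ε hε hε0 => ?_
    obtain ⟨f, hfS, hf⟩ := hey.exists_seq_lt (𝓕.le t) hSm ⟨_, hS2⟩
      (h := fun ω => ((y ω + ε ω : ℝ) : EReal)) (hy.add hε).coe_real_ereal
    choose m hm hVm hfm using hfS
    obtain ⟨j, hj, hjm⟩ := exists_measurable_index (m := 𝓕 t) (P := P)
      (B := fun n => {ω | m n ω < y ω + ε ω}) (fun n => measurableSet_lt (hm n) (hy.add hε)) (by
        filter_upwards [hf] with ω hω
        obtain ⟨n, hn⟩ := hω (EReal.coe_lt_coe_iff.2 (lt_add_of_pos_right _ (hε0 ω)))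
        rw [hfm n] at hn
        exact ⟨n, EReal.coe_lt_coe_iff.1 hn⟩)
    have hmj : Measurable[𝓕 t] fun ω => m (j ω) ω := measurable_concat le_rfl hj hm
    have hVj : φ V ≤ᵐ[P] φ (cash fun ω => m (j ω) ω) := by
      filter_upwards [hφ.concat hp hj fun n => memFuture_cash (T := T) (P := P) hp (hm n),
        ae_all_iff.2 hVm] with ω h1 h2
      exact (h2 (j ω)).trans_eq h1.symm
    refine ⟨fun ω => m (j ω) ω, hmj, hVj, ?_⟩
    filter_upwards [hjm, hey.2.1 _ ⟨_, hmj, hVj, rfl⟩] with ω (h1 : m (j ω) ω < y ω + ε ω) h2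
    have h2' := EReal.coe_le_coe_iff.1 h2
    rw [abs_of_nonneg (sub_nonneg.2 h2')]
    linarith
  refine ⟨y, hy, ?_, hey, ?_⟩
  · refine (h1'.abs.add (𝓕.le r) h2'.abs).of_le
      (hy.mono (𝓕.le t) le_rfl).aestronglyMeasurable (𝓕.le r) ?_
    filter_upwards [hg1, hg2, hgy] with ω h1 h2 h3
    rw [h3] at h1 h2
    have h1 := EReal.coe_le_coe_iff.1 h1
    have h2 := EReal.coe_le_coe_iff.1 h2
    rw [abs_of_nonneg (add_nonneg (abs_nonneg (m₁ ω)) (abs_nonneg (m₂ ω))), abs_le]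
    constructor
    · linarith [neg_abs_le (m₁ ω), abs_nonneg (m₂ ω)]
    · linarith [le_abs_self (m₂ ω), abs_nonneg (m₁ ω)]
  · have hyF := memFuture_cash (T := T) (P := P) hp hy
    -- Sensitivity: where cash `y` were strictly better than `V`, `y` could be lowered by some `ε >
    -- 0` and remain admissible, although it is a lower bound of the admissible amounts.
    have hA : MeasurableSet[𝓕 t] {ω | φ V ω < φ (cash y) ω} :=
      measurableSet_lt (hφ.measurable V hVt) (hφ.measurable _ hyF)
    obtain ⟨ε, hε, hε0, hεA, hεV⟩ := hC.sensitive y V hy hVt _ hA (ae_of_all _ fun _ h => h)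
    have hsub : Measurable[𝓕 t] fun ω => y ω - ε ω := hy.sub hε
    have hyε := memFuture_cash (T := T) (P := P) hp hsub
    have hpaste := hφ.paste_eq hp hA hyε hyF
    classical
    have e : paste {ω | φ V ω < φ (cash y) ω} (cash fun ω => y ω - ε ω) (cash y) =
      cash (fun ω => if φ V ω < φ (cash y) ω then y ω - ε ω else y ω) := by
      ext s ω
      by_cases h : φ V ω < φ (cash y) ω <;> simp [paste, cash, h]
    have hin := hey.2.1 (fun ω => (((if φ V ω < φ (cash y) ω then y ω - ε ω else y ω) : ℝ) : EReal))
      ⟨_, Measurable.ite hA hsub hy, by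
        rw [← e]
        filter_upwards [hεV, hge, hpaste.1, hpaste.2] with ω h1 h2 h3 h4
        by_cases h : ω ∈ {ω | φ V ω < φ (cash y) ω}
        · exact (h1 h).trans_eq (h3 h).symm
        · exact h2.trans_eq (h4 h).symm, rfl⟩
    filter_upwards [hin, hεA, hge] with ω h1 h2 h3
    refine le_antisymm (not_lt.1 fun h => ?_) h3
    simp only [h, if_true] at h1
    linarith [EReal.coe_le_coe_iff.1 h1, h2 h]

end IsUSCAssessmentIndex

end Certainty

/-! ### Right- and left-continuous versions -/

section Versions

variable {Ω : Type*} {m m0 : MeasurableSpace Ω} {P : Measure Ω} [IsProbabilityMeasure P]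
  {G G' : (Ω → EReal) → Ω → EReal} {s s' : Ω → EReal}

/-- `G` maps `L̄⁰(m)` to itself. -/
def PreservesMeasurable (m : MeasurableSpace Ω) (G : (Ω → EReal) → Ω → EReal) : Prop :=
  ∀ s, Measurable[m] s → Measurable[m] (G s)

/-- `G` is local and increasing. -/
def LocallyIncreasing (m : MeasurableSpace Ω) {m0 : MeasurableSpace Ω} (P : Measure Ω)
    (G : (Ω → EReal) → Ω → EReal) : Prop :=
  ∀ s s', Measurable[m] s → Measurable[m] s' → ∀ A, MeasurableSet[m] A →
    (∀ᵐ ω ∂P, ω ∈ A → s ω ≤ s' ω) → ∀ᵐ ω ∂P, ω ∈ A → G s ω ≤ G s' ω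

theorem isEssInf_rightVersion (hm : m ≤ m0) (hG : PreservesMeasurable m G) :
    IsEssInf m P {g | ∃ n : Ω → EReal, Measurable[m] n ∧ (∀ᵐ ω ∂P, s ω < ⊤ → s ω < n ω) ∧ g = G n}
      (essInf m P {g | ∃ n : Ω → EReal, Measurable[m] n ∧
        (∀ᵐ ω ∂P, s ω < ⊤ → s ω < n ω) ∧ g = G n}) :=
  isEssInf_essInf hm (by rintro _ ⟨n, hn, -, rfl⟩; exact hG n hn)

theorem isEssSup_leftVersion (hm : m ≤ m0) (hG : PreservesMeasurable m G) :
    IsEssSup m P {g | ∃ n : Ω → EReal, Measurable[m] n ∧ (∀ᵐ ω ∂P, ⊥ < s ω → n ω < s ω) ∧ g = G n}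
      (essSup m P {g | ∃ n : Ω → EReal, Measurable[m] n ∧
        (∀ᵐ ω ∂P, ⊥ < s ω → n ω < s ω) ∧ g = G n}) :=
  isEssSup_essSup hm (by rintro _ ⟨n, hn, -, rfl⟩; exact hG n hn)

theorem PreservesMeasurable.rightVersion (hm : m ≤ m0) (hG : PreservesMeasurable m G) :
    PreservesMeasurable m (rightVersion m P G) := fun s hs => by
  classical
  unfold DynIndex.rightVersion
  exact Measurable.ite (measurableSet_lt hs measurable_const)
    (isEssInf_rightVersion (P := P) hm hG).1 measurable_const

/-- Set to `⊤` off `A`, `n` competes in the infimum that defines the right version; local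
monotonicity brings the bound back to `n` on `A`. -/
theorem rightVersion_le (hm : m ≤ m0) (hG : PreservesMeasurable m G)
    (hi : LocallyIncreasing m P G) {n : Ω → EReal} (hn : Measurable[m] n) {A : Set Ω}
    (hA : MeasurableSet[m] A) (h : ∀ᵐ ω ∂P, ω ∈ A → s ω < n ω) :
    ∀ᵐ ω ∂P, ω ∈ A → rightVersion m P G s ω ≤ G n ω := by
  classical
  have hn' : Measurable[m] (A.piecewise n fun _ => ⊤) := hn.piecewise hA measurable_const
  have h1 := (isEssInf_rightVersion (P := P) (s := s) hm hG).2.1 _ ⟨_, hn', by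
    filter_upwards [h] with ω hω hs
    by_cases hωA : ω ∈ A
    · simpa [hωA] using hω hωA
    · simpa [hωA] using hs, rfl⟩
  have h2 := hi _ n hn' hn A hA (ae_of_all _ fun ω hω => by simp [hω])
  filter_upwards [h1, h2, h] with ω h1 h2 h hω
  have : s ω < ⊤ := (h hω).trans_le le_top
  simp only [rightVersion, if_pos this]
  exact h1.trans (h2 hω)

theorem le_rightVersion (hm : m ≤ m0) (hG : PreservesMeasurable m G) (hs : Measurable[m] s)
    {h : Ω → EReal} (hh : Measurable[m] h) {A : Set Ω} (hA : MeasurableSet[m] A)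
    (H : ∀ n, Measurable[m] n → (∀ᵐ ω ∂P, s ω < ⊤ → s ω < n ω) →
      ∀ᵐ ω ∂P, ω ∈ A → s ω < ⊤ → h ω ≤ G n ω) :
    ∀ᵐ ω ∂P, ω ∈ A → h ω ≤ rightVersion m P G s ω := by
  have := (isEssInf_rightVersion (P := P) (s := s) hm hG).ge_on
    (hA.inter (measurableSet_lt hs measurable_const)) hh (by
      rintro _ ⟨n, hn, hsn, rfl⟩
      filter_upwards [H n hn hsn] with ω hω hωA
      exact hω hωA.1 hωA.2)
  filter_upwards [this] with ω hω hωA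
  by_cases hs : s ω < ⊤
  · simp only [rightVersion, if_pos hs]
    exact hω ⟨hωA, hs⟩
  · simp [rightVersion, if_neg hs]

theorem rightVersion_le_rightVersion (hm : m ≤ m0) (hG : PreservesMeasurable m G)
    (hi : LocallyIncreasing m P G) (hG' : PreservesMeasurable m G') (hs : Measurable[m] s)
    (hs' : Measurable[m] s') {A : Set Ω} (hA : MeasurableSet[m] A)
    (hGG' : ∀ n, Measurable[m] n → ∀ᵐ ω ∂P, ω ∈ A → G n ω ≤ G' n ω)
    (h : ∀ᵐ ω ∂P, ω ∈ A → s ω ≤ s' ω) :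
    ∀ᵐ ω ∂P, ω ∈ A → rightVersion m P G s ω ≤ rightVersion m P G' s' ω := by
  refine le_rightVersion hm hG' hs' (hG.rightVersion hm s hs) hA fun n hn hsn => ?_
  have := rightVersion_le (s := s) hm hG hi hn
    (hA.inter (measurableSet_lt hs' measurable_const)) (by
      filter_upwards [h, hsn] with ω h1 h2 hω
      exact (h1 hω.1).trans_lt (h2 hω.2))
  filter_upwards [this, hGG' n hn] with ω h1 h2 hω hs
  exact (h1 ⟨hω, hs⟩).trans (h2 hω)

theorem LocallyIncreasing.rightVersion (hm : m ≤ m0) (hG : PreservesMeasurable m G)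
    (hi : LocallyIncreasing m P G) : LocallyIncreasing m P (rightVersion m P G) :=
  fun _ _ hs hs' _ hA h => rightVersion_le_rightVersion hm hG hi hG hs hs' hA
    (fun _ _ => ae_of_all _ fun _ _ => le_rfl) h

theorem self_le_rightVersion (hm : m ≤ m0) (hG : PreservesMeasurable m G)
    (hi : LocallyIncreasing m P G) (hs : Measurable[m] s) : G s ≤ᵐ[P] rightVersion m P G s := by
  have := le_rightVersion (P := P) (A := Set.univ) hm hG hs (hG s hs) .univ fun n hn hsn => by
    filter_upwards [hi s n hs hn {ω | s ω < ⊤} (measurableSet_lt hs measurable_const)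
      (hsn.mono fun ω hω h => (hω h).le)] with ω hω _ h
    exact hω h
  exact this.mono fun ω hω => hω trivial

/-- Between `s` and a competitor `n` lies a real `r`: the twice regularized value at `s` is at most
the once regularized value at `r`, which is at most `G n`. -/
theorem rightVersion_idem (hm : m ≤ m0) (hG : PreservesMeasurable m G)
    (hi : LocallyIncreasing m P G) (hs : Measurable[m] s) :
    rightVersion m P G s =ᵐ[P] rightVersion m P (rightVersion m P G) s := by
  have hG1 := hG.rightVersion (P := P) hm
  have hi1 := hi.rightVersion hm hG
  refine (self_le_rightVersion hm hG1 hi1 hs).antisymm ?_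
  have := le_rightVersion (P := P) (A := Set.univ) hm hG hs (hG1.rightVersion (P := P) hm s hs)
    .univ fun n hn hsn => by
      obtain ⟨r, hr, hrs⟩ := exists_measurable_between hs hn
      have hA : MeasurableSet[m] {ω | s ω < ⊤ ∧ s ω < n ω} :=
        (measurableSet_lt hs measurable_const).inter (measurableSet_lt hs hn)
      have h1 := rightVersion_le (s := s) hm hG1 hi1 hr.coe_real_ereal hA
        (ae_of_all _ fun ω hω => (hrs ω hω.2).1)
      have h2 := rightVersion_le (P := P) (s := fun ω => (r ω : EReal)) hm hG hi hn hA
        (ae_of_all _ fun ω hω => (hrs ω hω.2).2)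
      filter_upwards [h1, h2, hsn] with ω h1 h2 h3 _ hs
      exact (h1 ⟨hs, h3 hs⟩).trans (h2 ⟨hs, h3 hs⟩)
  exact this.mono fun ω hω => hω trivial

theorem leftVersion_le (hm : m ≤ m0) (hG : PreservesMeasurable m G) {s : Ω → ℝ}
    {h : Ω → EReal} (hh : Measurable[m] h)
    (H : ∀ n : Ω → EReal, Measurable[m] n → (∀ᵐ ω ∂P, n ω < s ω) → G n ≤ᵐ[P] h) :
    leftVersion m P G (fun ω => (s ω : EReal)) ≤ᵐ[P] h := by
  have := (isEssSup_leftVersion (P := P) (s := fun ω => (s ω : EReal)) hm hG).2.2 h hh (by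
    rintro _ ⟨n, hn, hsn, rfl⟩
    exact H n hn (hsn.mono fun ω hω => hω (EReal.bot_lt_coe _)))
  filter_upwards [this] with ω hω
  simpa only [leftVersion, if_pos (EReal.bot_lt_coe _)] using hω

theorem le_leftVersion (hm : m ≤ m0) (hG : PreservesMeasurable m G) {s : Ω → ℝ}
    {n : Ω → EReal} (hn : Measurable[m] n) (h : ∀ᵐ ω ∂P, n ω < s ω) :
    G n ≤ᵐ[P] leftVersion m P G (fun ω => (s ω : EReal)) := by
  filter_upwards [(isEssSup_leftVersion (P := P) (s := fun ω => (s ω : EReal)) hm hG).2.1 _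
    ⟨n, hn, h.mono fun ω hω _ => hω, rfl⟩] with ω hω
  simpa only [leftVersion, if_pos (EReal.bot_lt_coe _)] using hω

end Versions

/-! ### One-step measures -/

section OneStep

variable {Ω : Type*} {m0 : MeasurableSpace Ω} {𝓕 : Filtration ℕ m0} {P : Measure Ω}
  {T t : ℕ} {p q : ℝ≥0∞} {w w' : QD Ω} {x : Ω → ℝ}

theorem mem_MD_iff (ht : t < T) : w ∈ MD 𝓕 P T q t ↔
    Measurable[𝓕 (t + 1)] w.Z ∧ (∀ ω, 0 ≤ w.Z ω) ∧
      (∀ A, MeasurableSet[𝓕 t] A → w.Q P A = P A) ∧ MemCondLp (𝓕 t) P q w.Z ∧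
      Measurable[𝓕 t] w.D ∧ (∀ ω, 0 ≤ w.D ω ∧ w.D ω ≤ 1) := by
  change (if t < T then _ else _) ↔ _
  rw [if_pos ht]

/-- The argument of the conditional expectation in `QD.expect`. -/
theorem measurable_expect_arg (hD : Measurable w.D) (hx : Measurable x) {Y : Ω → EReal}
    (hY : Measurable Y) :
    Measurable fun ω => (w.D ω : EReal) * (Y ω - (x ω : EReal)) + (x ω : EReal) :=
  (hD.coe_real_ereal.mul (hY.sub hx.coe_real_ereal)).add hx.coe_real_ereal

theorem measurable_expect (Y : Ω → EReal) : Measurable[𝓕 t] (w.expect 𝓕 P t x Y) :=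
  measurable_condE _ _ _

theorem measurable_tensor_fst (ht : t < T) (hw : w ∈ MD 𝓕 P T q t) :
    Measurable[𝓕 t] fun ω => (w.tensor ω).1 :=
  measurable_const.sub ((mem_MD_iff ht).1 hw).2.2.2.2.1

/-- The duality `⟨Q ⊗ D, (x, Y)⟩` in terms of the density of `Q ⊗ D`. -/
noncomputable def tensorPairing (m : MeasurableSpace Ω) {m0 : MeasurableSpace Ω} (P : Measure Ω)
    (τ : Ω → ℝ × ℝ) (x Y : Ω → ℝ) : Ω → ℝ :=
  fun ω => (τ ω).1 * x ω + cE m P (fun ω => (τ ω).2 * Y ω) ω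

theorem measurable_tensorPairing {m : MeasurableSpace Ω} {τ : Ω → ℝ × ℝ} {x Y : Ω → ℝ}
    (hτ : Measurable[m] fun ω => (τ ω).1) (hx : Measurable[m] x) :
    Measurable[m] (tensorPairing m P τ x Y) :=
  (hτ.mul hx).add (measurable_cE _ _ _)

variable [IsProbabilityMeasure P]

theorem Q_eq_iff : (∀ A, MeasurableSet[𝓕 t] A → w.Q P A = P A) ↔
    condLExp (𝓕 t) P (fun ω => ENNReal.ofReal (w.Z ω)) =ᵐ[P] fun _ => 1 := by
  constructor
  · intro h
    refine (ae_eq_condLExp (𝓕.le t) P _ measurable_const fun A hA => ?_).symm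
    rw [setLIntegral_one, ← h A hA, QD.Q, withDensity_apply _ (𝓕.le t _ hA)]
  · intro h A hA
    rw [QD.Q, withDensity_apply _ (𝓕.le t _ hA), ← setLIntegral_condLExp (𝓕.le t) P _ hA,
      setLIntegral_congr_fun_ae (𝓕.le t _ hA) (h.mono fun ω hω _ => hω), setLIntegral_one]

/-- Bayes' formula. -/
theorem condLExp_Q (hZ : Measurable w.Z) (hQ : ∀ A, MeasurableSet[𝓕 t] A → w.Q P A = P A)
    {f : Ω → ℝ≥0∞} (hf : Measurable f) :
    condLExp (𝓕 t) (w.Q P) f =ᵐ[P] condLExp (𝓕 t) P fun ω => ENNReal.ofReal (w.Z ω) * f ω := by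
  have : IsProbabilityMeasure (w.Q P) := ⟨by rw [hQ _ .univ]; exact measure_univ⟩
  -- `Q` and `P` agree on 𝓕ₜ, so integrals of 𝓕ₜ-measurable functions pass from one to the other;
  -- this is why no normalizing denominator appears.
  have htrim : (w.Q P).trim (𝓕.le t) = P.trim (𝓕.le t) := by
    refine @Measure.ext _ (𝓕 t) _ _ fun A hA => ?_
    rw [trim_measurableSet_eq _ hA, trim_measurableSet_eq _ hA, hQ A hA]
  refine ae_eq_condLExp (𝓕.le t) P _ (measurable_condLExp _ _ _) fun A hA => ?_
  rw [← setLIntegral_trim (𝓕.le t) (measurable_condLExp _ _ _) hA, ← htrim,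
    setLIntegral_trim (𝓕.le t) (measurable_condLExp _ _ _) hA,
    setLIntegral_condLExp (𝓕.le t) (w.Q P) _ hA, QD.Q,
    setLIntegral_withDensity_eq_setLIntegral_mul _ hZ.ennreal_ofReal hf (𝓕.le t _ hA)]
  rfl

theorem condE_Q (hZ : Measurable w.Z) (hQ : ∀ A, MeasurableSet[𝓕 t] A → w.Q P A = P A)
    {f : Ω → EReal} (hf : Measurable f) :
    condE (𝓕 t) (w.Q P) f =ᵐ[P] fun ω =>
      (condLExp (𝓕 t) P (fun ω => ENNReal.ofReal (w.Z ω) * (f ω).toENNReal) ω : EReal) -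
        (condLExp (𝓕 t) P (fun ω => ENNReal.ofReal (w.Z ω) * (-f ω).toENNReal) ω : EReal) := by
  filter_upwards [condLExp_Q hZ hQ (f := fun ω => (f ω).toENNReal) hf.ereal_toENNReal,
    condLExp_Q hZ hQ (f := fun ω => (-f ω).toENNReal) hf.neg.ereal_toENNReal] with ω h1 h2
  simp only [condE, h1, h2]

theorem expect_mono (ht : t < T) (hw : w ∈ MD 𝓕 P T q t) (hx : Measurable x)
    {Y Y' : Ω → EReal} (hY : Measurable Y) (hY' : Measurable Y') (h : Y ≤ᵐ[P] Y') :
    w.expect 𝓕 P t x Y ≤ᵐ[P] w.expect 𝓕 P t x Y' := by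
  obtain ⟨hZ, -, hQ, -, hD, hD1⟩ := (mem_MD_iff ht).1 hw
  have hZ := hZ.mono (𝓕.le _) le_rfl
  have hD := hD.mono (𝓕.le _) le_rfl
  have hle : ∀ᵐ ω ∂P, (w.D ω : EReal) * (Y ω - (x ω : EReal)) + (x ω : EReal) ≤
      (w.D ω : EReal) * (Y' ω - (x ω : EReal)) + (x ω : EReal) := by
    filter_upwards [h] with ω hω
    exact add_le_add_left (mul_le_mul_of_nonneg_left (EReal.sub_le_sub hω le_rfl)
      (EReal.coe_nonneg.2 (hD1 ω).1)) _
  filter_upwards [condE_Q hZ hQ (measurable_expect_arg hD hx hY),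
    condE_Q hZ hQ (measurable_expect_arg hD hx hY'),
    condLExp_mono (mΩ := 𝓕 t) (P := P) (hle.mono fun ω hω =>
      mul_le_mul_right (EReal.toENNReal_le_toENNReal hω) (ENNReal.ofReal (w.Z ω))),
    condLExp_mono (mΩ := 𝓕 t) (P := P) (hle.mono fun ω hω =>
      mul_le_mul_right (EReal.toENNReal_le_toENNReal (EReal.neg_le_neg_iff.2 hω))
        (ENNReal.ofReal (w.Z ω)))] with ω h1 h2 h3 h4
  rw [QD.expect, QD.expect, h1, h2]
  exact EReal.sub_le_sub (EReal.coe_ennreal_le_coe_ennreal_iff.2 h3)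
    (EReal.coe_ennreal_le_coe_ennreal_iff.2 h4)

theorem expect_congr_on (ht : t < T) (hw : w ∈ MD 𝓕 P T q t) (hw' : w' ∈ MD 𝓕 P T q t)
    (hx : Measurable x) {Y : Ω → EReal} (hY : Measurable Y) {A : Set Ω}
    (hA : MeasurableSet[𝓕 t] A) (h : ∀ᵐ ω ∂P, ω ∈ A → w.Z ω = w'.Z ω ∧ w.D ω = w'.D ω) :
    ∀ᵐ ω ∂P, ω ∈ A → w.expect 𝓕 P t x Y ω = w'.expect 𝓕 P t x Y ω := by
  obtain ⟨hZ, -, hQ, -, hD, hD1⟩ := (mem_MD_iff ht).1 hw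
  obtain ⟨hZ', -, hQ', -, hD', hD1'⟩ := (mem_MD_iff ht).1 hw'
  have hZ := hZ.mono (𝓕.le _) le_rfl
  have hD := hD.mono (𝓕.le _) le_rfl
  have hZ' := hZ'.mono (𝓕.le _) le_rfl
  have hD' := hD'.mono (𝓕.le _) le_rfl
  have hm := measurable_expect_arg hD hx hY
  have hm' := measurable_expect_arg hD' hx hY
  filter_upwards [condE_Q hZ hQ hm, condE_Q hZ' hQ' hm',
    condLExp_congr_on (P := P) (𝓕.le t) hA (F := fun ω => ENNReal.ofReal (w.Z ω) *
        ((w.D ω : EReal) * (Y ω - (x ω : EReal)) + (x ω : EReal)).toENNReal)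
      (G := fun ω => ENNReal.ofReal (w'.Z ω) *
        ((w'.D ω : EReal) * (Y ω - (x ω : EReal)) + (x ω : EReal)).toENNReal) (by
          filter_upwards [h] with ω hω hA
          rw [(hω hA).1, (hω hA).2]),
    condLExp_congr_on (P := P) (𝓕.le t) hA (F := fun ω => ENNReal.ofReal (w.Z ω) *
        (-((w.D ω : EReal) * (Y ω - (x ω : EReal)) + (x ω : EReal))).toENNReal)
      (G := fun ω => ENNReal.ofReal (w'.Z ω) *
        (-((w'.D ω : EReal) * (Y ω - (x ω : EReal)) + (x ω : EReal))).toENNReal) (by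
          filter_upwards [h] with ω hω hA
          rw [(hω hA).1, (hω hA).2])] with ω h1 h2 h3 h4 hω
  rw [QD.expect, QD.expect, h1, h2, h3 hω, h4 hω]

variable [ENNReal.HolderConjugate p q]

theorem MD.locLp (hq : 1 ≤ q) (ht : t < T) (hw : w ∈ MD 𝓕 P T q t) :
    LocLp (𝓕 t) P q w.Z := by
  obtain ⟨hZ, -, hQ, hZq, hD, hD1⟩ := (mem_MD_iff ht).1 hw
  exact (memCondLp_iff (𝓕.le t) (hZ.mono (𝓕.le _) le_rfl) (one_pos.trans_le hq).ne').1 hZq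

theorem cE_Z (ht : t < T) (hw : w ∈ MD 𝓕 P T q t) : cE (𝓕 t) P w.Z =ᵐ[P] fun _ => 1 := by
  obtain ⟨hZ, hZ0, hQ, hZq, hD, hD1⟩ := (mem_MD_iff ht).1 hw
  filter_upwards [Q_eq_iff.1 hQ] with ω hω
  have e1 : (fun ω => ((w.Z ω : EReal)).toENNReal) = fun ω => ENNReal.ofReal (w.Z ω) := by
    ext ω
    rw [EReal.toENNReal_of_ne_top (by simp)]
    simp
  have e2 : (fun ω => (-(w.Z ω : EReal)).toENNReal) = 0 := by
    ext ω
    exact EReal.toENNReal_of_nonpos (by simpa using hZ0 ω)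
  simp only [cE, condE, e1, e2, hω, condLExp_zero]
  simp

theorem memTwoStep_iff (hp : 1 ≤ p) {x Y : Ω → ℝ} : MemTwoStep 𝓕 P p t x Y ↔
    Measurable[𝓕 t] x ∧ Measurable[𝓕 (t + 1)] Y ∧ LocLp (𝓕 t) P p Y :=
  and_congr_right fun _ => and_congr_right fun h =>
    memCondLp_iff (𝓕.le t) (h.mono (𝓕.le _) le_rfl) (one_pos.trans_le hp).ne'

/-- `Z D Y` is conditionally integrable. -/
theorem locLp_tensor_mul (p : ℝ≥0∞) [ENNReal.HolderConjugate p q] (ht : t < T)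
    (hw : w ∈ MD 𝓕 P T q t) {Y : Ω → ℝ} (hY : LocLp (𝓕 t) P p Y) :
    LocLp (𝓕 t) P 1 fun ω => (w.tensor ω).2 * Y ω := by
  obtain ⟨hZ, -, hQ, hZq, hD, hD1⟩ := (mem_MD_iff ht).1 hw
  have hqp : ENNReal.HolderTriple q p 1 := ENNReal.HolderTriple.symm
  have h1 := LocLp.mul (r := 1) (𝓕.le t) (MD.locLp (ENNReal.HolderConjugate.one_le q p) ht hw) hY
  have h2 := LocLp.measurable_mul (𝓕.le t) hD h1
  refine h2.congr (ae_of_all _ fun ω => ?_)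
  simp only [QD.tensor]
  ring

/-- Since `E[Z | 𝓕ₜ] = 1`, the part `(1 - D) x` leaves the expectation. The price of a real position
thus depends on `Q` and `D` only through the density of `Q ⊗ D`, and linearly, which is what
quasiconvexity and lower semicontinuity rest on. -/
theorem expect_real (ht : t < T) (hw : w ∈ MD 𝓕 P T q t) {Y : Ω → ℝ}
    (hY : MemTwoStep 𝓕 P p t x Y) :
    w.expect 𝓕 P t x (fun ω => (Y ω : EReal)) =ᵐ[P]
      fun ω => (tensorPairing (𝓕 t) P w.tensor x Y ω : EReal) := by
  have hp : 1 ≤ p := ENNReal.HolderConjugate.one_le p q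
  obtain ⟨hx, hYm, hYp⟩ := (memTwoStep_iff hp).1 hY
  obtain ⟨hZ, hZ0, hQ, hZq, hD, hD1⟩ := (mem_MD_iff ht).1 hw
  have hZm := hZ.mono (𝓕.le _) le_rfl
  have i1 := locLp_tensor_mul p ht hw hYp
  have i2 : LocLp (𝓕 t) P 1 w.Z :=
    (MD.locLp (ENNReal.HolderConjugate.one_le q p) ht hw).mono_exponent (ENNReal.HolderConjugate.one_le q p)
  have hDx : Measurable[𝓕 t] fun ω => (1 - w.D ω) * x ω := (measurable_const.sub hD).mul hx
  have i3 := LocLp.measurable_mul (𝓕.le t) hDx i2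
  -- This is `Z (D (Y - x) + x)`, regrouped so that each summand is locally integrable.
  let f : Ω → ℝ := fun ω => (w.tensor ω).2 * Y ω + (1 - w.D ω) * x ω * w.Z ω
  have hf : LocLp (𝓕 t) P 1 f := i1.add (𝓕.le t) i3
  have e1 : ∀ ω, ENNReal.ofReal (w.Z ω) *
      ((w.D ω : EReal) * ((Y ω : EReal) - (x ω : EReal)) + (x ω : EReal)).toENNReal =
        ((f ω : ℝ) : EReal).toENNReal := fun ω => by
    rw [← EReal.coe_sub, ← EReal.coe_mul, ← EReal.coe_add, EReal.toENNReal_of_ne_top (EReal.coe_ne_top _),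
      EReal.toENNReal_of_ne_top (EReal.coe_ne_top _), EReal.toReal_coe, EReal.toReal_coe,
      ← ENNReal.ofReal_mul (hZ0 ω)]
    congr 1
    simp only [f, QD.tensor]
    ring
  have e2 : ∀ ω, ENNReal.ofReal (w.Z ω) *
      (-((w.D ω : EReal) * ((Y ω : EReal) - (x ω : EReal)) + (x ω : EReal))).toENNReal =
        (-((f ω : ℝ) : EReal)).toENNReal := fun ω => by
    rw [← EReal.coe_sub, ← EReal.coe_mul, ← EReal.coe_add, ← EReal.coe_neg, ← EReal.coe_neg,
      EReal.toENNReal_of_ne_top (EReal.coe_ne_top _),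
      EReal.toENNReal_of_ne_top (EReal.coe_ne_top _), EReal.toReal_coe, EReal.toReal_coe,
      ← ENNReal.ofReal_mul (hZ0 ω)]
    congr 1
    simp only [f, QD.tensor]
    ring
  have h1 := condE_Q hZm hQ (measurable_expect_arg (hD.mono (𝓕.le t) le_rfl)
    (hx.mono (𝓕.le t) le_rfl) ((hYm.mono (𝓕.le _) le_rfl).coe_real_ereal))
  simp only [e1, e2] at h1
  filter_upwards [h1, hf.condE_eq (𝓕.le t), cE_add (𝓕.le t) i1 i3,
    cE_measurable_mul (𝓕.le t) hDx i2, cE_Z ht hw] with ω h1 h2 h3 h4 h5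
  rw [QD.expect, h1]
  refine h2.trans ?_
  rw [h3, h4, h5]
  simp only [tensorPairing, QD.tensor, mul_one, add_comm]

end OneStep

/-! ### The minimal risk function of a one-step certainty equivalent -/

section Risk

variable {Ω : Type*} {m0 : MeasurableSpace Ω} {𝓕 : Filtration ℕ m0} {P : Measure Ω}
  {T t : ℕ} {p q : ℝ≥0∞} {c : (Ω → ℝ) → (Ω → ℝ) → Ω → EReal}
  {w w' w'' : QD Ω} {τ τ' : Ω → ℝ × ℝ} {s s' : Ω → EReal}

open Classical in
/-- The largest certainty equivalent `c x Y` of the two-step positions with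
`⟨Q ⊗ D, (x, Y)⟩ < s`; this is the left-continuous version of the risk function. -/
noncomputable def lowerRisk (𝓕 : Filtration ℕ m0) (P : Measure Ω) (p : ℝ≥0∞) (t : ℕ)
    (c : (Ω → ℝ) → (Ω → ℝ) → Ω → EReal) (τ : Ω → ℝ × ℝ) (s : Ω → EReal) : Ω → EReal :=
  essSup (𝓕 t) P {g | ∃ x Y, MemTwoStep 𝓕 P p t x Y ∧ g = fun ω =>
    if (tensorPairing (𝓕 t) P τ x Y ω : EReal) < s ω then c x Y ω else ⊥}

/-- The minimal risk function of `c`. -/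
noncomputable def risk (𝓕 : Filtration ℕ m0) (P : Measure Ω) (p : ℝ≥0∞) (t : ℕ)
    (c : (Ω → ℝ) → (Ω → ℝ) → Ω → EReal) (τ : Ω → ℝ × ℝ) : (Ω → EReal) → Ω → EReal :=
  rightVersion (𝓕 t) P (lowerRisk 𝓕 P p t c τ)

variable [IsProbabilityMeasure P]

open Classical in
theorem isEssSup_lowerRisk (hc : ∀ x Y, MemTwoStep 𝓕 P p t x Y → Measurable[𝓕 t] (c x Y))
    (hτ : Measurable[𝓕 t] fun ω => (τ ω).1) (hs : Measurable[𝓕 t] s) :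
    IsEssSup (𝓕 t) P {g | ∃ x Y, MemTwoStep 𝓕 P p t x Y ∧ g = fun ω =>
      if (tensorPairing (𝓕 t) P τ x Y ω : EReal) < s ω then c x Y ω else ⊥}
      (lowerRisk 𝓕 P p t c τ s) := by
  refine isEssSup_essSup (𝓕.le t) ?_
  rintro _ ⟨x, Y, h, rfl⟩
  exact Measurable.ite
    (measurableSet_lt (measurable_tensorPairing hτ h.1).coe_real_ereal hs) (hc x Y h)
    measurable_const

theorem preservesMeasurable_lowerRisk
    (hc : ∀ x Y, MemTwoStep 𝓕 P p t x Y → Measurable[𝓕 t] (c x Y))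
    (hτ : Measurable[𝓕 t] fun ω => (τ ω).1) :
    PreservesMeasurable (𝓕 t) (lowerRisk 𝓕 P p t c τ) :=
  fun _ hs => (isEssSup_lowerRisk hc hτ hs).1

theorem le_lowerRisk (hc : ∀ x Y, MemTwoStep 𝓕 P p t x Y → Measurable[𝓕 t] (c x Y))
    (hτ : Measurable[𝓕 t] fun ω => (τ ω).1) (hs : Measurable[𝓕 t] s) {x Y : Ω → ℝ}
    (h : MemTwoStep 𝓕 P p t x Y) :
    ∀ᵐ ω ∂P, (tensorPairing (𝓕 t) P τ x Y ω : EReal) < s ω →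
      c x Y ω ≤ lowerRisk 𝓕 P p t c τ s ω := by
  classical
  filter_upwards [(isEssSup_lowerRisk hc hτ hs).2.1 _ ⟨x, Y, h, rfl⟩] with ω hω hlt
  simpa [hlt] using hω

theorem lowerRisk_le_on (hc : ∀ x Y, MemTwoStep 𝓕 P p t x Y → Measurable[𝓕 t] (c x Y))
    (hτ : Measurable[𝓕 t] fun ω => (τ ω).1) (hs : Measurable[𝓕 t] s) {h : Ω → EReal}
    (hh : Measurable[𝓕 t] h) {A : Set Ω} (hA : MeasurableSet[𝓕 t] A)
    (H : ∀ x Y, MemTwoStep 𝓕 P p t x Y → ∀ᵐ ω ∂P, ω ∈ A →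
      (tensorPairing (𝓕 t) P τ x Y ω : EReal) < s ω → c x Y ω ≤ h ω) :
    ∀ᵐ ω ∂P, ω ∈ A → lowerRisk 𝓕 P p t c τ s ω ≤ h ω := by
  classical
  refine (isEssSup_lowerRisk hc hτ hs).le_on hA hh ?_
  rintro _ ⟨x, Y, hxY, rfl⟩
  filter_upwards [H x Y hxY] with ω hω hωA
  by_cases hlt : (tensorPairing (𝓕 t) P τ x Y ω : EReal) < s ω
  · simpa [hlt] using hω hωA hlt
  · simp [hlt]

theorem tensorPairing_congr_on {A : Set Ω} (hA : MeasurableSet[𝓕 t] A)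
    (h : ∀ᵐ ω ∂P, ω ∈ A → τ ω = τ' ω) (x Y : Ω → ℝ) :
    ∀ᵐ ω ∂P, ω ∈ A → tensorPairing (𝓕 t) P τ x Y ω = tensorPairing (𝓕 t) P τ' x Y ω := by
  filter_upwards [h, cE_congr_on (P := P) (𝓕.le t) hA (f := fun ω => (τ ω).2 * Y ω)
    (g := fun ω => (τ' ω).2 * Y ω) (by
      filter_upwards [h] with ω hω hωA; rw [hω hωA])] with ω h1 h2 hω
  rw [tensorPairing, tensorPairing, h1 hω, h2 hω]

theorem lowerRisk_mono_on (hc : ∀ x Y, MemTwoStep 𝓕 P p t x Y → Measurable[𝓕 t] (c x Y))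
    (hτ : Measurable[𝓕 t] fun ω => (τ ω).1) (hτ' : Measurable[𝓕 t] fun ω => (τ' ω).1)
    (hs : Measurable[𝓕 t] s) (hs' : Measurable[𝓕 t] s') {A : Set Ω}
    (hA : MeasurableSet[𝓕 t] A) (h : ∀ᵐ ω ∂P, ω ∈ A → τ ω = τ' ω)
    (hss : ∀ᵐ ω ∂P, ω ∈ A → s ω ≤ s' ω) :
    ∀ᵐ ω ∂P, ω ∈ A → lowerRisk 𝓕 P p t c τ s ω ≤ lowerRisk 𝓕 P p t c τ' s' ω := by
  refine lowerRisk_le_on hc hτ hs (isEssSup_lowerRisk hc hτ' hs').1 hA fun x Y hxY => ?_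
  filter_upwards [le_lowerRisk hc hτ' hs' hxY, hss, tensorPairing_congr_on hA h x Y]
    with ω h1 h2 h3 hω hlt
  exact h1 ((h3 hω ▸ hlt).trans_le (h2 hω))

theorem locallyIncreasing_lowerRisk
    (hc : ∀ x Y, MemTwoStep 𝓕 P p t x Y → Measurable[𝓕 t] (c x Y))
    (hτ : Measurable[𝓕 t] fun ω => (τ ω).1) :
    LocallyIncreasing (𝓕 t) P (lowerRisk 𝓕 P p t c τ) :=
  fun _ _ hs hs' _ hA h =>
    lowerRisk_mono_on hc hτ hτ hs hs' hA (ae_of_all _ fun _ _ => rfl) h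

theorem preservesMeasurable_risk
    (hc : ∀ x Y, MemTwoStep 𝓕 P p t x Y → Measurable[𝓕 t] (c x Y))
    (hτ : Measurable[𝓕 t] fun ω => (τ ω).1) :
    PreservesMeasurable (𝓕 t) (risk 𝓕 P p t c τ) :=
  (preservesMeasurable_lowerRisk hc hτ).rightVersion (P := P) (𝓕.le t)

theorem risk_mono_on (hc : ∀ x Y, MemTwoStep 𝓕 P p t x Y → Measurable[𝓕 t] (c x Y))
    (hτ : Measurable[𝓕 t] fun ω => (τ ω).1) (hτ' : Measurable[𝓕 t] fun ω => (τ' ω).1)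
    (hs : Measurable[𝓕 t] s) (hs' : Measurable[𝓕 t] s') {A : Set Ω}
    (hA : MeasurableSet[𝓕 t] A) (h : ∀ᵐ ω ∂P, ω ∈ A → τ ω = τ' ω)
    (hss : ∀ᵐ ω ∂P, ω ∈ A → s ω ≤ s' ω) :
    ∀ᵐ ω ∂P, ω ∈ A → risk 𝓕 P p t c τ s ω ≤ risk 𝓕 P p t c τ' s' ω :=
  rightVersion_le_rightVersion (𝓕.le t) (preservesMeasurable_lowerRisk hc hτ)
    (locallyIncreasing_lowerRisk hc hτ) (preservesMeasurable_lowerRisk hc hτ') hs hs' hA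
    (fun _ hn => lowerRisk_mono_on hc hτ hτ' hn hn hA h (ae_of_all _ fun _ _ => le_rfl)) hss

/-- A position is no better than the risk function at its price. -/
theorem le_risk_tensorPairing
    (hc : ∀ x Y, MemTwoStep 𝓕 P p t x Y → Measurable[𝓕 t] (c x Y))
    (hτ : Measurable[𝓕 t] fun ω => (τ ω).1) {x Y : Ω → ℝ} (h : MemTwoStep 𝓕 P p t x Y) :
    c x Y ≤ᵐ[P] risk 𝓕 P p t c τ fun ω => (tensorPairing (𝓕 t) P τ x Y ω : EReal) := by
  have := le_rightVersion (P := P) (A := Set.univ) (𝓕.le t) (preservesMeasurable_lowerRisk hc hτ)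
    (measurable_tensorPairing (P := P) hτ h.1 (Y := Y)).coe_real_ereal (hc x Y h) .univ
    fun n hn hsn => by
      filter_upwards [le_lowerRisk hc hτ hn h, hsn] with ω h1 h2 _ h3
      exact h1 (h2 h3)
  exact this.mono fun ω hω => hω trivial

theorem le_leftVersion_risk
    (hc : ∀ x Y, MemTwoStep 𝓕 P p t x Y → Measurable[𝓕 t] (c x Y))
    (hτ : Measurable[𝓕 t] fun ω => (τ ω).1) {x Y : Ω → ℝ} (h : MemTwoStep 𝓕 P p t x Y)
    {s : Ω → ℝ} (hs : Measurable[𝓕 t] s) :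
    ∀ᵐ ω ∂P, tensorPairing (𝓕 t) P τ x Y ω < s ω →
      c x Y ω ≤ leftVersion (𝓕 t) P (risk 𝓕 P p t c τ) (fun ω => (s ω : EReal)) ω := by
  have ht := measurable_tensorPairing (P := P) hτ h.1 (Y := Y)
  -- The midpoint between the price and `s` where the price is below `s`, and `s - 1` elsewhere,
  -- since a competitor in the left version must satisfy `n < s` everywhere.
  let n : Ω → ℝ := fun ω => s ω - max ((s ω - tensorPairing (𝓕 t) P τ x Y ω) / 2)
    (if tensorPairing (𝓕 t) P τ x Y ω < s ω then 0 else 1)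
  have hn : Measurable[𝓕 t] n := hs.sub (((hs.sub ht).div_const 2).max
    (Measurable.ite (measurableSet_lt ht hs) measurable_const measurable_const))
  have hns : ∀ ω, n ω < s ω := fun ω => by
    simp only [n]
    split_ifs with h
    · linarith [le_max_left ((s ω - tensorPairing (𝓕 t) P τ x Y ω) / 2) 0]
    · linarith [le_max_right ((s ω - tensorPairing (𝓕 t) P τ x Y ω) / 2) 1]
  have hnt : ∀ ω, tensorPairing (𝓕 t) P τ x Y ω < s ω → tensorPairing (𝓕 t) P τ x Y ω < n ω :=
    fun ω h => by
      simp only [n, if_pos h]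
      rw [max_eq_left (by linarith)]
      linarith
  have h1 := le_leftVersion (P := P) (𝓕.le t) (preservesMeasurable_risk hc hτ)
    (s := s) hn.coe_real_ereal (ae_of_all _ fun ω => EReal.coe_lt_coe_iff.2 (hns ω))
  have h2 := self_le_rightVersion (P := P) (𝓕.le t) (preservesMeasurable_lowerRisk hc hτ)
    (locallyIncreasing_lowerRisk hc hτ) hn.coe_real_ereal
  filter_upwards [h1, h2, le_lowerRisk hc hτ hn.coe_real_ereal h] with ω h1 h2 h3 hlt
  exact (h3 (EReal.coe_lt_coe_iff.2 (hnt ω hlt))).trans (h2.trans h1)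

/-- For `n < s` the right version at `n` is at most `lowerRisk` at `s`. With `le_leftVersion_risk`
this identifies `lowerRisk` as the left-continuous version of the risk at real levels. -/
theorem leftVersion_risk_le
    (hc : ∀ x Y, MemTwoStep 𝓕 P p t x Y → Measurable[𝓕 t] (c x Y))
    (hτ : Measurable[𝓕 t] fun ω => (τ ω).1) {s : Ω → ℝ} (hs : Measurable[𝓕 t] s) :
    leftVersion (𝓕 t) P (risk 𝓕 P p t c τ) (fun ω => (s ω : EReal)) ≤ᵐ[P]
      lowerRisk 𝓕 P p t c τ (fun ω => (s ω : EReal)) := by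
  have hG := preservesMeasurable_lowerRisk (P := P) hc hτ
  refine leftVersion_le (𝓕.le t) (preservesMeasurable_risk hc hτ) (hG _ hs.coe_real_ereal)
    fun n hn hns => ?_
  have := rightVersion_le (P := P) (s := n) (A := Set.univ) (𝓕.le t) hG
    (locallyIncreasing_lowerRisk hc hτ) hs.coe_real_ereal .univ (hns.mono fun _ h _ => h)
  exact this.mono fun ω hω => hω trivial

/-- Neither `a` nor `b` can be `⊤`. A value `⊥` with positive weight makes the sum `⊥`, while with
weight zero it drops out because `0 · ⊥ = 0`; hence the separate treatment of `l = 0` and `l = 1`.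
-/
theorem convexComb_lt {l : ℝ} (hl : 0 ≤ l ∧ l ≤ 1) {a b : EReal} {r u : ℝ} (ha : a < r)
    (hb : b < u) :
    (l : EReal) * a + ((1 - l : ℝ) : EReal) * b < ((l * r + (1 - l) * u : ℝ) : EReal) := by
  rcases hl.1.eq_or_lt with rfl | h0
  · simpa using hb
  rcases hl.2.eq_or_lt with rfl | h1
  · simpa using ha
  have h1 : 0 < 1 - l := sub_pos.2 h1
  induction a with
  | bot => rw [EReal.coe_mul_bot_of_pos h0, EReal.bot_add]; exact EReal.bot_lt_coe _
  | top => exact absurd ha (not_lt.2 le_top)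
  | coe a =>
    induction b with
    | bot => rw [EReal.coe_mul_bot_of_pos h1, EReal.add_bot]; exact EReal.bot_lt_coe _
    | top => exact absurd hb (not_lt.2 le_top)
    | coe b =>
      have ha := EReal.coe_lt_coe_iff.1 ha
      have hb := EReal.coe_lt_coe_iff.1 hb
      rw [← EReal.coe_mul, ← EReal.coe_mul, ← EReal.coe_add, EReal.coe_lt_coe_iff]
      nlinarith

variable [ENNReal.HolderConjugate p q]

theorem tensorPairing_convexComb (ht : t < T) (hw : w ∈ MD 𝓕 P T q t) (hw' : w' ∈ MD 𝓕 P T q t)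
    {l : Ω → ℝ} (hl : Measurable[𝓕 t] l)
    (hww : ∀ᵐ ω ∂P, w''.tensor ω = l ω • w.tensor ω + (1 - l ω) • w'.tensor ω)
    {x Y : Ω → ℝ} (h : MemTwoStep 𝓕 P p t x Y) :
    ∀ᵐ ω ∂P, tensorPairing (𝓕 t) P w''.tensor x Y ω =
      l ω * tensorPairing (𝓕 t) P w.tensor x Y ω +
        (1 - l ω) * tensorPairing (𝓕 t) P w'.tensor x Y ω := by
  have hY := ((memTwoStep_iff (ENNReal.HolderConjugate.one_le p q)).1 h).2.2
  have i1 := locLp_tensor_mul p ht hw hY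
  have i2 := locLp_tensor_mul p ht hw' hY
  have hl' : Measurable[𝓕 t] fun ω => 1 - l ω := measurable_const.sub hl
  have e : (fun ω => (w''.tensor ω).2 * Y ω) =ᵐ[P] fun ω =>
      l ω * ((w.tensor ω).2 * Y ω) + (1 - l ω) * ((w'.tensor ω).2 * Y ω) := by
    filter_upwards [hww] with ω hω
    rw [hω]
    simp only [Prod.snd_add, Prod.smul_snd, smul_eq_mul]
    ring
  filter_upwards [hww, cE_congr (𝓕.le t) e, cE_add (𝓕.le t)
    (LocLp.measurable_mul (𝓕.le t) hl i1) (LocLp.measurable_mul (𝓕.le t) hl' i2),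
    cE_measurable_mul (𝓕.le t) hl i1, cE_measurable_mul (𝓕.le t) hl' i2] with ω h1 h2 h3 h4 h5
  simp only [tensorPairing]
  rw [h2, h3, h4, h5, h1]
  simp only [Prod.fst_add, Prod.smul_fst, smul_eq_mul]
  ring

/-- If `l π + (1 - l) π' < l r + (1 - l) r'`, then `π < r` or `π' < r'`. So a position priced below
the mixed level under the mixed measure is priced below its level under one of the two measures, and
its value is counted in one of the two suprema. -/
theorem risk_quasiconvex (hc : ∀ x Y, MemTwoStep 𝓕 P p t x Y → Measurable[𝓕 t] (c x Y))
    (ht : t < T) (hw : w ∈ MD 𝓕 P T q t) (hw' : w' ∈ MD 𝓕 P T q t)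
    (hw'' : w'' ∈ MD 𝓕 P T q t) (hs : Measurable[𝓕 t] s) (hs' : Measurable[𝓕 t] s')
    {l : Ω → ℝ} (hl : Measurable[𝓕 t] l) (hl01 : ∀ ω, 0 ≤ l ω ∧ l ω ≤ 1)
    (hww : ∀ᵐ ω ∂P, w''.tensor ω = l ω • w.tensor ω + (1 - l ω) • w'.tensor ω) :
    ∀ᵐ ω ∂P, risk 𝓕 P p t c w''.tensor
        (fun ω => (l ω : EReal) * s ω + ((1 - l ω : ℝ) : EReal) * s' ω) ω ≤
      max (risk 𝓕 P p t c w.tensor s ω) (risk 𝓕 P p t c w'.tensor s' ω) := by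
  have hτ := measurable_tensor_fst ht hw
  have hτ' := measurable_tensor_fst ht hw'
  have hτ'' := measurable_tensor_fst ht hw''
  have hG := preservesMeasurable_lowerRisk (P := P) hc hτ
  have hG' := preservesMeasurable_lowerRisk (P := P) hc hτ'
  have hG'' := preservesMeasurable_lowerRisk (P := P) hc hτ''
  have hs'' : Measurable[𝓕 t] fun ω => (l ω : EReal) * s ω + ((1 - l ω : ℝ) : EReal) * s' ω :=
    (hl.coe_real_ereal.mul hs).add ((measurable_const.sub hl).coe_real_ereal.mul hs')
  -- Off this set one of the two right versions is `⊤` by definition, and the bound is trivial.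
  have hA : MeasurableSet[𝓕 t] {ω | s ω < ⊤ ∧ s' ω < ⊤} :=
    (measurableSet_lt hs measurable_const).inter (measurableSet_lt hs' measurable_const)
  have key := le_max_essInf (P := P) (isEssInf_rightVersion (P := P) (s := s) (𝓕.le t) hG)
    (isEssInf_rightVersion (P := P) (s := s') (𝓕.le t) hG')
    (by rintro _ ⟨n, hn, -, rfl⟩; exact hG' n hn) hA
    (h := risk 𝓕 P p t c w''.tensor
      (fun ω => (l ω : EReal) * s ω + ((1 - l ω : ℝ) : EReal) * s' ω))
    (preservesMeasurable_risk hc hτ'' _ hs'') (by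
      rintro _ ⟨n, hn, hsn, rfl⟩ _ ⟨n', hn', hsn', rfl⟩
      obtain ⟨r, hr, hrs⟩ := exists_measurable_between hs hn
      obtain ⟨r', hr', hrs'⟩ := exists_measurable_between hs' hn'
      have hB : MeasurableSet[𝓕 t] {ω | s ω < n ω ∧ s' ω < n' ω} :=
        (measurableSet_lt hs hn).inter (measurableSet_lt hs' hn')
      have hk : Measurable[𝓕 t] fun ω => l ω * r ω + (1 - l ω) * r' ω :=
        (hl.mul hr).add ((measurable_const.sub hl).mul hr')
      have h1 := rightVersion_le (P := P) (𝓕.le t) hG''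
        (locallyIncreasing_lowerRisk hc hτ'') hk.coe_real_ereal hB
        (s := fun ω => (l ω : EReal) * s ω + ((1 - l ω : ℝ) : EReal) * s' ω)
        (ae_of_all _ fun ω hω => convexComb_lt (hl01 ω) (hrs ω hω.1).1 (hrs' ω hω.2).1)
      have h2 := lowerRisk_le_on (P := P) hc hτ'' hk.coe_real_ereal
        ((hG _ hn).max (hG' _ hn')) hB fun x Y hxY => by
          filter_upwards [tensorPairing_convexComb ht hw hw' hl hww hxY,
            le_lowerRisk hc hτ hn hxY, le_lowerRisk hc hτ' hn' hxY] with ω h1 h2 h3 hω hlt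
          rw [h1, EReal.coe_lt_coe_iff] at hlt
          rcases lt_or_ge (tensorPairing (𝓕 t) P w.tensor x Y ω) (r ω) with h | h
          · exact (h2 ((EReal.coe_lt_coe_iff.2 h).trans (hrs ω hω.1).2)).trans (le_max_left _ _)
          rcases lt_or_ge (tensorPairing (𝓕 t) P w'.tensor x Y ω) (r' ω) with h' | h'
          · exact (h3 ((EReal.coe_lt_coe_iff.2 h').trans (hrs' ω hω.2).2)).trans
              (le_max_right _ _)
          · have := hl01 ω
            nlinarith
      filter_upwards [h1, h2, hsn, hsn'] with ω h1 h2 h3 h4 hω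
      have hωB : ω ∈ {ω | s ω < n ω ∧ s' ω < n' ω} := ⟨h3 hω.1, h4 hω.2⟩
      exact (h1 hωB).trans (h2 hωB))
  filter_upwards [key] with ω hω
  by_cases h : s ω < ⊤
  · by_cases h' : s' ω < ⊤
    · have := hω ⟨h, h'⟩
      simp only [risk, rightVersion, if_pos h, if_pos h'] at this ⊢
      exact this
    · exact le_max_of_le_right (by simp [risk, rightVersion, if_neg h'])
  · exact le_max_of_le_left (by simp [risk, rightVersion, if_neg h])

/-- The supremum of the risk function over finite prices is the supremum of `c`. -/
theorem essSup_risk (hc : ∀ x Y, MemTwoStep 𝓕 P p t x Y → Measurable[𝓕 t] (c x Y))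
    (hτ : Measurable[𝓕 t] fun ω => (τ ω).1) :
    essSup (𝓕 t) P {g | ∃ s : Ω → ℝ, Measurable[𝓕 t] s ∧
      g = risk 𝓕 P p t c τ fun ω => (s ω : EReal)} =ᵐ[P]
    essSup (𝓕 t) P {g | ∃ x Y, MemTwoStep 𝓕 P p t x Y ∧ g = c x Y} := by
  have hR := preservesMeasurable_risk (P := P) hc hτ
  have hG := preservesMeasurable_lowerRisk (P := P) hc hτ
  have h1 : IsEssSup (𝓕 t) P _ (essSup (𝓕 t) P {g | ∃ s : Ω → ℝ, Measurable[𝓕 t] s ∧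
      g = risk 𝓕 P p t c τ fun ω => (s ω : EReal)}) := isEssSup_essSup (𝓕.le t) (by
    rintro _ ⟨s, hs, rfl⟩
    exact hR _ hs.coe_real_ereal)
  have h2 : IsEssSup (𝓕 t) P _
      (essSup (𝓕 t) P {g | ∃ x Y, MemTwoStep 𝓕 P p t x Y ∧ g = c x Y}) :=
    isEssSup_essSup (𝓕.le t) (by
      rintro _ ⟨x, Y, h, rfl⟩
      exact hc x Y h)
  refine EventuallyLE.antisymm (h1.2.2 _ h2.1 ?_) (h2.2.2 _ h1.1 ?_)
  · rintro _ ⟨s, hs, rfl⟩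
    have hs1 : Measurable[𝓕 t] fun ω => s ω + 1 := hs.add_const 1
    have h3 := rightVersion_le (P := P) (s := fun ω => (s ω : EReal)) (A := Set.univ) (𝓕.le t) hG
      (locallyIncreasing_lowerRisk hc hτ) hs1.coe_real_ereal .univ
      (ae_of_all _ fun ω _ => EReal.coe_lt_coe_iff.2 (lt_add_one _))
    have h4 := lowerRisk_le_on (P := P) hc hτ hs1.coe_real_ereal h2.1 .univ fun x Y hxY => by
      filter_upwards [h2.2.1 _ ⟨x, Y, hxY, rfl⟩] with ω hω _ _ using hω
    filter_upwards [h3, h4] with ω h3 h4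
    exact (h3 trivial).trans (h4 trivial)
  · rintro _ ⟨x, Y, h, rfl⟩
    exact (le_risk_tensorPairing hc hτ h).trans
      (h1.2.1 _ ⟨_, measurable_tensorPairing hτ h.1, rfl⟩)

/-- The left version is a supremum over positions with price strictly below `s`, and each strict
inequality survives small perturbations of the measure and of the level. Neighbourhoods with a
single test position therefore suffice. -/
theorem leftVersion_risk_lsc (hc : ∀ x Y, MemTwoStep 𝓕 P p t x Y → Measurable[𝓕 t] (c x Y))
    (ht : t < T) {a : Ω → EReal} (ha : Measurable[𝓕 t] a) (hw : w ∈ MD 𝓕 P T q t) {s : Ω → ℝ}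
    (hs : Measurable[𝓕 t] s)
    (H : ∀ x Y : Ω → ℝ, MemTwoStep 𝓕 P p t x Y →
      ∀ ε : Ω → ℝ, Measurable[𝓕 t] ε → (∀ ω, 0 < ε ω) →
      ∃ w' ∈ MD 𝓕 P T q t, ∃ s' : Ω → ℝ, Measurable[𝓕 t] s' ∧
        (∀ᵐ ω ∂P, |(w'.expect 𝓕 P t x (fun ω => (Y ω : EReal)) ω).toReal -
            (w.expect 𝓕 P t x (fun ω => (Y ω : EReal)) ω).toReal| ≤ ε ω) ∧
        (∀ᵐ ω ∂P, |s' ω - s ω| ≤ ε ω) ∧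
        leftVersion (𝓕 t) P (risk 𝓕 P p t c w'.tensor) (fun ω => (s' ω : EReal)) ≤ᵐ[P] a) :
    leftVersion (𝓕 t) P (risk 𝓕 P p t c w.tensor) (fun ω => (s ω : EReal)) ≤ᵐ[P] a := by
  have hτ := measurable_tensor_fst ht hw
  refine (leftVersion_risk_le hc hτ hs).trans ?_
  have := lowerRisk_le_on (P := P) hc hτ hs.coe_real_ereal ha .univ fun x Y hxY => by
    have hm := measurable_tensorPairing (P := P) hτ hxY.1 (Y := Y)
    -- A third of the gap: after an error of this size in the price and another in the level, a
    -- third of the gap is left.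
    let ε : Ω → ℝ := fun ω => if tensorPairing (𝓕 t) P w.tensor x Y ω < s ω then
      (s ω - tensorPairing (𝓕 t) P w.tensor x Y ω) / 3 else 1
    have hε : Measurable[𝓕 t] ε :=
      Measurable.ite (measurableSet_lt hm hs) ((hs.sub hm).div_const 3) measurable_const
    have hε0 : ∀ ω, 0 < ε ω := fun ω => by
      simp only [ε]
      split_ifs with h
      · linarith
      · exact one_pos
    obtain ⟨w', hw', s', hs', h1, h2, h3⟩ := H x Y hxY ε hε hε0
    filter_upwards [h1, h2, h3, expect_real ht hw hxY, expect_real ht hw' hxY,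
      le_leftVersion_risk hc (measurable_tensor_fst ht hw') hxY hs'] with ω h1 h2 h3 h4 h5 h6 _ hlt
    have hlt := EReal.coe_lt_coe_iff.1 hlt
    rw [h4, h5, EReal.toReal_coe, EReal.toReal_coe] at h1
    simp only [ε, if_pos hlt] at h1 h2
    exact (h6 (by linarith [(abs_le.1 h1).2, (abs_le.1 h2).1])).trans h3
  exact this.mono fun ω hω => hω trivial

theorem isMinimalRiskFunction_risk
    (hc : ∀ x Y, MemTwoStep 𝓕 P p t x Y → Measurable[𝓕 t] (c x Y)) (ht : t < T) :
    IsMinimalRiskFunction 𝓕 P T p q t (risk 𝓕 P p t c) where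
  measurable w hw := preservesMeasurable_risk hc (measurable_tensor_fst ht hw)
  localProp w hw w' hw' s s' hs hs' A hA h := by
    have hτ := measurable_tensor_fst ht hw
    have hτ' := measurable_tensor_fst ht hw'
    filter_upwards [risk_mono_on hc hτ hτ' hs hs' hA (h.mono fun ω h hω => (h hω).1)
      (h.mono fun ω h hω => (h hω).2.le), risk_mono_on hc hτ' hτ hs' hs hA
      (h.mono fun ω h hω => (h hω).1.symm) (h.mono fun ω h hω => (h hω).2.ge)] with ω h1 h2 hω
    exact le_antisymm (h1 hω) (h2 hω)
  increasing w hw s s' hs hs' h := by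
    have hτ := measurable_tensor_fst ht hw
    have := risk_mono_on (P := P) (A := Set.univ) hc hτ hτ hs hs' .univ
      (ae_of_all _ fun _ _ => rfl) (h.mono fun ω h _ => h)
    exact this.mono fun ω h => h trivial
  rightContinuous w hw s hs := by
    have hτ := measurable_tensor_fst ht hw
    exact rightVersion_idem (𝓕.le t) (preservesMeasurable_lowerRisk hc hτ)
      (locallyIncreasing_lowerRisk hc hτ) hs
  quasiconvex w hw w' hw' w'' hw'' s s' hs hs' l hl hl01 hww :=
    risk_quasiconvex hc ht hw hw' hw'' hs hs' hl hl01 hww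
  asymptoticMax w hw w' hw' := (essSup_risk hc (measurable_tensor_fst ht hw)).trans
    (essSup_risk hc (measurable_tensor_fst ht hw')).symm
  lsc a ha w hw s hs H := leftVersion_risk_lsc hc ht ha hw hs fun x Y hxY ε hε hε0 => by
    obtain ⟨w', hw', s', hs', h1, h2, h3⟩ := H 1 (fun _ => x) (fun _ => Y) (fun _ => hxY) ε hε hε0
    exact ⟨w', hw', s', hs', h1 0, h2, h3⟩

/-- The risk function represents `c`, provided that a position which is worse than a constant on
some set is separated, on a part of that set, from the positions which are better. -/
theorem isEssInf_risk (hc : ∀ x Y, MemTwoStep 𝓕 P p t x Y → Measurable[𝓕 t] (c x Y))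
    (ht : t < T) {x Y : Ω → ℝ} (h : MemTwoStep 𝓕 P p t x Y)
    (hsep : ∀ (a : ℝ) (A : Set Ω), MeasurableSet[𝓕 t] A → P A ≠ 0 →
      (∀ᵐ ω ∂P, ω ∈ A → c x Y ω < a) →
      ∃ B ⊆ A, MeasurableSet[𝓕 t] B ∧ P B ≠ 0 ∧ ∃ w ∈ MD 𝓕 P T q t, ∃ δ : Ω → ℝ,
        Measurable[𝓕 t] δ ∧ (∀ ω, 0 < δ ω) ∧ ∀ x' Y', MemTwoStep 𝓕 P p t x' Y' →
          ∀ᵐ ω ∂P, ω ∈ B → tensorPairing (𝓕 t) P w.tensor x' Y' ω <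
            tensorPairing (𝓕 t) P w.tensor x Y ω + δ ω → c x' Y' ω ≤ a) :
    IsEssInf (𝓕 t) P {g | ∃ w ∈ MD 𝓕 P T q t,
      g = risk 𝓕 P p t c w.tensor (w.expect 𝓕 P t x fun ω => (Y ω : EReal))} (c x Y) := by
  have hE : ∀ w ∈ MD 𝓕 P T q t,
      risk 𝓕 P p t c w.tensor (w.expect 𝓕 P t x fun ω => (Y ω : EReal)) =ᵐ[P]
      risk 𝓕 P p t c w.tensor fun ω => (tensorPairing (𝓕 t) P w.tensor x Y ω : EReal) :=
    fun w hw => by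
      have hτ := measurable_tensor_fst ht hw
      have := (isMinimalRiskFunction_risk (q := q) hc ht).localProp w hw w hw _ _
        (measurable_expect (P := P) (x := x) (fun ω => (Y ω : EReal)))
        (measurable_tensorPairing (P := P) hτ h.1 (Y := Y)).coe_real_ereal Set.univ .univ (by
          filter_upwards [expect_real ht hw h] with ω hω _ using ⟨rfl, hω⟩)
      exact this.mono fun ω hω => hω trivial
  refine ⟨hc x Y h, ?_, fun k hk H => ?_⟩
  · rintro _ ⟨w, hw, rfl⟩
    exact (le_risk_tensorPairing hc (measurable_tensor_fst ht hw) h).trans (hE w hw).symm.le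
  by_contra hcon
  have h0 : P {ω | ¬ k ω ≤ c x Y ω} ≠ 0 := fun h0 => hcon (ae_iff.2 h0)
  -- A rational level turns the failure of `k ≤ c x Y` into a set of positive probability on which
  -- `c x Y < a < k`.
  have hcover : {ω | ¬ k ω ≤ c x Y ω} ⊆
      ⋃ a : ℚ, {ω | c x Y ω < ((a : ℝ) : EReal) ∧ ((a : ℝ) : EReal) < k ω} := fun ω hω => by
    obtain ⟨a, h1, h2⟩ := EReal.lt_iff_exists_rat_btwn.1 (not_le.1 hω)
    exact Set.mem_iUnion.2 ⟨a, h1, h2⟩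
  obtain ⟨a, ha⟩ : ∃ a : ℚ,
      P {ω | c x Y ω < ((a : ℝ) : EReal) ∧ ((a : ℝ) : EReal) < k ω} ≠ 0 := by
    by_contra hall
    push Not at hall
    exact h0 (measure_mono_null hcover (measure_iUnion_null hall))
  have hA : MeasurableSet[𝓕 t] {ω | c x Y ω < ((a : ℝ) : EReal) ∧ ((a : ℝ) : EReal) < k ω} :=
    (measurableSet_lt (hc x Y h) measurable_const).inter (measurableSet_lt measurable_const hk)
  obtain ⟨B, hBA, hB, hPB, w, hw, δ, hδ, hδ0, hw1⟩ :=
    hsep a _ hA ha (ae_of_all _ fun ω hω => hω.1)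
  have hτ := measurable_tensor_fst ht hw
  have hm := measurable_tensorPairing (P := P) hτ h.1 (Y := Y)
  have hmδ : Measurable[𝓕 t] fun ω => tensorPairing (𝓕 t) P w.tensor x Y ω + δ ω := hm.add hδ
  -- The right version at the price is at most `lowerRisk` at the price plus `δ`, which the
  -- separation bounds by `a` on `B`. As `k` is below the risk, this contradicts `a < k`.
  have h1 := rightVersion_le (P := P)
    (s := fun ω => (tensorPairing (𝓕 t) P w.tensor x Y ω : EReal)) (A := B) (𝓕.le t)
    (preservesMeasurable_lowerRisk hc hτ) (locallyIncreasing_lowerRisk hc hτ)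
    hmδ.coe_real_ereal hB
    (ae_of_all _ fun ω _ => EReal.coe_lt_coe_iff.2 (lt_add_of_pos_right _ (hδ0 ω)))
  have h2 := lowerRisk_le_on (P := P) hc hτ hmδ.coe_real_ereal
    (measurable_const (a := ((a : ℝ) : EReal))) hB fun x' Y' hxY' => by
      filter_upwards [hw1 x' Y' hxY'] with ω hω hωB hlt
      exact hω hωB (EReal.coe_lt_coe_iff.1 hlt)
  refine hPB (measure_eq_zero_iff_ae_notMem.2 ?_)
  filter_upwards [h1, h2, H _ ⟨w, hw, rfl⟩, hE w hw] with ω h1 h2 h3 h4 hωB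
  have h5 : k ω ≤ ((a : ℝ) : EReal) := by
    rw [h4] at h3
    exact h3.trans ((h1 hωB).trans (h2 hωB))
  exact absurd (hBA hωB).2 (not_lt.2 h5)

end Risk

/-! ### The recursion -/

section Recursion

variable {Ω : Type*} {m0 : MeasurableSpace Ω} {𝓕 : Filtration ℕ m0} {P : Measure Ω}
  {T t : ℕ} {p q : ℝ≥0∞} {α : ℕ → (ℕ → Ω → ℝ) → Ω → EReal} {X V W : ℕ → Ω → ℝ} {w : QD Ω}
  {R : ℕ → (ℕ → Ω → ℝ) → (Ω → ℝ × ℝ) → (Ω → EReal) → Ω → EReal}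

theorem glue_self : glue t X X = X := by
  ext s ω; simp [glue]

theorem glue_glue : glue t (glue t X V) W = glue t X W := by
  ext s ω; by_cases h : s < t <;> simp [glue, h]

theorem twoStep_eq_glue (x Y : Ω → ℝ) :
    twoStep t X x Y = glue t X fun s => if s = t then x else Y := rfl

theorem glue_twoStep (x Y : Ω → ℝ) : glue t (twoStep t X x Y) W = glue t X W := glue_glue

theorem certEquiv_twoStep (x Y : Ω → ℝ) :
    certEquiv 𝓕 P α t (twoStep t X x Y) = essInf (𝓕 t) P
      {g | ∃ m : Ω → ℝ, Measurable[𝓕 t] m ∧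
        α t (twoStep t X x Y) ≤ᵐ[P] α t (glue t X (cash m)) ∧ g = fun ω => (m ω : EReal)} := by
  simp only [certEquiv, glue_twoStep]

/-- Under strong time consistency a position may be replaced, after time `t`, by its certainty
equivalent at time `t + 1`. -/
theorem certEquiv_eq_twoStep (hstc : StronglyTimeConsistent 𝓕 P T p α) (ht : t < T)
    (hX : MemX 𝓕 P T p t X) {y : Ω → ℝ} (hy : MemTwoStep 𝓕 P p t (X t) y)
    (h : α (t + 1) (glue (t + 1) X (cash y)) =ᵐ[P] α (t + 1) X) :
    certEquiv 𝓕 P α t (twoStep t X (X t) y) = certEquiv 𝓕 P α t X := by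
  -- Keeping `X` through time `t` and holding cash `y` from `t + 1` on is this two-step position. It
  -- is as good as `X` at `t + 1`, so strong time consistency, used in both directions, makes the
  -- two equally good at `t`.
  have e : twoStep t X (X t) y = glue (t + 1) X (cash y) := by
    ext s ω
    rcases lt_trichotomy s t with h | h | h
    · simp [twoStep, glue, h, h.trans (Nat.lt_succ_self t)]
    · simp [twoStep, glue, h]
    · simp [twoStep, glue, cash, h.not_gt, h.ne', show ¬ s < t + 1 by omega]
  have hY : MemX 𝓕 P T p t (twoStep t X (X t) y) := by
    rw [e]
    constructor
    · intro s hs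
      by_cases h : s < t + 1
      · simpa [glue, h] using hX.1 s hs
      · simpa [glue, h, cash] using hy.2.1.mono (𝓕.mono (show t + 1 ≤ s by omega)) le_rfl
    · intro s hts hs
      by_cases h : s < t + 1
      · simpa [glue, h] using hX.2 s hts hs
      · simpa [glue, h, cash] using
          ⟨hy.2.1.mono (𝓕.mono (show t + 1 ≤ s by omega)) le_rfl, hy.2.2⟩
  have hs : ∀ s ≤ t, twoStep t X (X t) y s = X s := fun s hs => by
    rw [e]
    ext ω
    simp [glue, show s < t + 1 by omega]
  have h' : α (t + 1) (twoStep t X (X t) y) =ᵐ[P] α (t + 1) X := by rw [e]; exact h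
  have h1 : α t (twoStep t X (X t) y) =ᵐ[P] α t X :=
    (hstc t ht _ _ hX hY (fun s h => by rw [hs s h]) h'.le).antisymm
      (hstc t ht _ _ hY hX (fun s h => by rw [hs s h]) h'.symm.le)
  rw [certEquiv_twoStep, certEquiv]
  congr 1
  ext g
  refine exists_congr fun m => and_congr_right fun _ => and_congr_left fun _ => ?_
  exact ⟨fun h => h1.symm.le.trans h, fun h => h1.le.trans h⟩

variable [IsProbabilityMeasure P]

theorem isEssInf_certEquiv : IsEssInf (𝓕 t) P {g | ∃ m : Ω → ℝ, Measurable[𝓕 t] m ∧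
    α t X ≤ᵐ[P] α t (glue t X (cash m)) ∧ g = fun ω => (m ω : EReal)} (certEquiv 𝓕 P α t X) :=
  isEssInf_essInf (𝓕.le t) (by
    rintro _ ⟨m, hm, -, rfl⟩
    exact hm.coe_real_ereal)

theorem measurable_certEquiv : Measurable[𝓕 t] (certEquiv 𝓕 P α t X) := isEssInf_certEquiv.1

theorem exists_certEquiv_eq (hp : 1 ≤ p) (hα : IsPathDependentIndex 𝓕 P T p t (α t))
    (hC : ∀ X, IsPast 𝓕 t X →
      HasCertaintyAssumptions 𝓕 P T p t (fun V => α t (glue t X V)))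
    (hX : IsPast 𝓕 t X) {r : ℕ} (hr : r ≤ t)
    (hXp : ∀ s, t ≤ s → s ≤ T → Measurable[𝓕 s] (X s) ∧ LocLp (𝓕 r) P p (X s)) :
    ∃ y : Ω → ℝ, Measurable[𝓕 t] y ∧ LocLp (𝓕 r) P p y ∧
      (certEquiv 𝓕 P α t X =ᵐ[P] fun ω => (y ω : EReal)) ∧
      α t (glue t X (cash y)) =ᵐ[P] α t X := by
  obtain ⟨y, h1, h2, h3, h4⟩ := (hα.index X hX).exists_certainty (hC X hX) hp hr hXp
  simp only [glue_self] at h3 h4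
  exact ⟨y, h1, h2, isEssInf_certEquiv.unique h3, h4⟩

/-- The normalization `E[Z | 𝓕ₜ] = 1` and conditional integrability are local properties, so
one-step measures can be pasted along 𝓕ₜ-partitions. -/
theorem MD.concat (hq : 1 ≤ q) {j : Ω → ℕ} (hj : Measurable[𝓕 t] j) {W : ℕ → QD Ω}
    (hW : ∀ n, W n ∈ MD 𝓕 P T q t) :
    (⟨fun ω => (W (j ω)).Z ω, fun ω => (W (j ω)).D ω⟩ : QD Ω) ∈ MD 𝓕 P T q t := by
  by_cases ht : t < T
  · have h := fun n => (mem_MD_iff ht).1 (hW n)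
    have hZ : Measurable[𝓕 (t + 1)] fun ω => (W (j ω)).Z ω :=
      measurable_concat (𝓕.mono (Nat.le_succ t)) hj fun n => (h n).1
    refine (mem_MD_iff ht).2 ⟨hZ, fun ω => (h _).2.1 ω, ?_, ?_,
      measurable_concat le_rfl hj fun n => (h n).2.2.2.2.1, fun ω => (h _).2.2.2.2.2 ω⟩
    · refine Q_eq_iff.2 (ae_of_index j fun n => ?_)
      filter_upwards [Q_eq_iff.1 (h n).2.2.1, condLExp_congr_on (P := P) (𝓕.le t)
        (measurableSet_index hj n) (F := fun ω => ENNReal.ofReal ((W (j ω)).Z ω))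
        (G := fun ω => ENNReal.ofReal ((W n).Z ω))
        (ae_of_all _ fun ω (hω : j ω = n) => by rw [hω])] with ω h1 h2 hn
      rw [← h1]
      exact h2 hn
    · exact (memCondLp_iff (𝓕.le t) (hZ.mono (𝓕.le _) le_rfl) (one_pos.trans_le hq).ne').2
        (LocLp.concat (𝓕.le t) hj fun n => MD.locLp hq ht (hW n))
  -- From the horizon on there is only the trivial pair, and pasting it with itself changes nothing.
  · have h : ∀ n, W n = ⟨fun _ => 1, fun _ => 1⟩ := fun n => by
      have := hW n
      change (if t < T then _ else _) at this
      rwa [if_neg ht] at this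
    change (if t < T then _ else _)
    rw [if_neg ht]
    simp only [h]

/-- As `E[Z | 𝓕ₜ] = 1`, an 𝓕ₜ-measurable amount added to `Y` enters the price with factor `D ≤ 1`.
This controls the cost of replacing `y` by `y + ε` in the recursion. -/
theorem tensorPairing_add_measurable [ENNReal.HolderConjugate p q] (ht : t < T)
    (hw : w ∈ MD 𝓕 P T q t) {x Y ε : Ω → ℝ} (h : MemTwoStep 𝓕 P p t x Y)
    (hε : Measurable[𝓕 t] ε) :
    ∀ᵐ ω ∂P, tensorPairing (𝓕 t) P w.tensor x (fun ω => Y ω + ε ω) ω =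
      tensorPairing (𝓕 t) P w.tensor x Y ω + w.D ω * ε ω := by
  have hY := ((memTwoStep_iff (ENNReal.HolderConjugate.one_le p q)).1 h).2.2
  have hq := ENNReal.HolderConjugate.one_le q p
  have i1 := locLp_tensor_mul p ht hw hY
  have i2 : LocLp (𝓕 t) P 1 w.Z := (MD.locLp hq ht hw).mono_exponent hq
  have hD : Measurable[𝓕 t] fun ω => w.D ω * ε ω := ((mem_MD_iff ht).1 hw).2.2.2.2.1.mul hε
  have e : (fun ω => (w.tensor ω).2 * (Y ω + ε ω)) = fun ω =>
      (w.tensor ω).2 * Y ω + w.D ω * ε ω * w.Z ω := by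
    ext ω
    simp only [QD.tensor]
    ring
  filter_upwards [cE_add (𝓕.le t) i1 (LocLp.measurable_mul (𝓕.le t) hD i2),
    cE_measurable_mul (𝓕.le t) hD i2, cE_Z ht hw] with ω h1 h2 h3
  simp only [tensorPairing]
  rw [e, h1, h2, h3]
  ring

theorem measurable_recF {C : ℕ → (ℕ → Ω → ℝ) → Ω → EReal} (hR : IsOneStepRisk 𝓕 P T p q C R)
    (hX : AdaptedUpTo 𝓕 T X) : ∀ (n t : ℕ), t + n = T → ∀ w ∈ MD 𝓕 P T q t,
      Measurable[𝓕 t] (recF 𝓕 P T q R X n t w)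
  | 0, t, ht, _, _ => (hX t (by omega)).coe_real_ereal
  | n + 1, t, ht, w, hw => (isEssInf_essInf (P := P) (𝓕.le t) (by
      rintro _ ⟨w', hw', rfl⟩
      exact (hR.minimal t (by omega) X fun s hs => hX s (by omega)).measurable w hw _
        (measurable_expect _))).1

theorem isEssInf_recF {C : ℕ → (ℕ → Ω → ℝ) → Ω → EReal} (hR : IsOneStepRisk 𝓕 P T p q C R)
    (hX : AdaptedUpTo 𝓕 T X) {n t : ℕ} (ht : t < T) (hw : w ∈ MD 𝓕 P T q t) :
    IsEssInf (𝓕 t) P {g | ∃ w' ∈ MD 𝓕 P T q (t + 1),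
        g = R t X w.tensor (w.expect 𝓕 P t (X t) (recF 𝓕 P T q R X n (t + 1) w'))}
      (recF 𝓕 P T q R X (n + 1) t w) :=
  isEssInf_essInf (P := P) (𝓕.le t) (by
    rintro _ ⟨w', hw', rfl⟩
    exact (hR.minimal t ht X fun s hs => hX s (by omega)).measurable w hw _
        (measurable_expect _))

/-- The recursion inherits locality in the pair from `R`. This is what allows it to be evaluated at
pasted near-minimizers. -/
theorem recF_le_on {C : ℕ → (ℕ → Ω → ℝ) → Ω → EReal} (hR : IsOneStepRisk 𝓕 P T p q C R)
    (hX : AdaptedUpTo 𝓕 T X) {n t : ℕ} (ht : t + n = T) {w w' : QD Ω} (hw : w ∈ MD 𝓕 P T q t)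
    (hw' : w' ∈ MD 𝓕 P T q t) {A : Set Ω} (hA : MeasurableSet[𝓕 t] A)
    (h : ∀ᵐ ω ∂P, ω ∈ A → w.Z ω = w'.Z ω ∧ w.D ω = w'.D ω) :
    ∀ᵐ ω ∂P, ω ∈ A → recF 𝓕 P T q R X n t w ω ≤ recF 𝓕 P T q R X n t w' ω := by
  cases n with
  | zero => exact ae_of_all _ fun _ _ => le_rfl
  | succ n =>
    have htT : t < T := by omega
    have hXt : Measurable (X t) := (hX t (by omega)).mono (𝓕.le _) le_rfl
    have e1 := isEssInf_recF (n := n) hR hX htT hw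
    refine (isEssInf_recF (n := n) hR hX htT hw').ge_on hA e1.1 ?_
    rintro _ ⟨v, hv, rfl⟩
    have hv' := (measurable_recF hR hX n (t + 1) (by omega) v hv).mono (𝓕.le _) le_rfl
    filter_upwards [e1.2.1 _ ⟨v, hv, rfl⟩,
      (hR.minimal t htT X fun s hs => hX s (by omega)).localProp w hw w' hw' _ _
        (measurable_expect _) (measurable_expect _) A hA (by
          filter_upwards [h, expect_congr_on htT hw hw' hXt hv' hA h] with ω h1 h2 hω
          exact ⟨by simp only [QD.tensor, h1 hω], h2 hω⟩)] with ω h1 h2 hω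
    exact h1.trans (h2 hω).le

variable [ENNReal.HolderConjugate p q]

/-- If the values of the next recursion step have infimum `y`, then the infimum may be taken inside
the one-step risk function. -/
theorem recF_succ_eq {C : ℕ → (ℕ → Ω → ℝ) → Ω → EReal} (hR : IsOneStepRisk 𝓕 P T p q C R)
    (hX : AdaptedUpTo 𝓕 T X) {n t : ℕ} (ht : t + (n + 1) = T) (hw : w ∈ MD 𝓕 P T q t)
    {y : Ω → ℝ} (hy : MemTwoStep 𝓕 P p t (X t) y)
    (hinf : IsEssInf (𝓕 (t + 1)) P {g | ∃ w' ∈ MD 𝓕 P T q (t + 1),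
      g = recF 𝓕 P T q R X n (t + 1) w'} fun ω => (y ω : EReal)) :
    recF 𝓕 P T q R X (n + 1) t w =ᵐ[P]
      R t X w.tensor (w.expect 𝓕 P t (X t) fun ω => (y ω : EReal)) := by
  have hp := ENNReal.HolderConjugate.one_le p q
  have hq := ENNReal.HolderConjugate.one_le q p
  have htT : t < T := by omega
  have hXt : Measurable (X t) := (hX t (by omega)).mono (𝓕.le _) le_rfl
  have hmin := hR.minimal t htT X fun s hs => hX s (by omega)
  have hF := isEssInf_recF (n := n) hR hX htT hw
  have hFm := fun v hv => (measurable_recF hR hX n (t + 1) (by omega) v hv).mono (𝓕.le _) le_rfl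
  have hye : Measurable fun ω => (y ω : EReal) := (hy.2.1.mono (𝓕.le _) le_rfl).coe_real_ereal
  have hsm : Measurable[𝓕 t] (w.expect 𝓕 P t (X t) fun ω => (y ω : EReal)) := measurable_expect _
  refine EventuallyLE.antisymm ?_ (hF.2.2 _ (hmin.measurable w hw _ hsm) ?_)
  -- By right continuity it suffices to compare with `R` at levels `k` above the price, which leaves
  -- room to approximate `y` from above.
  · refine EventuallyLE.trans_eq ?_ (hmin.rightContinuous w hw _ hsm).symm
    have := le_rightVersion (P := P) (A := Set.univ) (𝓕.le t)
      (G := R t X w.tensor) (fun s hs => hmin.measurable w hw s hs) hsm hF.1 .univ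
      fun k hk hsk => by
        obtain ⟨r, hr, hrk⟩ := exists_measurable_between hsm hk
        have hτ := measurable_tensor_fst htT hw
        have hm := measurable_tensorPairing (P := P) hτ hy.1 (Y := y)
        -- Adding the 𝓕ₜ-measurable room below `r` to `y` raises the price to at most `r`; the value
        -- 1 elsewhere only keeps `ε` positive.
        let ε : Ω → ℝ := fun ω => if tensorPairing (𝓕 t) P w.tensor (X t) y ω < r ω then
          r ω - tensorPairing (𝓕 t) P w.tensor (X t) y ω else 1
        have hε : Measurable[𝓕 t] ε :=
          Measurable.ite (measurableSet_lt hm hr) (hr.sub hm) measurable_const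
        have hε0 : ∀ ω, 0 < ε ω := fun ω => by
          simp only [ε]
          split_ifs with h
          · linarith
          · exact one_pos
        have hε' : Measurable[𝓕 (t + 1)] ε := hε.mono (𝓕.mono (Nat.le_succ t)) le_rfl
        have hyε : Measurable[𝓕 (t + 1)] fun ω => y ω + ε ω := hy.2.1.add hε'
        have hSm : ∀ f ∈ {g | ∃ w' ∈ MD 𝓕 P T q (t + 1), g = recF 𝓕 P T q R X n (t + 1) w'},
            Measurable[𝓕 (t + 1)] f := by
          rintro _ ⟨v, hv, rfl⟩
          exact measurable_recF hR hX n (t + 1) (by omega) v hv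
        have hne : {g | ∃ w' ∈ MD 𝓕 P T q (t + 1),
            g = recF 𝓕 P T q R X n (t + 1) w'}.Nonempty := by
          -- An empty family would have infimum `⊤`, whereas `y` is real.
          by_contra hemp
          rw [Set.not_nonempty_iff_eq_empty] at hemp
          have h1 := hinf.2.2 (fun _ => ⊤) measurable_const (by rw [hemp]; simp)
          have h2 : ∀ᵐ _ ∂P, False := h1.mono fun ω hω => absurd hω (by simp)
          have h3 := ae_iff.1 h2
          simp at h3
        -- Countably many near-minimizers are pasted along an 𝓕_{t+1}-partition into one pair whose
        -- value is at most `y + ε`.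
        obtain ⟨f, hfS, hf⟩ := hinf.exists_seq_lt (𝓕.le _) hSm hne hyε.coe_real_ereal
        choose v hv hfv using hfS
        obtain ⟨j, hj, hjB⟩ := exists_measurable_index (m := 𝓕 (t + 1)) (P := P)
          (B := fun i => {ω | recF 𝓕 P T q R X n (t + 1) (v i) ω < ((y ω + ε ω : ℝ) : EReal)})
          (fun i => measurableSet_lt (measurable_recF hR hX n (t + 1) (by omega) _ (hv i))
            hyε.coe_real_ereal) (by
            filter_upwards [hf] with ω hω
            obtain ⟨i, hi⟩ := hω (EReal.coe_lt_coe_iff.2 (lt_add_of_pos_right _ (hε0 ω)))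
            exact ⟨i, by rw [hfv i] at hi; exact hi⟩)
        have hvj := MD.concat hq hj hv
        have hle : recF 𝓕 P T q R X n (t + 1)
            ⟨fun ω => (v (j ω)).Z ω, fun ω => (v (j ω)).D ω⟩ ≤ᵐ[P]
              fun ω => ((y ω + ε ω : ℝ) : EReal) := ae_of_index j fun i => by
          filter_upwards [recF_le_on hR hX (n := n) (t := t + 1) (by omega) hvj (hv i)
            (measurableSet_index hj i) (ae_of_all _ fun ω (hω : j ω = i) => by simp [hω]), hjB]
            with ω h1 h2 hi
          have h2 : recF 𝓕 P T q R X n (t + 1) (v (j ω)) ω < ((y ω + ε ω : ℝ) : EReal) := h2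
          rw [hi] at h2
          exact (h1 hi).trans h2.le
        have hyε2 : MemTwoStep 𝓕 P p t (X t) fun ω => y ω + ε ω :=
          (memTwoStep_iff hp).2 ⟨hy.1, hyε, ((memTwoStep_iff hp).1 hy).2.2.add (𝓕.le t)
            (LocLp.of_measurable (𝓕.le t) hε)⟩
        have h3 := expect_mono htT hw hXt (hFm _ hvj)
          (hyε.mono (𝓕.le _) le_rfl).coe_real_ereal hle
        have h4 : w.expect 𝓕 P t (X t) (recF 𝓕 P T q R X n (t + 1)
            ⟨fun ω => (v (j ω)).Z ω, fun ω => (v (j ω)).D ω⟩) ≤ᵐ[P] k := by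
          filter_upwards [h3, expect_real htT hw hyε2, expect_real htT hw hy, hsk,
            tensorPairing_add_measurable htT hw hy hε] with ω h3 h4 h5 h6 h7
          have h8 := hrk ω (h6 (by rw [h5]; exact EReal.coe_lt_top _))
          rw [h5, EReal.coe_lt_coe_iff] at h8
          refine h3.trans (le_trans ?_ h8.2.le)
          rw [h4, h7, EReal.coe_le_coe_iff]
          have hD := ((mem_MD_iff htT).1 hw).2.2.2.2.2 ω
          have h9 : w.D ω * ε ω ≤ ε ω := mul_le_of_le_one_left (hε0 ω).le hD.2
          have h10 : ε ω = r ω - tensorPairing (𝓕 t) P w.tensor (X t) y ω := if_pos h8.1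
          linarith
        filter_upwards [hF.2.1 _ ⟨_, hvj, rfl⟩,
          hmin.increasing w hw _ _ (measurable_expect _) hk h4] with ω h1 h2 _ _
        exact h1.trans h2
    exact this.mono fun ω hω => hω trivial
  · rintro _ ⟨v, hv, rfl⟩
    exact hmin.increasing w hw _ _ hsm (measurable_expect _)
      (expect_mono htT hw hXt hye (hFm v hv) (hinf.2.1 _ ⟨v, hv, rfl⟩))

/-- Backward induction: time consistency reduces `X` to the two-step position with the next
certainty equivalent `y`, `R` represents its value, and `recF_succ_eq` identifies the represented
family with the recursion. -/
theorem isEssInf_recF_certEquiv (hα : ∀ t ≤ T, IsPathDependentIndex 𝓕 P T p t (α t))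
    (hC : ∀ t ≤ T, ∀ X, IsPast 𝓕 t X →
      HasCertaintyAssumptions 𝓕 P T p t (fun V => α t (glue t X V)))
    (hstc : StronglyTimeConsistent 𝓕 P T p α)
    (hR : IsOneStepRisk 𝓕 P T p q (certEquiv 𝓕 P α) R) :
    ∀ (n t : ℕ), t + n = T → MemX 𝓕 P T p t X →
      IsEssInf (𝓕 t) P {g | ∃ w ∈ MD 𝓕 P T q t, g = recF 𝓕 P T q R X n t w}
        (certEquiv 𝓕 P α t X) := by
  have hp := ENNReal.HolderConjugate.one_le p q
  intro n
  induction n with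
  | zero =>
    intro t ht hX
    have hXt : Measurable[𝓕 t] (X t) := hX.1 t (by omega)
    have hpast : IsPast 𝓕 t X := fun s hs => hX.1 s (by omega)
    have hidx := (hα t (by omega)).index X hpast
    obtain ⟨y, hy, -, hCy, hφy⟩ := exists_certEquiv_eq hp (hα t (by omega)) (hC t (by omega)) hpast
      le_rfl ((memFuture_iff hp).1 hX.2)
    -- Here `t = T`, so `X` and cash `X_T` agree from `t` on; the strict order of cash amounts then
    -- forces `C_T(X) = X_T`.
    have h1 : α t (glue t X (cash (X t))) =ᵐ[P] α t X := by
      have := hidx.localProp _ X (memFuture_cash hp hXt) hX.2 Set.univ .univ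
        fun s hs hsT => ae_of_all _ fun ω _ => by
          rw [show s = t by omega]
          rfl
      filter_upwards [this] with ω hω
      rw [hω trivial, glue_self]
    have h2 : certEquiv 𝓕 P α t X =ᵐ[P] fun ω => (X t ω : EReal) := by
      filter_upwards [hCy, hφy, h1, hidx.cash_lt_iff (hC t (by omega) X hpast) hp hy hXt,
        hidx.cash_lt_iff (hC t (by omega) X hpast) hp hXt hy] with ω h1 h2 h3 h4 h5
      rw [h2, h3] at h4 h5
      rw [h1, le_antisymm (not_lt.1 fun h => (lt_irrefl _ (h5.2 h)).elim)
        (not_lt.1 fun h => (lt_irrefl _ (h4.2 h)).elim)]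
    refine ⟨measurable_certEquiv, ?_, fun h _ hh => ?_⟩
    · rintro _ ⟨w, -, rfl⟩
      exact h2.le
    · refine (hh _ ⟨⟨fun _ => 1, fun _ => 1⟩, ?_, rfl⟩).trans h2.symm.le
      change (if t < T then _ else _)
      rw [if_neg (by omega)]
  | succ n ih =>
    intro t ht hX
    have htT : t < T := by omega
    have hpast : IsPast 𝓕 t X := fun s hs => hX.1 s (by omega)
    have hXF := (memFuture_iff hp).1 hX.2
    have hX' : MemX 𝓕 P T p (t + 1) X := ⟨hX.1, (memFuture_iff hp).2 fun s hs hsT =>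
      ⟨hX.1 s hsT, (hXF s (by omega) hsT).2.mono_sigma (𝓕.mono (Nat.le_succ t))⟩⟩
    obtain ⟨y, hy, hyp, hCy, hαy⟩ := exists_certEquiv_eq hp (hα (t + 1) (by omega))
      (hC (t + 1) (by omega)) (fun s hs => hX.1 s (by omega)) (Nat.le_succ t)
      fun s hs hsT => hXF s (by omega) hsT
    have hy2 : MemTwoStep 𝓕 P p t (X t) y :=
      (memTwoStep_iff hp).2 ⟨hX.1 t (by omega), hy, hyp⟩
    have hinf := (ih (t + 1) (by omega) hX').congr hy.coe_real_ereal hCy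
      (fun f hf => ⟨f, hf, EventuallyLE.rfl⟩) fun f hf => ⟨f, hf, EventuallyLE.rfl⟩
    have hrep := hR.represents t htT X hpast (X t) y hy2
    rw [certEquiv_eq_twoStep hstc htT hX hy2 hαy] at hrep
    have heq := fun w hw => recF_succ_eq hR hX.1 (n := n) ht (w := w) hw hy2 hinf
    refine hrep.congr measurable_certEquiv EventuallyEq.rfl ?_ ?_
    · rintro _ ⟨w, hw, rfl⟩
      exact ⟨_, ⟨w, hw, rfl⟩, (heq w hw).symm.le⟩
    · rintro _ ⟨w, hw, rfl⟩
      exact ⟨_, ⟨w, hw, rfl⟩, (heq w hw).le⟩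

end Recursion

/-! ### Positive functionals on `Lᵖ` -/

section LpDual

variable {S : Type*} {mS : MeasurableSpace S} {μ : Measure S} [IsFiniteMeasure μ] {p q : ℝ≥0∞}

theorem memLp_indicator_one {A : Set S} (hA : MeasurableSet A) :
    MemLp (A.indicator fun _ => (1 : ℝ)) p μ := (memLp_const 1).indicator hA

theorem memLp_simpleFunc_nnreal (g : SimpleFunc S NNReal) :
    MemLp (fun ω => (g ω : ℝ)) p μ :=
  (g.map ((↑) : NNReal → ℝ)).memLp_of_isFiniteMeasure p μ

variable [Fact (1 ≤ p)]

/-- The measure `A ↦ ℓ(1_A)` of a positive functional on `Lᵖ`, `p < ∞`. -/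
theorem exists_measure_of_nonneg (hp : p ≠ ∞) (ℓ : Lp ℝ p μ →L[ℝ] ℝ)
    (hpos : ∀ f : Lp ℝ p μ, 0 ≤ᵐ[μ] f → 0 ≤ ℓ f) :
    ∃ ν : Measure S, ν ≪ μ ∧ ∀ (A : Set S) (hA : MeasurableSet A),
      ν A = ENNReal.ofReal (ℓ ((memLp_indicator_one hA).toLp _)) := by
  have hpos' : ∀ (A : Set S) (hA : MeasurableSet A),
      0 ≤ ℓ ((memLp_indicator_one (μ := μ) (p := p) hA).toLp _) := fun A hA => hpos _ (by
    filter_upwards [MemLp.coeFn_toLp (memLp_indicator_one (μ := μ) (p := p) hA)] with ω hω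
    rw [hω]
    exact Set.indicator_nonneg (fun _ _ => zero_le_one) _)
  let ν : Measure S := Measure.ofMeasurable
    (fun A hA => ENNReal.ofReal (ℓ ((memLp_indicator_one (μ := μ) (p := p) hA).toLp _)))
    (by
      have : (memLp_indicator_one (μ := μ) (p := p) MeasurableSet.empty).toLp _ = 0 := by
        exact indicatorConstLp_empty
      rw [this, map_zero, ENNReal.ofReal_zero])
    (fun A hA hd => by
      have hpart : ∀ n, ∑ i ∈ Finset.range n,
          ℓ ((memLp_indicator_one (μ := μ) (p := p) (hA i)).toLp _) =
          ℓ ((memLp_indicator_one (μ := μ) (p := p)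
            (MeasurableSet.biUnion (Finset.range n).countable_toSet fun i _ => hA i)).toLp _) := by
        intro n
        rw [← map_sum]
        congr 1
        refine Lp.ext ?_
        have h1 := Lp.coeFn_fun_finsetSum (Finset.range n)
          fun i => (memLp_indicator_one (μ := μ) (p := p) (hA i)).toLp _
        filter_upwards [h1, MemLp.coeFn_toLp (memLp_indicator_one (μ := μ) (p := p)
            (MeasurableSet.biUnion (Finset.range n).countable_toSet fun i _ => hA i)),
          ae_all_iff.2 fun i => MemLp.coeFn_toLp (memLp_indicator_one (μ := μ) (p := p) (hA i))]
          with ω h1 h2 h3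
        rw [h1, h2]
        simp only [h3]
        have := Finset.indicator_biUnion_apply (Finset.range n) A (f := fun _ : S => (1 : ℝ))
          (fun i _ j _ hij => hd hij) ω
        exact this.symm
      -- This is where `p < ∞` enters: the indicators of the partial unions converge in `Lᵖ`, and
      -- continuity of `ℓ` gives countable additivity.
      have hsum : HasSum (fun i => ℓ ((memLp_indicator_one (μ := μ) (p := p) (hA i)).toLp _))
          (ℓ ((memLp_indicator_one (μ := μ) (p := p) (MeasurableSet.iUnion hA)).toLp _)) := by
        rw [hasSum_iff_tendsto_nat_of_nonneg fun i => hpos' _ (hA i)]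
        simp only [hpart]
        refine (ℓ.continuous.tendsto _).comp ?_
        refine tendsto_indicatorConstLp_set (c := (1 : ℝ)) (hs := MeasurableSet.iUnion hA)
          (hμs := measure_ne_top _ _)
          (ht := fun n => MeasurableSet.biUnion (Finset.range n).countable_toSet fun i _ => hA i)
          (hμt := fun n => measure_ne_top _ _) hp ?_
        have hsub : ∀ n, (⋃ i ∈ Finset.range n, A i) ⊆ ⋃ i, A i := fun n =>
          Set.iUnion₂_subset fun i _ => Set.subset_iUnion A i
        have h1 : ∀ n, μ (symmDiff (⋃ i ∈ Finset.range n, A i) (⋃ i, A i)) =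
            μ ((⋃ i, A i) \ ⋃ i ∈ Finset.range n, A i) := fun n => by
          rw [symmDiff_of_le (hsub n)]
        have h2 : Tendsto (fun n => μ ((⋃ i, A i) \ ⋃ i ∈ Finset.range n, A i)) atTop
            (nhds (μ (⋂ n, (⋃ i, A i) \ ⋃ i ∈ Finset.range n, A i))) := by
          refine tendsto_measure_iInter_atTop (fun n => ((MeasurableSet.iUnion hA).diff
            (MeasurableSet.biUnion (Finset.range n).countable_toSet fun i _ =>
              hA i)).nullMeasurableSet) (fun n m hnm => ?_) ⟨0, measure_ne_top _ _⟩
          refine Set.sdiff_subset_sdiff_right (Set.biUnion_subset_biUnion_left ?_)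
          exact fun i hi => Finset.mem_coe.2 (Finset.range_mono hnm (Finset.mem_coe.1 hi))
        have h3 : (⋂ n, (⋃ i, A i) \ ⋃ i ∈ Finset.range n, A i) = ∅ := by
          refine Set.eq_empty_of_forall_notMem fun ω hω => ?_
          rw [Set.mem_iInter] at hω
          obtain ⟨i, hi⟩ := Set.mem_iUnion.1 (hω 0).1
          exact (hω (i + 1)).2 (Set.mem_biUnion (Finset.mem_range.2 (Nat.lt_succ_self i)) hi)
        rw [h3, measure_empty] at h2
        exact h2.congr fun n => (h1 n).symm
      rw [← hsum.tsum_eq, ENNReal.ofReal_tsum_of_nonneg (fun i => hpos' _ (hA i)) hsum.summable])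
  have hν : ∀ (A : Set S) (hA : MeasurableSet A),
      ν A = ENNReal.ofReal (ℓ ((memLp_indicator_one hA).toLp _)) := fun A hA =>
    Measure.ofMeasurable_apply A hA
  refine ⟨ν, Measure.AbsolutelyContinuous.mk fun A hA h0 => ?_, hν⟩
  have : (memLp_indicator_one (μ := μ) (p := p) hA).toLp _ = 0 := by
    refine Lp.ext ?_
    filter_upwards [MemLp.coeFn_toLp (memLp_indicator_one (μ := μ) (p := p) hA),
      Lp.coeFn_zero ℝ p μ, indicator_meas_zero (f := fun _ => (1 : ℝ)) h0] with ω h1 h2 h3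
    rw [h1, h2, h3]
  rw [hν A hA, this, map_zero, ENNReal.ofReal_zero]

theorem lintegral_simpleFunc_eq (ℓ : Lp ℝ p μ →L[ℝ] ℝ)
    (hpos : ∀ f : Lp ℝ p μ, 0 ≤ᵐ[μ] f → 0 ≤ ℓ f) {ν : Measure S}
    (hν : ∀ (A : Set S) (hA : MeasurableSet A),
      ν A = ENNReal.ofReal (ℓ ((memLp_indicator_one hA).toLp _))) (g : SimpleFunc S NNReal) :
    ∫⁻ ω, (g ω : ℝ≥0∞) ∂ν = ENNReal.ofReal (ℓ ((memLp_simpleFunc_nnreal g).toLp _)) := by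
  have hpos' : ∀ g : SimpleFunc S NNReal,
      0 ≤ ℓ ((memLp_simpleFunc_nnreal (μ := μ) (p := p) g).toLp _) := fun g => hpos _ (by
    filter_upwards [MemLp.coeFn_toLp (memLp_simpleFunc_nnreal (μ := μ) (p := p) g)] with ω hω
    rw [hω]
    exact NNReal.coe_nonneg _)
  induction g using SimpleFunc.induction with
  | const c hs =>
    rename_i A
    have e1 : (memLp_simpleFunc_nnreal (μ := μ) (p := p) (SimpleFunc.piecewise A hs
        (SimpleFunc.const S c) (SimpleFunc.const S 0))).toLp _ =
        (c : ℝ) • (memLp_indicator_one (μ := μ) (p := p) hs).toLp _ := by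
      rw [← MemLp.toLp_const_smul, MemLp.toLp_eq_toLp_iff]
      refine ae_of_all _ fun ω => ?_
      by_cases h : ω ∈ A <;> simp [h]
    have e2 : ∀ ω, ((SimpleFunc.piecewise A hs (SimpleFunc.const S c) (SimpleFunc.const S 0) ω :
        NNReal) : ℝ≥0∞) = A.indicator (fun _ => (c : ℝ≥0∞)) ω := fun ω => by
      by_cases h : ω ∈ A <;> simp [h]
    rw [e1, map_smul, smul_eq_mul, ENNReal.ofReal_mul (NNReal.coe_nonneg c), ← hν A hs]
    simp only [e2]
    rw [lintegral_indicator_const hs]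
    simp
  | add hd hf hg =>
    rename_i f g
    have e : (memLp_simpleFunc_nnreal (μ := μ) (p := p) (f + g)).toLp _ =
        (memLp_simpleFunc_nnreal (μ := μ) (p := p) f).toLp _ +
          (memLp_simpleFunc_nnreal (μ := μ) (p := p) g).toLp _ := by
      rw [← MemLp.toLp_add, MemLp.toLp_eq_toLp_iff]
      exact ae_of_all _ fun ω => by simp
    rw [e, map_add, ENNReal.ofReal_add (hpos' f) (hpos' g), ← hf, ← hg,
      ← lintegral_add_left f.measurable.coe_nnreal_ennreal]
    simp

/-- Simple functions from below reduce this to the operator norm of `ℓ`. It is the input for showing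
that the density of `ν` lies in `L^q`. -/
theorem lintegral_le_eLpNorm (ℓ : Lp ℝ p μ →L[ℝ] ℝ)
    (hpos : ∀ f : Lp ℝ p μ, 0 ≤ᵐ[μ] f → 0 ≤ ℓ f) {ν : Measure S}
    (hν : ∀ (A : Set S) (hA : MeasurableSet A),
      ν A = ENNReal.ofReal (ℓ ((memLp_indicator_one hA).toLp _))) (f : S → ℝ≥0∞) :
    ∫⁻ ω, f ω ∂ν ≤ ENNReal.ofReal ‖ℓ‖ * eLpNorm f p μ := by
  rw [lintegral_eq_nnreal]
  refine iSup₂_le fun g hg => ?_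
  rw [← SimpleFunc.lintegral_eq_lintegral]
  have := lintegral_simpleFunc_eq ℓ hpos hν g
  simp only [SimpleFunc.map_apply]
  rw [this]
  have hg' := memLp_simpleFunc_nnreal (μ := μ) (p := p) g
  calc ENNReal.ofReal (ℓ (hg'.toLp _)) ≤ ENNReal.ofReal (‖ℓ‖ * ‖hg'.toLp _‖) :=
        ENNReal.ofReal_le_ofReal ((le_abs_self _).trans (ℓ.le_opNorm _))
    _ = ENNReal.ofReal ‖ℓ‖ * eLpNorm (fun ω => (g ω : ℝ)) p μ := by
        rw [ENNReal.ofReal_mul (norm_nonneg _), Lp.norm_toLp,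
          ENNReal.ofReal_toReal hg'.eLpNorm_ne_top]
    _ ≤ ENNReal.ofReal ‖ℓ‖ * eLpNorm f p μ := by
        gcongr
        refine eLpNorm_mono_enorm fun ω => ?_
        simpa using hg ω

/-- Converse of Hölder's inequality. For `q < ∞` the test function is `min(ζ, n)^(q-1)`, whose
`p`-th power is `min(ζ, n)^q`; for `q = ∞` it is the indicator of `{ζ > C}`. -/
theorem memLp_of_lintegral_mul_le [ENNReal.HolderConjugate p q] (hp : p ≠ ∞) {ζ : S → ℝ≥0∞}
    (hζ : Measurable ζ) {C : ℝ≥0∞} (hC : C ≠ ∞)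
    (h : ∀ f : S → ℝ≥0∞, Measurable f → ∫⁻ ω, ζ ω * f ω ∂μ ≤ C * eLpNorm f p μ) :
    eLpNorm ζ q μ < ∞ := by
  have h1p : 1 ≤ p := Fact.out
  have hp0 : p ≠ 0 := (one_pos.trans_le h1p).ne'
  rcases eq_or_ne q ∞ with rfl | hq
  · have hp1 : p = 1 := (ENNReal.HolderConjugate.eq_top_iff_eq_one ∞ p).1 rfl
    subst hp1
    rw [eLpNorm_exponent_top]
    refine (eLpNormEssSup_le_of_ae_enorm_bound (C := C) ?_).trans_lt hC.lt_top
    by_contra hcon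
    have hA : MeasurableSet {ω | C < ζ ω} := measurableSet_lt measurable_const hζ
    have h0 : μ {ω | C < ζ ω} ≠ 0 := fun h0 => hcon (by
      rw [ae_iff]
      simpa using h0)
    have h1 := h ({ω | C < ζ ω}.indicator fun _ => 1) (measurable_const.indicator hA)
    rw [eLpNorm_one_eq_lintegral_enorm] at h1
    have e1 : ∫⁻ ω, ζ ω * {ω | C < ζ ω}.indicator (fun _ => 1) ω ∂μ =
        ∫⁻ ω in {ω | C < ζ ω}, ζ ω ∂μ := by
      rw [← lintegral_indicator hA]
      refine lintegral_congr fun ω => ?_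
      by_cases hω : C < ζ ω
      · rw [Set.indicator_of_mem (by exact hω), Set.indicator_of_mem (by exact hω), mul_one]
      · rw [Set.indicator_of_notMem (by exact hω), Set.indicator_of_notMem (by exact hω), mul_zero]
    have e2 : ∫⁻ ω, ‖{ω | C < ζ ω}.indicator (fun _ => (1 : ℝ≥0∞)) ω‖ₑ ∂μ = μ {ω | C < ζ ω} := by
      simp only [enorm_eq_self]
      rw [lintegral_indicator hA, setLIntegral_one]
    rw [e1, e2] at h1
    have h2 : ∫⁻ _ in {ω | C < ζ ω}, C ∂μ < ∫⁻ ω in {ω | C < ζ ω}, ζ ω ∂μ :=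
      setLIntegral_strict_mono hA h0 hζ (by simp [hC, ENNReal.mul_eq_top])
        (ae_of_all _ fun ω hω => hω)
    rw [setLIntegral_const] at h2
    exact absurd h1 (not_le.2 h2)
  · have h1q : 1 ≤ q := ENNReal.HolderConjugate.one_le q p
    have hq0 : q ≠ 0 := (one_pos.trans_le h1q).ne'
    have hpq : p.toReal.HolderConjugate q.toReal := ENNReal.HolderConjugate.toReal_of_ne_top hp hq
    rw [eLpNorm_lt_top_iff_lintegral_rpow_enorm_lt_top hq0 hq]
    -- Truncation makes the integral finite, so that a power of it can be cancelled; monotone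
    -- convergence later removes `n`.
    have key : ∀ n : ℕ, ∫⁻ ω, (min (ζ ω) n) ^ q.toReal ∂μ ≤ C ^ q.toReal := fun n => by
      set I := ∫⁻ ω, (min (ζ ω) n) ^ q.toReal ∂μ with hI
      have hzm : Measurable fun ω => min (ζ ω) (n : ℝ≥0∞) := hζ.min measurable_const
      have hIfin : I ≠ ∞ := by
        refine ne_top_of_le_ne_top ?_ (lintegral_mono fun ω =>
          ENNReal.rpow_le_rpow (min_le_right (ζ ω) (n : ℝ≥0∞)) hpq.symm.nonneg)
        rw [lintegral_const]
        exact ENNReal.mul_ne_top (ENNReal.rpow_ne_top_of_nonneg hpq.symm.nonneg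
          (ENNReal.natCast_ne_top n)) (measure_ne_top _ _)
      have h1 := h (fun ω => min (ζ ω) n ^ (q.toReal - 1)) (hzm.pow_const _)
      have h2 : I ≤ ∫⁻ ω, ζ ω * min (ζ ω) n ^ (q.toReal - 1) ∂μ := lintegral_mono fun ω => by
        calc min (ζ ω) (n : ℝ≥0∞) ^ q.toReal = min (ζ ω) n ^ (1 + (q.toReal - 1)) := by
              rw [add_sub_cancel]
          _ = min (ζ ω) n * min (ζ ω) n ^ (q.toReal - 1) := by
              rw [ENNReal.rpow_add_of_nonneg _ _ zero_le_one (sub_nonneg.2 hpq.symm.lt.le),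
                ENNReal.rpow_one]
          _ ≤ ζ ω * min (ζ ω) n ^ (q.toReal - 1) := by
              gcongr
              exact min_le_left _ _
      have h3 : eLpNorm (fun ω => min (ζ ω) (n : ℝ≥0∞) ^ (q.toReal - 1)) p μ =
          I ^ (1 / p.toReal) := by
        rw [eLpNorm_eq_lintegral_rpow_enorm_toReal hp0 hp]
        congr 1
        refine lintegral_congr fun ω => ?_
        rw [enorm_eq_self, ← ENNReal.rpow_mul, hpq.symm.sub_one_mul_conj]
      rw [h3] at h1
      rcases eq_or_ne I 0 with h0 | h0
      · rw [h0]
        exact zero_le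
      have h4 : I ^ (1 / q.toReal) * I ^ (1 / p.toReal) ≤ C * I ^ (1 / p.toReal) := by
        rw [← ENNReal.rpow_add _ _ h0 hIfin, one_div, one_div, hpq.symm.inv_add_inv_eq_one,
          ENNReal.rpow_one, ← one_div]
        exact h2.trans h1
      have h5 : I ^ (1 / q.toReal) ≤ C := (ENNReal.mul_le_mul_iff_left
        (ENNReal.rpow_pos (pos_iff_ne_zero.2 h0) hIfin).ne'
        (ENNReal.rpow_ne_top_of_nonneg (one_div_nonneg.2 hpq.nonneg) hIfin)).1 h4
      rw [one_div] at h5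
      exact (ENNReal.rpow_inv_le_iff hpq.symm.pos).1 h5
    have hmono : Monotone fun (n : ℕ) ω => (min (ζ ω) n) ^ q.toReal := fun a b hab ω =>
      ENNReal.rpow_le_rpow (min_le_min_left _ (by exact_mod_cast hab)) ENNReal.toReal_nonneg
    have hsup : ∀ ω, ⨆ n : ℕ, (min (ζ ω) n) ^ q.toReal = ζ ω ^ q.toReal := fun ω => by
      have h1 : ⨆ n : ℕ, min (ζ ω) (n : ℝ≥0∞) = ζ ω := by
        rw [← inf_iSup_eq, ENNReal.iSup_natCast, inf_top_eq]
      conv_rhs => rw [← h1]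
      exact ((ENNReal.orderIsoRpow q.toReal hpq.symm.pos).map_iSup _).symm
    simp only [enorm_eq_self, ← hsup]
    rw [lintegral_iSup (fun n => (hζ.min measurable_const).pow_const _) hmono]
    exact (iSup_le key).trans_lt (ENNReal.rpow_lt_top_of_nonneg ENNReal.toReal_nonneg hC)

/-- A positive functional on `Lᵖ`, `p < ∞`, is given by a density in `L^q`. -/
theorem exists_density_of_nonneg [ENNReal.HolderConjugate p q] (hp : p ≠ ∞)
    (ℓ : Lp ℝ p μ →L[ℝ] ℝ) (hpos : ∀ f : Lp ℝ p μ, 0 ≤ᵐ[μ] f → 0 ≤ ℓ f) :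
    ∃ ζ : S → ℝ, Measurable ζ ∧ (∀ ω, 0 ≤ ζ ω) ∧ MemLp ζ q μ ∧
      ∀ (f : S → ℝ) (hf : MemLp f p μ), ℓ (hf.toLp f) = ∫ ω, ζ ω * f ω ∂μ := by
  obtain ⟨ν, hνμ, hν⟩ := exists_measure_of_nonneg hp ℓ hpos
  have : IsFiniteMeasure ν := ⟨by rw [hν _ .univ]; exact ENNReal.ofReal_lt_top⟩
  have hwd : μ.withDensity (ν.rnDeriv μ) = ν := Measure.withDensity_rnDeriv_eq ν μ hνμ
  have hZm : Measurable (ν.rnDeriv μ) := Measure.measurable_rnDeriv ν μ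
  have hfin := Measure.rnDeriv_lt_top ν μ
  have hq := memLp_of_lintegral_mul_le (q := q) hp hZm (C := ENNReal.ofReal ‖ℓ‖)
    ENNReal.ofReal_ne_top fun f hf => by
      have := lintegral_le_eLpNorm ℓ hpos hν f
      rwa [← hwd, lintegral_withDensity_eq_lintegral_mul _ hZm hf] at this
  have hZq : MemLp (fun ω => (ν.rnDeriv μ ω).toReal) q μ := by
    refine ⟨hZm.ennreal_toReal.aestronglyMeasurable, ?_⟩
    refine (eLpNorm_mono_enorm_ae ?_).trans_lt hq
    filter_upwards [hfin] with ω hω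
    rw [Real.enorm_eq_ofReal ENNReal.toReal_nonneg, ENNReal.ofReal_toReal hω.ne, enorm_eq_self]
  refine ⟨fun ω => (ν.rnDeriv μ ω).toReal, hZm.ennreal_toReal, fun _ => ENNReal.toReal_nonneg,
    hZq, ?_⟩
  have hq1 : Fact (1 ≤ q) := ⟨ENNReal.HolderConjugate.one_le q p⟩
  have hint : ∀ {f : S → ℝ}, MemLp f p μ →
      Integrable (fun ω => (ν.rnDeriv μ ω).toReal * f ω) μ := fun hf =>
    memLp_one_iff_integrable.1 (hf.mul' hZq)
  let Λ : Lp ℝ p μ →L[ℝ] ℝ :=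
    (ContinuousLinearMap.mul ℝ ℝ).lpPairing μ q p (hZq.toLp _)
  have hΛ : ∀ (f : S → ℝ) (hf : MemLp f p μ),
      Λ (hf.toLp f) = ∫ ω, (ν.rnDeriv μ ω).toReal * f ω ∂μ := fun f hf => by
    rw [ContinuousLinearMap.lpPairing_eq_integral]
    refine integral_congr_ae ?_
    filter_upwards [hZq.coeFn_toLp, hf.coeFn_toLp] with ω h1 h2
    rw [h1, h2]
    rfl
  -- Both functionals give the `ν`-measure on indicators, and simple functions are dense since `p <
  -- ∞`.
  have hall : ∀ f : Lp ℝ p μ, ℓ f = Λ f := by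
    refine Lp.induction hp _ (fun c A hA _ => ?_) (fun f g hf hg _ h1 h2 => ?_)
      (isClosed_eq ℓ.continuous Λ.continuous)
    · have e : ((Lp.simpleFunc.indicatorConst p hA (measure_ne_top μ A) c : Lp.simpleFunc ℝ p μ) :
          Lp ℝ p μ) = c • (memLp_indicator_one (μ := μ) (p := p) hA).toLp _ := by
        rw [Lp.simpleFunc.coe_indicatorConst, ← MemLp.toLp_const_smul, indicatorConstLp,
          MemLp.toLp_eq_toLp_iff]
        refine ae_of_all _ fun ω => ?_
        by_cases h : ω ∈ A <;> simp [h]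
      rw [e, map_smul, map_smul, hΛ]
      congr 1
      have h1 : ∫ ω, (ν.rnDeriv μ ω).toReal * A.indicator (fun _ => (1 : ℝ)) ω ∂μ =
          ∫ ω in A, (ν.rnDeriv μ ω).toReal ∂μ := by
        rw [← integral_indicator hA]
        congr 1
        ext ω
        by_cases h : ω ∈ A <;> simp [h]
      rw [h1, Measure.setIntegral_toReal_rnDeriv hνμ, measureReal_def, hν A hA,
        ENNReal.toReal_ofReal]
      refine hpos _ ?_
      filter_upwards [MemLp.coeFn_toLp (memLp_indicator_one (μ := μ) (p := p) hA)] with ω hω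
      rw [hω]
      exact Set.indicator_nonneg (fun _ _ => zero_le_one) _
    · rw [map_add, map_add, h1, h2]
  intro f hf
  rw [hall, hΛ]

/-- Strict separation of a point from an upward closed convex set of pairs in `Lᵖ × Lᵖ`,
`p < ∞`, by a pair of nonnegative densities. -/
theorem exists_separating_densities [ENNReal.HolderConjugate p q] (hp : p ≠ ∞)
    {S' : Type*} {mS' : MeasurableSpace S'} {μ' : Measure S'} [IsFiniteMeasure μ']
    {K : Set ((S → ℝ) × (S' → ℝ))} (hK : ∀ U ∈ K, MemLp U.1 p μ ∧ MemLp U.2 p μ')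
    (hconv : Convex ℝ K) (hne : K.Nonempty)
    (hup : ∀ U ∈ K, ∀ (f : S → ℝ) (g : S' → ℝ), Measurable f → MemLp f p μ → (∀ ω, 0 ≤ f ω) →
      Measurable g → MemLp g p μ' → (∀ ω, 0 ≤ g ω) → (U.1 + f, U.2 + g) ∈ K)
    {x : S → ℝ} {y : S' → ℝ} (hx : MemLp x p μ) (hy : MemLp y p μ') {η : ℝ≥0∞} (hη : η ≠ 0)
    (hfar : ∀ U ∈ K, η ≤ eLpNorm (U.1 - x) p μ + eLpNorm (U.2 - y) p μ') :
    ∃ (ζ : S → ℝ) (ζ' : S' → ℝ), Measurable ζ ∧ Measurable ζ' ∧ (∀ ω, 0 ≤ ζ ω) ∧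
      (∀ ω, 0 ≤ ζ' ω) ∧ MemLp ζ q μ ∧ MemLp ζ' q μ' ∧ ∃ δ : ℝ, 0 < δ ∧ ∀ U ∈ K,
        ∫ ω, ζ ω * x ω ∂μ + ∫ ω, ζ' ω * y ω ∂μ' + δ ≤
          ∫ ω, ζ ω * U.1 ω ∂μ + ∫ ω, ζ' ω * U.2 ω ∂μ' := by
  -- Two different measure spaces are needed because the two entries of a two-step position are
  -- measurable for different σ-algebras.
  let E := Lp ℝ p μ × Lp ℝ p μ'
  let C : Set E := {e | ∃ U ∈ K, U.1 =ᵐ[μ] e.1 ∧ U.2 =ᵐ[μ'] e.2}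
  have hCconv : Convex ℝ C := by
    rintro e ⟨U, hU, h1, h2⟩ e' ⟨U', hU', h1', h2'⟩ a b ha hb hab
    refine ⟨a • U + b • U', hconv hU hU' ha hb hab, ?_, ?_⟩
    · filter_upwards [h1, h1', Lp.coeFn_add (a • e.1) (b • e'.1), Lp.coeFn_smul a e.1,
        Lp.coeFn_smul b e'.1] with ω h1 h2 h3 h4 h5
      have h : (a • e.1 + b • e'.1 : Lp ℝ p μ) ω = a * U.1 ω + b * U'.1 ω := by
        rw [h3, Pi.add_apply, h4, h5, h1, h2]
        rfl
      exact h.symm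
    · filter_upwards [h2, h2', Lp.coeFn_add (a • e.2) (b • e'.2), Lp.coeFn_smul a e.2,
        Lp.coeFn_smul b e'.2] with ω h1 h2 h3 h4 h5
      have h : (a • e.2 + b • e'.2 : Lp ℝ p μ') ω = a * U.2 ω + b * U'.2 ω := by
        rw [h3, Pi.add_apply, h4, h5, h1, h2]
        rfl
      exact h.symm
  let v : E := (hx.toLp x, hy.toLp y)
  have hv : v ∉ closure C := fun hv => by
    have hη' : 0 < min η 1 := lt_min (pos_iff_ne_zero.2 hη) one_pos
    obtain ⟨e, ⟨U, hU, h1, h2⟩, he⟩ := Metric.mem_closure_iff.1 hv ((min η 1).toReal / 2)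
      (half_pos (ENNReal.toReal_pos hη'.ne' (min_lt_of_right_lt ENNReal.one_lt_top).ne))
    have hle := hfar U hU
    have e1 : eLpNorm (U.1 - x) p μ = edist e.1 v.1 := by
      rw [Lp.edist_def]
      exact eLpNorm_congr_ae (h1.sub hx.coeFn_toLp.symm)
    have e2 : eLpNorm (U.2 - y) p μ' = edist e.2 v.2 := by
      rw [Lp.edist_def]
      exact eLpNorm_congr_ae (h2.sub hy.coeFn_toLp.symm)
    rw [dist_comm, Prod.dist_eq] at he
    have h3 := (le_max_left _ _).trans_lt he
    have h4 := (le_max_right _ _).trans_lt he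
    rw [e1, e2, edist_dist, edist_dist, ← ENNReal.ofReal_add dist_nonneg dist_nonneg] at hle
    have h5 : ENNReal.ofReal (dist e.1 v.1 + dist e.2 v.2) < min η 1 := by
      rw [ENNReal.ofReal_lt_iff_lt_toReal (add_nonneg dist_nonneg dist_nonneg)
        (min_lt_of_right_lt ENNReal.one_lt_top).ne]
      linarith
    exact absurd hle (not_le.2 (h5.trans_le (min_le_left _ _)))
  obtain ⟨ℓ, u, hu, hC⟩ := geometric_hahn_banach_point_closed hCconv.closure isClosed_closure hv
  have hC' : ∀ U (hU : U ∈ K), u < ℓ ((hK U hU).1.toLp _, (hK U hU).2.toLp _) := fun U hU =>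
    hC _ (subset_closure ⟨U, hU, (hK U hU).1.coeFn_toLp.symm, (hK U hU).2.coeFn_toLp.symm⟩)
  have hadd : ∀ (e : E) (n : ℕ) (d : E), ℓ (e + (n : ℝ) • d) = ℓ e + n * ℓ d := fun e n d => by
    rw [map_add, map_smul, smul_eq_mul]
  obtain ⟨U₀, hU₀⟩ := hne
  -- `K` is stable under adding nonnegative pairs, so a direction `d ≥ 0` with `ℓ d < 0` would drive
  -- `ℓ` below the separating level `u` along `e₀ + n d`.
  have hpos : ∀ d : E, 0 ≤ᵐ[μ] d.1 → 0 ≤ᵐ[μ'] d.2 → 0 ≤ ℓ d := fun d hd1 hd2 => by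
    by_contra hneg
    push Not at hneg
    let e₀ : E := ((hK U₀ hU₀).1.toLp _, (hK U₀ hU₀).2.toLp _)
    obtain ⟨n, hn⟩ := exists_nat_gt ((ℓ e₀ - u) / (-ℓ d))
    rw [div_lt_iff₀ (neg_pos.2 hneg)] at hn
    have hin : e₀ + (n : ℝ) • d ∈ C := by
      refine ⟨_, hup U₀ hU₀ (fun ω => n * max (d.1 ω) 0) (fun ω => n * max (d.2 ω) 0)
        (((Lp.stronglyMeasurable d.1).measurable.max measurable_const).const_mul _)
        ((Lp.memLp d.1).pos_part.const_mul _)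
        (fun ω => mul_nonneg n.cast_nonneg (le_max_right _ _))
        (((Lp.stronglyMeasurable d.2).measurable.max measurable_const).const_mul _)
        ((Lp.memLp d.2).pos_part.const_mul _)
        (fun ω => mul_nonneg n.cast_nonneg (le_max_right _ _)), ?_, ?_⟩
      · filter_upwards [hd1, Lp.coeFn_add e₀.1 ((n : ℝ) • d.1), Lp.coeFn_smul (n : ℝ) d.1,
          (hK U₀ hU₀).1.coeFn_toLp] with ω h1 h2 h3 h4
        have h1 : max (d.1 ω) 0 = d.1 ω := max_eq_left h1
        have h4 : e₀.1 ω = U₀.1 ω := h4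
        have h : (e₀.1 + (n : ℝ) • d.1 : Lp ℝ p μ) ω = U₀.1 ω + n * max (d.1 ω) 0 := by
          rw [h2, Pi.add_apply, h3, h4, h1]
          rfl
        exact h.symm
      · filter_upwards [hd2, Lp.coeFn_add e₀.2 ((n : ℝ) • d.2), Lp.coeFn_smul (n : ℝ) d.2,
          (hK U₀ hU₀).2.coeFn_toLp] with ω h1 h2 h3 h4
        have h1 : max (d.2 ω) 0 = d.2 ω := max_eq_left h1
        have h4 : e₀.2 ω = U₀.2 ω := h4
        have h : (e₀.2 + (n : ℝ) • d.2 : Lp ℝ p μ') ω = U₀.2 ω + n * max (d.2 ω) 0 := by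
          rw [h2, Pi.add_apply, h3, h4, h1]
          rfl
        exact h.symm
    have := hC _ (subset_closure hin)
    rw [hadd] at this
    linarith
  obtain ⟨ζ, hζ, hζ0, hζq, hζℓ⟩ := exists_density_of_nonneg (q := q) hp
    (ℓ.comp (ContinuousLinearMap.inl ℝ _ _)) fun f hf => hpos (f, 0) hf (Lp.coeFn_zero ℝ p μ').symm.le
  obtain ⟨ζ', hζ', hζ0', hζq', hζℓ'⟩ := exists_density_of_nonneg (q := q) hp
    (ℓ.comp (ContinuousLinearMap.inr ℝ _ _)) fun f hf => hpos (0, f) (Lp.coeFn_zero ℝ p μ).symm.le hf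
  have hℓ : ∀ (f : S → ℝ) (g : S' → ℝ) (hf : MemLp f p μ) (hg : MemLp g p μ'),
      ℓ (hf.toLp f, hg.toLp g) = ∫ ω, ζ ω * f ω ∂μ + ∫ ω, ζ' ω * g ω ∂μ' := fun f g hf hg => by
    have h : ((hf.toLp f, hg.toLp g) : E) = (hf.toLp f, 0) + (0, hg.toLp g) := by
      rw [Prod.mk_add_mk, add_zero, zero_add]
    rw [← hζℓ f hf, ← hζℓ' g hg, h, map_add]
    rfl
  refine ⟨ζ, ζ', hζ, hζ', hζ0, hζ0', hζq, hζq', u - ℓ v, sub_pos.2 hu, fun U hU => ?_⟩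
  have h1 := hC' U hU
  rw [hℓ] at h1
  rw [← hℓ _ _ hx hy]
  linarith

end LpDual

/-! ### Superlevel sets of two-step positions -/

section TwoStep

variable {Ω : Type*} {m0 : MeasurableSpace Ω} {𝓕 : Filtration ℕ m0} {P : Measure Ω}
  {T t : ℕ} {p q : ℝ≥0∞} {φ : (ℕ → Ω → ℝ) → Ω → EReal} {h : Ω → EReal}
  {x Y : Ω → ℝ}

/-- The position `x 1_{{t}} + Y 1_{[t+1,T]}`. -/
def twoPos (t : ℕ) (x Y : Ω → ℝ) : ℕ → Ω → ℝ := fun s => if s = t then x else Y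

/-- The two-step positions in `Lᵖ × Lᵖ`. -/
def lpTwoStep (𝓕 : Filtration ℕ m0) (P : Measure Ω) (p : ℝ≥0∞) (t : ℕ) :
    Set ((Ω → ℝ) × (Ω → ℝ)) :=
  {U | Measurable[𝓕 t] U.1 ∧ MemLp U.1 p P ∧ Measurable[𝓕 (t + 1)] U.2 ∧ MemLp U.2 p P}

/-- The two-step positions in `Lᵖ × Lᵖ` on which `φ` is at least `h`. -/
def superlevel (𝓕 : Filtration ℕ m0) (P : Measure Ω) (p : ℝ≥0∞) (t : ℕ)
    (φ : (ℕ → Ω → ℝ) → Ω → EReal) (h : Ω → EReal) : Set ((Ω → ℝ) × (Ω → ℝ)) :=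
  {U | U ∈ lpTwoStep 𝓕 P p t ∧ h ≤ᵐ[P] φ (twoPos t U.1 U.2)}

/-- With finitely many pieces the sum of the absolute values is a bound in `Lᵖ`; an unbounded index
would preserve only local integrability. -/
theorem MemLp.concat_of_le {m : MeasurableSpace Ω} (hm : m ≤ m0) {j : Ω → ℕ}
    (hj : Measurable[m] j) {N : ℕ} (hN : ∀ ω, j ω ≤ N) {f : ℕ → Ω → ℝ}
    (hf : ∀ n, Measurable[m0] (f n)) (hfp : ∀ n, MemLp (f n) p P) :
    MemLp (fun ω => f (j ω) ω) p P := by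
  refine (memLp_finsetSum (Finset.range (N + 1)) fun n _ => (hfp n).abs).mono
    (measurable_concat hm hj hf).aestronglyMeasurable (ae_of_all _ fun ω => ?_)
  exact (Finset.single_le_sum (f := fun n => |f n ω|) (fun _ _ => abs_nonneg _)
    (Finset.mem_range.2 (Nat.lt_succ_of_le (hN ω)))).trans (le_abs_self _)

/-- Positions that are close in the mean to some target yield a concatenation
that is close to it pointwise. -/
theorem exists_index_le {K : Set ((Ω → ℝ) × (Ω → ℝ))} {d : (Ω → ℝ) × (Ω → ℝ) → Ω → ℝ≥0∞}
    (hd : ∀ U ∈ K, Measurable[𝓕 t] (d U))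
    (hsmall : ∀ η : ℝ≥0∞, η ≠ 0 → ∃ U ∈ K, ∫⁻ ω, d U ω ∂P < η) {ε : Ω → ℝ≥0∞}
    (hε : Measurable[𝓕 t] ε) (hε0 : ∀ ω, ε ω ≠ 0) :
    ∃ U : ℕ → (Ω → ℝ) × (Ω → ℝ), (∀ n, U n ∈ K) ∧ ∃ j : Ω → ℕ, Measurable[𝓕 t] j ∧
      ∀ᵐ ω ∂P, d (U (j ω)) ω ≤ ε ω := by
  choose U hUK hU using fun n : ℕ => hsmall ((n : ℝ≥0∞) + 1)⁻¹ (by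
    rw [ENNReal.inv_ne_zero]
    exact ENNReal.add_ne_top.2 ⟨ENNReal.natCast_ne_top n, ENNReal.one_ne_top⟩)
  have hm := 𝓕.le t
  have hB : ∀ n, MeasurableSet[𝓕 t] {ω | d (U n) ω ≤ ε ω} := fun n =>
    measurableSet_le (hd _ (hUK n)) hε
  have hA : MeasurableSet (⋂ n, {ω | ε ω < d (U n) ω}) :=
    MeasurableSet.iInter fun n => hm _ (measurableSet_lt hε (hd _ (hUK n)))
  -- Where every `d (U n)` exceeds `ε`, the integral of `ε` is at most `1 / (n + 1)` for all `n`; as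
  -- `ε` never vanishes, this set is null.
  have h0 : ∫⁻ ω in ⋂ n, {ω | ε ω < d (U n) ω}, ε ω ∂P = 0 := by
    refine le_antisymm (ENNReal.le_of_forall_pos_le_add fun r hr _ => ?_) zero_le
    obtain ⟨n, hn⟩ := ENNReal.exists_inv_nat_lt (ENNReal.coe_ne_zero.2 hr.ne')
    rw [zero_add]
    calc ∫⁻ ω in ⋂ n, {ω | ε ω < d (U n) ω}, ε ω ∂P
        ≤ ∫⁻ ω in ⋂ n, {ω | ε ω < d (U n) ω}, d (U n) ω ∂P :=
          setLIntegral_mono' hA fun ω hω => le_of_lt (show ε ω < d (U n) ω from Set.mem_iInter.1 hω n)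
      _ ≤ ∫⁻ ω, d (U n) ω ∂P := setLIntegral_le_lintegral _ _
      _ ≤ ((n : ℝ≥0∞) + 1)⁻¹ := (hU n).le
      _ ≤ (n : ℝ≥0∞)⁻¹ := ENNReal.inv_le_inv.2 le_self_add
      _ ≤ r := hn.le
  rw [setLIntegral_eq_zero_iff hA (hε.mono hm le_rfl)] at h0
  obtain ⟨j, hj, hjB⟩ := exists_measurable_index (P := P) hB (by
    filter_upwards [h0] with ω hω
    by_contra hcon
    refine hε0 ω (hω (Set.mem_iInter.2 fun n => ?_))
    exact lt_of_not_ge fun hle => hcon ⟨n, hle⟩)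
  exact ⟨U, hUK, j, hj, hjB⟩

variable [IsProbabilityMeasure P]

theorem memTwoStep_of_mem_lpTwoStep (hp : 1 ≤ p) {U : (Ω → ℝ) × (Ω → ℝ)}
    (hU : U ∈ lpTwoStep 𝓕 P p t) : MemTwoStep 𝓕 P p t U.1 U.2 :=
  (memTwoStep_iff hp).2 ⟨hU.1, hU.2.2.1, .of_memLp hU.2.2.2⟩

theorem memFuture_twoPos (hp : 1 ≤ p) (hU : MemTwoStep 𝓕 P p t x Y) :
    MemFuture 𝓕 P T p t (twoPos t x Y) := by
  rw [memTwoStep_iff hp] at hU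
  refine (memFuture_iff hp).2 fun s hs _ => ?_
  by_cases hst : s = t
  · subst hst
    simp only [twoPos, if_true]
    exact ⟨hU.1, .of_measurable (𝓕.le s) hU.1⟩
  · simp only [twoPos, hst, if_false]
    exact ⟨hU.2.1.mono (𝓕.mono (Nat.lt_of_le_of_ne hs (Ne.symm hst))) le_rfl, hU.2.2⟩

theorem MemTwoStep.concat (hp : 1 ≤ p) {j : Ω → ℕ} (hj : Measurable[𝓕 t] j)
    {U : ℕ → (Ω → ℝ) × (Ω → ℝ)} (hU : ∀ n, MemTwoStep 𝓕 P p t (U n).1 (U n).2) :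
    MemTwoStep 𝓕 P p t (fun ω => (U (j ω)).1 ω) (fun ω => (U (j ω)).2 ω) := by
  simp only [memTwoStep_iff hp] at hU ⊢
  exact ⟨measurable_concat le_rfl hj fun n => (hU n).1,
    measurable_concat (𝓕.mono t.le_succ) hj fun n => (hU n).2.1,
    LocLp.concat (𝓕.le t) hj fun n => (hU n).2.2⟩

namespace IsUSCAssessmentIndex

theorem concat_twoPos (hφ : IsUSCAssessmentIndex 𝓕 P T p t φ) (hp : 1 ≤ p) {j : Ω → ℕ}
    (hj : Measurable[𝓕 t] j) {U : ℕ → (Ω → ℝ) × (Ω → ℝ)}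
    (hU : ∀ n, MemTwoStep 𝓕 P p t (U n).1 (U n).2) :
    ∀ᵐ ω ∂P, φ (twoPos t (fun ω => (U (j ω)).1 ω) (fun ω => (U (j ω)).2 ω)) ω =
      φ (twoPos t (U (j ω)).1 (U (j ω)).2) ω := by
  have e : twoPos t (fun ω => (U (j ω)).1 ω) (fun ω => (U (j ω)).2 ω) =
      fun s ω => twoPos t (U (j ω)).1 (U (j ω)).2 s ω := by
    ext s ω
    by_cases hs : s = t <;> simp [twoPos, hs]
  rw [e]
  exact hφ.concat hp hj fun n => memFuture_twoPos hp (hU n)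

theorem concat_mem_superlevel (hφ : IsUSCAssessmentIndex 𝓕 P T p t φ) (hp : 1 ≤ p) {j : Ω → ℕ}
    (hj : Measurable[𝓕 t] j) {N : ℕ} (hN : ∀ ω, j ω ≤ N) {U : ℕ → (Ω → ℝ) × (Ω → ℝ)}
    (hU : ∀ n, U n ∈ lpTwoStep 𝓕 P p t)
    (hUh : ∀ᵐ ω ∂P, h ω ≤ φ (twoPos t (U (j ω)).1 (U (j ω)).2) ω) :
    (fun ω => (U (j ω)).1 ω, fun ω => (U (j ω)).2 ω) ∈ superlevel 𝓕 P p t φ h := by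
  refine ⟨⟨measurable_concat le_rfl hj fun n => (hU n).1,
    MemLp.concat_of_le (𝓕.le t) hj hN (f := fun n => (U n).1)
      (fun n => (hU n).1.mono (𝓕.le t) le_rfl) fun n => (hU n).2.1,
    measurable_concat (𝓕.mono t.le_succ) hj fun n => (hU n).2.2.1,
    MemLp.concat_of_le (𝓕.le t) hj hN (f := fun n => (U n).2)
      (fun n => (hU n).2.2.1.mono (𝓕.le _) le_rfl) fun n => (hU n).2.2.2⟩, ?_⟩
  filter_upwards [hφ.concat_twoPos hp hj fun n => memTwoStep_of_mem_lpTwoStep hp (hU n), hUh]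
    with ω h1 h2
  exact h2.trans_eq h1.symm

theorem convex_superlevel (hφ : IsUSCAssessmentIndex 𝓕 P T p t φ) (hp : 1 ≤ p) :
    Convex ℝ (superlevel 𝓕 P p t φ h) := by
  rintro U ⟨hU, hUh⟩ W ⟨hW, hWh⟩ a b ha hb hab
  obtain rfl : b = 1 - a := by linarith
  refine ⟨⟨(hU.1.const_smul a).add (hW.1.const_smul _),
    (hU.2.1.const_smul a).add (hW.2.1.const_smul _),
    (hU.2.2.1.const_smul a).add (hW.2.2.1.const_smul _),
    (hU.2.2.2.const_smul a).add (hW.2.2.2.const_smul _)⟩, ?_⟩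
  have e : twoPos t (a • U + (1 - a) • W).1 (a • U + (1 - a) • W).2 = fun s ω =>
      a * twoPos t U.1 U.2 s ω + (1 - a) * twoPos t W.1 W.2 s ω := by
    ext s ω
    by_cases hs : s = t <;> simp [twoPos, hs]
  rw [e]
  filter_upwards [hUh, hWh, hφ.quasiconcave _ _
    (memFuture_twoPos hp (memTwoStep_of_mem_lpTwoStep hp hU))
    (memFuture_twoPos hp (memTwoStep_of_mem_lpTwoStep hp hW)) (fun _ => a) measurable_const
    fun _ => ⟨ha, by linarith⟩] with ω h1 h2 h3
  exact (le_min h1 h2).trans h3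

theorem add_mem_superlevel (hφ : IsUSCAssessmentIndex 𝓕 P T p t φ) (hp : 1 ≤ p)
    {U : (Ω → ℝ) × (Ω → ℝ)} (hU : U ∈ superlevel 𝓕 P p t φ h) {f g : Ω → ℝ}
    (hf : Measurable[𝓕 t] f) (hfp : MemLp f p P) (hf0 : ∀ ω, 0 ≤ f ω)
    (hg : Measurable[𝓕 (t + 1)] g) (hgp : MemLp g p P) (hg0 : ∀ ω, 0 ≤ g ω) :
    (U.1 + f, U.2 + g) ∈ superlevel 𝓕 P p t φ h := by
  have hl : (U.1 + f, U.2 + g) ∈ lpTwoStep 𝓕 P p t :=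
    ⟨hU.1.1.add hf, hU.1.2.1.add hfp, hU.1.2.2.1.add hg, hU.1.2.2.2.add hgp⟩
  refine ⟨hl, hU.2.trans (hφ.monotone _ _ (memFuture_twoPos hp (memTwoStep_of_mem_lpTwoStep hp hl))
    (memFuture_twoPos hp (memTwoStep_of_mem_lpTwoStep hp hU.1)) fun s _ _ => ae_of_all _ fun ω => ?_)⟩
  by_cases hs : s = t <;> simp [twoPos, hs, hf0 ω, hg0 ω]

end IsUSCAssessmentIndex

end TwoStep

/-! ### Separation of a position from a superlevel set, `p < ∞` -/

section SeparationLp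

variable {Ω : Type*} {m m0 : MeasurableSpace Ω} {𝓕 : Filtration ℕ m0} {P : Measure Ω}
  {T t : ℕ} {p q : ℝ≥0∞} {φ : (ℕ → Ω → ℝ) → Ω → EReal} {h : Ω → EReal}

theorem memLp_trim_iff (hm : m ≤ m0) {f : Ω → ℝ} (hf : Measurable[m] f) :
    MemLp f p (P.trim hm) ↔ MemLp f p P :=
  ⟨memLp_of_memLp_trim hm, fun h => ⟨hf.stronglyMeasurable.aestronglyMeasurable, by
    rw [eLpNorm_trim hm hf.stronglyMeasurable]
    exact h.2⟩⟩

theorem lintegral_abs_rpow (hp0 : p ≠ 0) (hp : p ≠ ∞) (f : Ω → ℝ) :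
    ∫⁻ ω, ENNReal.ofReal |f ω| ^ p.toReal ∂P = eLpNorm f p P ^ p.toReal := by
  rw [eLpNorm_eq_lintegral_rpow_enorm_toReal hp0 hp, ← ENNReal.rpow_mul, one_div,
    inv_mul_cancel₀ (ENNReal.toReal_pos hp0 hp).ne', ENNReal.rpow_one]
  simp only [Real.enorm_eq_ofReal_abs]

variable [IsProbabilityMeasure P]

/-- Were the superlevel set arbitrarily close to `V` in `Lᵖ`, its elements could be pasted into
positions within any conditional radius of `V`, and conditional closedness would give `V` at least
the value `h`. -/
theorem exists_eLpNorm_le_of_notMem (hφ : IsUSCAssessmentIndex 𝓕 P T p t φ) (hp1 : 1 ≤ p)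
    (hp : p ≠ ∞) (hh : Measurable[𝓕 t] h) {V : (Ω → ℝ) × (Ω → ℝ)}
    (hV : V ∈ lpTwoStep 𝓕 P p t) (hVh : ¬ h ≤ᵐ[P] φ (twoPos t V.1 V.2)) :
    ∃ η : ℝ≥0∞, η ≠ 0 ∧ ∀ U ∈ superlevel 𝓕 P p t φ h,
      η ≤ eLpNorm (U.1 - V.1) p P + eLpNorm (U.2 - V.2) p P := by
  by_contra hcon
  push Not at hcon
  have hp0 : p ≠ 0 := (one_pos.trans_le hp1).ne'
  have hr : 0 < p.toReal := ENNReal.toReal_pos hp0 hp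
  let D : (Ω → ℝ) → Ω → ℝ≥0∞ := fun f =>
    condLExp (𝓕 t) P fun ω => ENNReal.ofReal |f ω| ^ p.toReal
  let d : (Ω → ℝ) × (Ω → ℝ) → Ω → ℝ≥0∞ := fun U ω => D (U.1 - V.1) ω + D (U.2 - V.2) ω
  refine hVh (hφ.usc h hh _ (memFuture_twoPos hp1 (memTwoStep_of_mem_lpTwoStep hp1 hV))
    (fun _ ε hε hε0 => ?_) fun hp' => absurd hp' hp)
  obtain ⟨U, hU, j, hj, hjd⟩ := exists_index_le (P := P) (K := superlevel 𝓕 P p t φ h) (d := d)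
    (fun U _ => (measurable_condLExp _ P _).add (measurable_condLExp _ P _))
    (fun η hη => by
      -- The root compensates for the `p`-th powers in `d`, the half for its two summands.
      have hη2 : (η / 2) ^ (p.toReal)⁻¹ ≠ 0 := by
        rw [Ne, ENNReal.rpow_eq_zero_iff]
        rintro (⟨h0, -⟩ | ⟨-, h0⟩)
        · exact (ENNReal.half_pos hη).ne' h0
        · exact absurd h0 (not_lt.2 (inv_nonneg.2 hr.le))
      obtain ⟨U, hU, hlt⟩ := hcon _ hη2
      refine ⟨U, hU, ?_⟩
      calc ∫⁻ ω, d U ω ∂P = ∫⁻ ω, D (U.1 - V.1) ω ∂P + ∫⁻ ω, D (U.2 - V.2) ω ∂P :=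
            lintegral_add_left ((measurable_condLExp _ P _).mono (𝓕.le t) le_rfl) _
        _ = eLpNorm (U.1 - V.1) p P ^ p.toReal + eLpNorm (U.2 - V.2) p P ^ p.toReal := by
            rw [lintegral_condLExp (𝓕.le t), lintegral_condLExp (𝓕.le t),
              lintegral_abs_rpow hp0 hp, lintegral_abs_rpow hp0 hp]
        _ < η / 2 + η / 2 := ENNReal.add_lt_add
            (by rw [← ENNReal.lt_rpow_inv_iff hr]; exact le_self_add.trans_lt hlt)
            (by rw [← ENNReal.lt_rpow_inv_iff hr]; exact le_add_self.trans_lt hlt)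
        _ = η := ENNReal.add_halves η)
    (ε := fun ω => ENNReal.ofReal (ε ω) ^ p.toReal) (hε.ennreal_ofReal.pow_const _)
    fun ω => (ENNReal.rpow_pos (ENNReal.ofReal_pos.2 (hε0 ω)) ENNReal.ofReal_ne_top).ne'
  have hUm := fun n => memTwoStep_of_mem_lpTwoStep hp1 (hU n).1
  have hloc : ∀ (f : ℕ → Ω → ℝ) (g : Ω → ℝ), ∀ᵐ ω ∂P,
      D (fun ω => f (j ω) ω - g ω) ω = D (f (j ω) - g) ω := fun f g => ae_of_index j fun n => by
    filter_upwards [condLExp_congr_on (P := P) (𝓕.le t) (measurableSet_index hj n)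
      (F := fun ω => ENNReal.ofReal |f (j ω) ω - g ω| ^ p.toReal)
      (G := fun ω => ENNReal.ofReal |(f n - g) ω| ^ p.toReal) (ae_of_all _ fun ω hω => by
        have hω : j ω = n := hω
        rw [hω, Pi.sub_apply])] with ω hω hn
    have h1 := hω hn
    rw [hn]
    exact h1
  refine ⟨_, ?_, memFuture_twoPos hp1 (MemTwoStep.concat hp1 hj hUm), fun s hs _ =>
    ⟨fun hp' => absurd hp' hp, fun _ => ?_⟩⟩
  · filter_upwards [hφ.concat_twoPos hp1 hj hUm, ae_all_iff.2 fun n => (hU n).2] with ω h1 h2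
    exact (h2 (j ω)).trans_eq h1.symm
  · by_cases hst : s = t
    · simp only [twoPos, hst, if_true]
      filter_upwards [hjd, hloc (fun n => (U n).1) V.1] with ω h1 h2
      exact h2.le.trans (le_self_add.trans h1)
    · simp only [twoPos, hst, if_false]
      filter_upwards [hjd, hloc (fun n => (U n).2) V.2] with ω h1 h2
      exact h2.le.trans (le_add_self.trans h1)

/-- Hahn–Banach is applied over the trimmed measures, so the densities come out measurable for 𝓕ₜ
and for 𝓕_{t+1}. -/
theorem exists_densities_of_ne_top [ENNReal.HolderConjugate p q]
    (hφ : IsUSCAssessmentIndex 𝓕 P T p t φ)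
    (hp : p ≠ ∞) (hh : Measurable[𝓕 t] h) (hne : (superlevel 𝓕 P p t φ h).Nonempty)
    {V : (Ω → ℝ) × (Ω → ℝ)}
    (hV : V ∈ lpTwoStep 𝓕 P p t) (hVh : ¬ h ≤ᵐ[P] φ (twoPos t V.1 V.2)) :
    ∃ ζ ζ' : Ω → ℝ, Measurable[𝓕 t] ζ ∧ Measurable[𝓕 (t + 1)] ζ' ∧ (∀ ω, 0 ≤ ζ ω) ∧
      (∀ ω, 0 ≤ ζ' ω) ∧ MemLp ζ q P ∧ MemLp ζ' q P ∧ ∃ δ : ℝ, 0 < δ ∧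
        ∀ U ∈ superlevel 𝓕 P p t φ h,
          ∫ ω, ζ ω * V.1 ω ∂P + ∫ ω, ζ' ω * V.2 ω ∂P + δ ≤
            ∫ ω, ζ ω * U.1 ω ∂P + ∫ ω, ζ' ω * U.2 ω ∂P := by
  have hp1 : 1 ≤ p := ENNReal.HolderConjugate.one_le p q
  have : Fact (1 ≤ p) := ⟨hp1⟩
  have hm := 𝓕.le t
  have hm' := 𝓕.le (t + 1)
  obtain ⟨η, hη, hfar⟩ := exists_eLpNorm_le_of_notMem hφ hp1 hp hh hV hVh
  obtain ⟨ζ, ζ', h1, h2, h3, h4, h5, h6, δ, hδ, hsep⟩ := exists_separating_densities (q := q)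
    (mS := 𝓕 t) (μ := P.trim hm) (mS' := 𝓕 (t + 1)) (μ' := P.trim hm') hp
    (K := superlevel 𝓕 P p t φ h)
    (fun U hU => ⟨(memLp_trim_iff hm hU.1.1).2 hU.1.2.1, (memLp_trim_iff hm' hU.1.2.2.1).2 hU.1.2.2.2⟩)
    (hφ.convex_superlevel hp1) hne
    (fun U hU f g hf hfp hf0 hg hgp hg0 => hφ.add_mem_superlevel hp1 hU hf
      (memLp_of_memLp_trim hm hfp) hf0 hg (memLp_of_memLp_trim hm' hgp) hg0)
    ((memLp_trim_iff hm hV.1).2 hV.2.1) ((memLp_trim_iff hm' hV.2.2.1).2 hV.2.2.2) hη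
    (fun U hU => by
      rw [eLpNorm_trim hm (hU.1.1.sub hV.1).stronglyMeasurable,
        eLpNorm_trim hm' (hU.1.2.2.1.sub hV.2.2.1).stronglyMeasurable]
      exact hfar U hU)
  refine ⟨ζ, ζ', h1, h2, h3, h4, memLp_of_memLp_trim hm h5, memLp_of_memLp_trim hm' h6, δ, hδ,
    fun U hU => ?_⟩
  have e : ∀ f : Ω → ℝ, Measurable[𝓕 t] f → ∫ ω, ζ ω * f ω ∂P = ∫ ω, ζ ω * f ω ∂P.trim hm :=
    fun f hf => integral_trim hm (h1.mul hf).stronglyMeasurable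
  have e' : ∀ f : Ω → ℝ, Measurable[𝓕 (t + 1)] f →
      ∫ ω, ζ' ω * f ω ∂P = ∫ ω, ζ' ω * f ω ∂P.trim hm' :=
    fun f hf => integral_trim hm' (h2.mul hf).stronglyMeasurable
  rw [e _ hV.1, e' _ hV.2.2.1, e _ hU.1.1, e' _ hU.1.2.2.1]
  exact hsep U hU

end SeparationLp

/-! ### Separation of a position from a superlevel set, `p = ∞` -/

/-- Strict separation of a point from a convex set in `(L²)ⁿ`. -/
theorem exists_separating_memLp_two {S : Type*} {mS : MeasurableSpace S} {μ : Measure S}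
    [IsFiniteMeasure μ] {n : ℕ} {C : Set (Fin n → S → ℝ)} (hC : ∀ f ∈ C, ∀ i, MemLp (f i) 2 μ)
    (hconv : Convex ℝ C) {g : Fin n → S → ℝ} (hg : ∀ i, MemLp (g i) 2 μ) {η : ℝ≥0∞} (hη : η ≠ 0)
    (hfar : ∀ f ∈ C, η ≤ ∑ i, eLpNorm (f i - g i) 2 μ) :
    ∃ k : Fin n → S → ℝ, (∀ i, Measurable (k i) ∧ MemLp (k i) 2 μ) ∧ ∃ δ : ℝ, 0 < δ ∧
      ∀ f ∈ C, ∑ i, ∫ ω, k i ω * g i ω ∂μ + δ ≤ ∑ i, ∫ ω, k i ω * f i ω ∂μ := by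
  let E := Fin n → Lp ℝ 2 μ
  let D : Set E := {e | ∃ f ∈ C, ∀ i, f i =ᵐ[μ] e i}
  have hD : Convex ℝ D := by
    rintro e ⟨f, hf, hfe⟩ e' ⟨f', hf', hfe'⟩ a b ha hb hab
    refine ⟨a • f + b • f', hconv hf hf' ha hb hab, fun i => ?_⟩
    filter_upwards [hfe i, hfe' i, Lp.coeFn_add (a • e i) (b • e' i), Lp.coeFn_smul a (e i),
      Lp.coeFn_smul b (e' i)] with ω h1 h2 h3 h4 h5
    have h : (a • e i + b • e' i : Lp ℝ 2 μ) ω = a * f i ω + b * f' i ω := by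
      rw [h3, Pi.add_apply, h4, h5, h1, h2]
      rfl
    exact h.symm
  let v : E := fun i => (hg i).toLp _
  have hv : v ∉ closure D := fun hv => by
    have hη' : 0 < min η 1 := lt_min (pos_iff_ne_zero.2 hη) one_pos
    have hηtop : min η 1 ≠ ∞ := (min_lt_of_right_lt ENNReal.one_lt_top).ne
    -- With this radius in each of the `n` coordinates the total distance stays below `η`; the
    -- minimum with 1 makes it finite.
    have hr : 0 < (min η 1).toReal / (n + 1) :=
      div_pos (ENNReal.toReal_pos hη'.ne' hηtop) (by positivity)
    obtain ⟨e, ⟨f, hf, hfe⟩, he⟩ := Metric.mem_closure_iff.1 hv _ hr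
    have hle := hfar f hf
    have e1 : ∀ i, eLpNorm (f i - g i) 2 μ ≤ ENNReal.ofReal ((min η 1).toReal / (n + 1)) :=
      fun i => by
        have : eLpNorm (f i - g i) 2 μ = edist (e i) (v i) := by
          rw [Lp.edist_def]
          exact eLpNorm_congr_ae ((hfe i).sub (hg i).coeFn_toLp.symm)
        rw [this, edist_dist, dist_comm]
        exact ENNReal.ofReal_le_ofReal ((dist_le_pi_dist v e i).trans he.le)
    have h2 := hle.trans (Finset.sum_le_sum fun i _ => e1 i)
    rw [Finset.sum_const, Finset.card_univ, Fintype.card_fin, ← ENNReal.ofReal_nsmul,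
      nsmul_eq_mul] at h2
    have h3 : ENNReal.ofReal (n * ((min η 1).toReal / (n + 1))) < min η 1 := by
      rw [ENNReal.ofReal_lt_iff_lt_toReal (by positivity) hηtop, ← mul_div_assoc,
        div_lt_iff₀ (by positivity)]
      nlinarith [ENNReal.toReal_pos hη'.ne' hηtop]
    exact absurd h2 (not_le.2 (h3.trans_le (min_le_left _ _)))
  obtain ⟨ℓ, u, hu, hDu⟩ := geometric_hahn_banach_point_closed hD.closure isClosed_closure hv
  -- The Riesz representation of each coordinate functional; this is the reason for working in `L²`.
  let κ : Fin n → Lp ℝ 2 μ := fun i =>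
    (InnerProductSpace.toDual ℝ (Lp ℝ 2 μ)).symm
      (ℓ.comp (ContinuousLinearMap.single ℝ (fun _ : Fin n => Lp ℝ 2 μ) i))
  have hℓ : ∀ (f : Fin n → S → ℝ) (hf : ∀ i, MemLp (f i) 2 μ),
      ℓ (fun i => (hf i).toLp _) = ∑ i, ∫ ω, κ i ω * f i ω ∂μ := fun f hf => by
    have h1 : (fun i => (hf i).toLp (f i) : E) = ∑ i, Pi.single i ((hf i).toLp (f i)) :=
      (Finset.univ_sum_single _).symm
    rw [h1, map_sum]
    refine Finset.sum_congr rfl fun i _ => ?_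
    have h2 : ℓ (Pi.single i ((hf i).toLp (f i))) = inner ℝ (κ i) ((hf i).toLp (f i)) := by
      rw [InnerProductSpace.toDual_symm_apply]
      rfl
    rw [h2, L2.inner_def]
    refine integral_congr_ae ?_
    filter_upwards [(hf i).coeFn_toLp] with ω hω
    rw [hω]
    simp [inner, mul_comm]
  refine ⟨fun i => κ i, fun i => ⟨(Lp.stronglyMeasurable (κ i)).measurable, Lp.memLp (κ i)⟩,
    u - ℓ v, sub_pos.2 hu, fun f hf => ?_⟩
  have h1 := hDu _ (subset_closure ⟨f, hf, fun i => (hC f hf i).coeFn_toLp.symm⟩)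
  rw [hℓ f (hC f hf)] at h1
  rw [← hℓ g hg]
  linarith

section SeparationTop

variable {Ω : Type*} {m m0 : MeasurableSpace Ω} {𝓕 : Filtration ℕ m0} {P : Measure Ω}
  {T t : ℕ} {φ : (ℕ → Ω → ℝ) → Ω → EReal} {h : Ω → EReal}
  {f g : Ω → ℝ}

theorem exists_abs_le_of_memLp_top (hf : MemLp f ∞ P) : ∃ c : ℝ, 0 ≤ c ∧ ∀ᵐ ω ∂P, |f ω| ≤ c := by
  refine ⟨(eLpNorm f ∞ P).toReal, ENNReal.toReal_nonneg, ?_⟩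
  filter_upwards [ae_le_eLpNormEssSup (f := f) (μ := P)] with ω hω
  rw [← Real.norm_eq_abs, ← toReal_enorm]
  exact ENNReal.toReal_mono hf.2.ne (by rwa [eLpNorm_exponent_top])

theorem locLp_one_mul_of_memLp_top (hm : m ≤ m0) (hf : LocLp m P 1 f) (hg : MemLp g ∞ P) :
    LocLp m P 1 fun ω => f ω * g ω :=
  hf.mul hm (.of_memLp hg)

theorem _root_.MeasureTheory.Integrable.fun_mul_memLp_top (hf : Integrable f P)
    (hg : MemLp g ∞ P) : Integrable (fun ω => f ω * g ω) P := hf.mul_of_top_left hg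

/-- The indicator of `{f < 0}` is an admissible test function. -/
theorem ae_nonneg_of_integral_mul_nonneg (hm : m ≤ m0) (hf : Measurable[m] f)
    (hfi : Integrable f P)
    (H : ∀ g : Ω → ℝ, Measurable[m] g → MemLp g ∞ P → (∀ ω, 0 ≤ g ω) → 0 ≤ ∫ ω, f ω * g ω ∂P) :
    ∀ᵐ ω ∂P, 0 ≤ f ω := by
  have hA : MeasurableSet[m] {ω | f ω < 0} := measurableSet_lt hf measurable_const
  let g : Ω → ℝ := {ω | f ω < 0}.indicator fun _ => 1
  have hg : Measurable[m] g := Measurable.indicator measurable_const hA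
  have hgp : MemLp g ∞ P := memLp_top_of_bound (hg.mono hm le_rfl).aestronglyMeasurable 1
    (ae_of_all _ fun ω => norm_indicator_le_of_subset (subset_refl _) (fun _ => (1 : ℝ)) ω |>.trans
      (by by_cases h : f ω < 0 <;> simp [h]))
  have h1 := H g hg hgp fun ω => Set.indicator_nonneg (fun _ _ => zero_le_one) ω
  have h2 : ∀ ω, 0 ≤ -(f ω * g ω) := fun ω => by
    by_cases h : f ω < 0
    · simp [g, h, h.le]
    · simp [g, h]
  have h3 : ∫ ω, -(f ω * g ω) ∂P = 0 := by
    refine le_antisymm ?_ (integral_nonneg h2)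
    rw [integral_neg]
    linarith
  rw [integral_eq_zero_iff_of_nonneg h2 (hfi.fun_mul_memLp_top hgp).neg] at h3
  filter_upwards [h3] with ω hω
  by_contra h
  push Not at h
  simp [g, h] at hω
  exact h.ne hω

variable [IsProbabilityMeasure P]

theorem abs_cE_le (hm : m ≤ m0) (hf : LocLp m P 1 f) :
    ∀ᵐ ω ∂P, |cE m P f ω| ≤ cE m P (fun ω => |f ω|) ω := by
  filter_upwards [cE_mono hm hf hf.abs (ae_of_all _ fun ω => le_abs_self _),
    cE_mono hm hf.neg hf.abs (ae_of_all _ fun ω => neg_le_abs _), cE_neg hm hf] with ω h1 h2 h3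
  rw [h3] at h2
  exact abs_le'.2 ⟨h1, h2⟩

theorem LocLp.condLExp_ofReal (hm : m ≤ m0) (hf : LocLp m P 1 f) (h0 : ∀ ω, 0 ≤ f ω) :
    condLExp m P (fun ω => ENNReal.ofReal (f ω)) =ᵐ[P] fun ω => ENNReal.ofReal (cE m P f ω) := by
  have e1 : (fun ω => (f ω : EReal).toENNReal) = fun ω => ENNReal.ofReal (f ω) := by
    ext ω
    simp
  have e2 : (fun ω => (-(f ω : EReal)).toENNReal) = 0 := by
    ext ω
    exact EReal.toENNReal_of_nonpos (by simpa using h0 ω)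
  filter_upwards [hf.condE_eq hm] with ω hω
  simp only [condE, e1, e2, condLExp_zero, Pi.zero_apply, EReal.coe_ennreal_zero, sub_zero] at hω
  have hn : 0 ≤ cE m P f ω := EReal.coe_nonneg.1 (hω ▸ EReal.coe_ennreal_nonneg _)
  rw [← EReal.coe_ennreal_eq_coe_ennreal_iff, hω, EReal.coe_ennreal_ofReal, max_eq_left hn]

theorem integrable_of_cE_abs_le (hm : m ≤ m0) (hf : LocLp m P 1 f) (hfm : Measurable[m0] f)
    (hg : Integrable g P) (h : ∀ᵐ ω ∂P, cE m P (fun ω => |f ω|) ω ≤ g ω) : Integrable f P := by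
  have h1 : ∀ᵐ ω ∂P, condLExp m P (fun ω => ENNReal.ofReal |f ω|) ω ≤ ENNReal.ofReal |g ω| := by
    filter_upwards [hf.abs.condLExp_ofReal hm fun _ => abs_nonneg _, h] with ω h1 h2
    rw [h1]
    exact ENNReal.ofReal_le_ofReal (h2.trans (le_abs_self _))
  refine ⟨hfm.aestronglyMeasurable, ?_⟩
  have hgf := hg.2
  rw [hasFiniteIntegral_iff_enorm] at hgf ⊢
  simp only [Real.enorm_eq_ofReal_abs] at hgf ⊢
  rw [← lintegral_condLExp hm]
  exact (lintegral_mono_ae h1).trans_lt hgf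

/-- A pair of weights defining a conditional functional on two-step positions that is bounded
by the essential supremum. -/
structure IsBoundedWeight (m : MeasurableSpace Ω) {m0 : MeasurableSpace Ω} (P : Measure Ω) (z S : Ω → ℝ) : Prop where
  measurable_fst : Measurable[m] z
  abs_fst_le : ∀ ω, |z ω| ≤ 1
  measurable_snd : Measurable[m0] S
  locLp_snd : LocLp m P 1 S
  cE_abs_snd_le : ∀ᵐ ω ∂P, cE m P (fun ω => |S ω|) ω ≤ 1

/-- The conditional functional with weights `z` and `S`. -/
noncomputable def weightPairing (m : MeasurableSpace Ω) {m0 : MeasurableSpace Ω} (P : Measure Ω)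
    (z S : Ω → ℝ) (U : (Ω → ℝ) × (Ω → ℝ)) : Ω → ℝ := cE m P fun ω => z ω * U.1 ω + S ω * U.2 ω

variable {z S : Ω → ℝ} {U W : (Ω → ℝ) × (Ω → ℝ)}

namespace IsBoundedWeight

theorem integrable_mul (hw : IsBoundedWeight (𝓕 t) P z S) {k : Ω → ℝ}
    (hk : Measurable[𝓕 t] k) (hki : Integrable k P) : Integrable (fun ω => k ω * S ω) P := by
  have hm := 𝓕.le t
  refine integrable_of_cE_abs_le hm (hw.locLp_snd.measurable_mul hm hk)
    ((hk.mono hm le_rfl).mul hw.measurable_snd) hki.abs ?_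
  have e : (fun ω => |k ω * S ω|) = fun ω => |k ω| * |S ω| := funext fun ω => abs_mul _ _
  rw [e]
  filter_upwards [cE_measurable_mul hm (f := fun ω => |k ω|)
      (continuous_abs.measurable.comp hk) hw.locLp_snd.abs,
    hw.cE_abs_snd_le] with ω h1 h2
  rw [h1]
  exact mul_le_of_le_one_right (abs_nonneg _) h2

theorem weightPairing_eq (hw : IsBoundedWeight (𝓕 t) P z S) (hU : U ∈ lpTwoStep 𝓕 P ∞ t) :
    weightPairing (𝓕 t) P z S U =ᵐ[P]
      fun ω => z ω * U.1 ω + cE (𝓕 t) P (fun ω => S ω * U.2 ω) ω := by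
  have hm := 𝓕.le t
  have h1 : Measurable[𝓕 t] fun ω => z ω * U.1 ω := hw.measurable_fst.mul hU.1
  filter_upwards [cE_add hm (.of_measurable hm h1)
    (locLp_one_mul_of_memLp_top hm hw.locLp_snd hU.2.2.2), cE_of_measurable (P := P) hm h1]
    with ω h2 h3
  rw [weightPairing, h2, h3]

theorem memLp_weightPairing (hw : IsBoundedWeight (𝓕 t) P z S) (hU : U ∈ lpTwoStep 𝓕 P ∞ t) :
    MemLp (weightPairing (𝓕 t) P z S U) 2 P := by
  have hm := 𝓕.le t
  obtain ⟨c, hc, hc1⟩ := exists_abs_le_of_memLp_top hU.2.1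
  obtain ⟨c', hc', hc2⟩ := exists_abs_le_of_memLp_top hU.2.2.2
  have hSU := locLp_one_mul_of_memLp_top hm hw.locLp_snd hU.2.2.2
  refine MemLp.of_bound ((measurable_cE _ _ _).mono hm le_rfl).aestronglyMeasurable (c + c') ?_
  filter_upwards [hw.weightPairing_eq hU, hc1, abs_cE_le hm hSU,
    cE_mono hm hSU.abs (hw.locLp_snd.abs.measurable_mul hm (measurable_const (a := c')))
      (by
        filter_upwards [hc2] with ω hω
        rw [abs_mul, mul_comm]
        exact mul_le_mul_of_nonneg_right hω (abs_nonneg _)),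
    cE_measurable_mul hm (measurable_const (a := c')) hw.locLp_snd.abs, hw.cE_abs_snd_le]
    with ω h1 h2 h3 h4 h5 h6
  rw [h1, Real.norm_eq_abs]
  rw [h5] at h4
  refine (abs_add_le _ _).trans (add_le_add ?_ (h3.trans (h4.trans (mul_le_of_le_one_right hc' h6))))
  rw [abs_mul]
  exact (mul_le_of_le_one_left (abs_nonneg _) (hw.abs_fst_le ω)).trans h2

theorem weightPairing_convexComb (hw : IsBoundedWeight (𝓕 t) P z S)
    (hU : U ∈ lpTwoStep 𝓕 P ∞ t) (hW : W ∈ lpTwoStep 𝓕 P ∞ t) (a b : ℝ) :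
    weightPairing (𝓕 t) P z S (a • U + b • W) =ᵐ[P]
      a • weightPairing (𝓕 t) P z S U + b • weightPairing (𝓕 t) P z S W := by
  have hm := 𝓕.le t
  have hl : ∀ {U}, U ∈ lpTwoStep 𝓕 P ∞ t → LocLp (𝓕 t) P 1 fun ω => z ω * U.1 ω + S ω * U.2 ω :=
    fun hU => LocLp.add hm (.of_measurable hm (hw.measurable_fst.mul hU.1))
      (locLp_one_mul_of_memLp_top hm hw.locLp_snd hU.2.2.2)
  have e : (fun ω => z ω * (a • U + b • W).1 ω + S ω * (a • U + b • W).2 ω) = fun ω =>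
      a * (z ω * U.1 ω + S ω * U.2 ω) + b * (z ω * W.1 ω + S ω * W.2 ω) := by
    ext ω
    simp
    ring
  filter_upwards [cE_add hm ((hl hU).measurable_mul hm (measurable_const (a := a)))
      ((hl hW).measurable_mul hm (measurable_const (a := b))),
    cE_measurable_mul hm (measurable_const (a := a)) (hl hU),
    cE_measurable_mul hm (measurable_const (a := b)) (hl hW)] with ω h1 h2 h3
  rw [weightPairing, e, h1, h2, h3]
  rfl

theorem integral_mul_weightPairing (hw : IsBoundedWeight (𝓕 t) P z S)
    (hU : U ∈ lpTwoStep 𝓕 P ∞ t) {k : Ω → ℝ} (hk : Measurable[𝓕 t] k) (hki : Integrable k P) :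
    ∫ ω, k ω * weightPairing (𝓕 t) P z S U ω ∂P =
      ∫ ω, k ω * z ω * U.1 ω ∂P + ∫ ω, k ω * S ω * U.2 ω ∂P := by
  have hm := 𝓕.le t
  have h1 : Integrable (fun ω => k ω * z ω * U.1 ω) P := by
    refine Integrable.mul_of_top_left ?_ hU.2.1
    exact hki.mul_bdd (c := 1) (hw.measurable_fst.mono hm le_rfl).aestronglyMeasurable
      (ae_of_all _ hw.abs_fst_le)
  have h2 : Integrable (fun ω => k ω * S ω * U.2 ω) P :=
    Integrable.mul_of_top_left (hw.integrable_mul hk hki) hU.2.2.2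
  have hl : LocLp (𝓕 t) P 1 fun ω => z ω * U.1 ω + S ω * U.2 ω :=
    LocLp.add hm (.of_measurable hm (hw.measurable_fst.mul hU.1))
      (locLp_one_mul_of_memLp_top hm hw.locLp_snd hU.2.2.2)
  rw [← integral_add h1 h2, ← integral_condExp hm
    (f := fun ω => k ω * z ω * U.1 ω + k ω * S ω * U.2 ω)]
  refine integral_congr_ae ?_
  have e : (fun ω => k ω * (z ω * U.1 ω + S ω * U.2 ω)) = fun ω =>
      k ω * z ω * U.1 ω + k ω * S ω * U.2 ω := by
    ext ω
    ring
  filter_upwards [cE_of_integrable (m := 𝓕 t) (h1.add h2), cE_measurable_mul hm hk hl] with ω h3 h4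
  rw [e] at h4
  rw [weightPairing, ← h4]
  exact h3

end IsBoundedWeight

/-- An upward closed convex set that is strictly separated from a point by conditional functionals
is strictly separated from it by a pair of nonnegative densities. -/
theorem exists_densities_of_weights {n : ℕ} {z S : Fin n → Ω → ℝ}
    (hw : ∀ i, IsBoundedWeight (𝓕 t) P (z i) (S i)) {K : Set ((Ω → ℝ) × (Ω → ℝ))}
    (hK : K ⊆ lpTwoStep 𝓕 P ∞ t) (hconv : Convex ℝ K) (hne : K.Nonempty)
    (hup : ∀ U ∈ K, ∀ f g : Ω → ℝ, Measurable[𝓕 t] f → MemLp f ∞ P → (∀ ω, 0 ≤ f ω) →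
      Measurable[𝓕 (t + 1)] g → MemLp g ∞ P → (∀ ω, 0 ≤ g ω) → (U.1 + f, U.2 + g) ∈ K)
    {V : (Ω → ℝ) × (Ω → ℝ)} (hV : V ∈ lpTwoStep 𝓕 P ∞ t) {η : ℝ≥0∞} (hη : η ≠ 0)
    (hfar : ∀ U ∈ K, η ≤ ∑ i, eLpNorm (weightPairing (𝓕 t) P (z i) (S i) U -
      weightPairing (𝓕 t) P (z i) (S i) V) 2 P) :
    ∃ ζ ζ' : Ω → ℝ, Measurable[𝓕 t] ζ ∧ Measurable[𝓕 (t + 1)] ζ' ∧ (∀ ω, 0 ≤ ζ ω) ∧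
      (∀ ω, 0 ≤ ζ' ω) ∧ MemLp ζ 1 P ∧ MemLp ζ' 1 P ∧ ∃ δ : ℝ, 0 < δ ∧ ∀ U ∈ K,
        ∫ ω, ζ ω * V.1 ω ∂P + ∫ ω, ζ' ω * V.2 ω ∂P + δ ≤
          ∫ ω, ζ ω * U.1 ω ∂P + ∫ ω, ζ' ω * U.2 ω ∂P := by
  have hm := 𝓕.le t
  have hm' := 𝓕.le (t + 1)
  -- Functionals on `L^∞` need not have densities in `L¹`. The separation is therefore made between
  -- images in `(L²)ⁿ` under the conditional functionals, and then pulled back.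
  let L : ((Ω → ℝ) × (Ω → ℝ)) → Fin n → Ω → ℝ := fun U i => weightPairing (𝓕 t) P (z i) (S i) U
  have hLm : ∀ U i, Measurable[𝓕 t] (L U i) := fun U i => measurable_cE _ _ _
  let C : Set (Fin n → Ω → ℝ) :=
    {f | (∀ i, Measurable[𝓕 t] (f i)) ∧ ∃ U ∈ K, ∀ i, f i =ᵐ[P] L U i}
  obtain ⟨k, hk, δ, hδ, hsep⟩ := exists_separating_memLp_two (mS := 𝓕 t) (μ := P.trim hm) (C := C)
    (g := L V) (η := η)
    (fun f ⟨hf, U, hU, hfU⟩ i => (memLp_trim_iff hm (hf i)).2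
      (((hw i).memLp_weightPairing (hK hU)).ae_eq (hfU i).symm))
    (by
      rintro f ⟨hf, U, hU, hfU⟩ f' ⟨hf', U', hU', hfU'⟩ a b ha hb hab
      refine ⟨fun i => ((hf i).const_mul a).add ((hf' i).const_mul b), _,
        hconv hU hU' ha hb hab, fun i => ?_⟩
      filter_upwards [hfU i, hfU' i, (hw i).weightPairing_convexComb (hK hU) (hK hU') a b]
        with ω h1 h2 h3
      refine Eq.trans ?_ h3.symm
      simp [h1, h2, L])
    (fun i => (memLp_trim_iff hm (hLm V i)).2 ((hw i).memLp_weightPairing hV)) hη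
    (fun f ⟨hf, U, hU, hfU⟩ => (hfar U hU).trans_eq (Finset.sum_congr rfl fun i _ => by
      rw [eLpNorm_trim hm ((hf i).sub (hLm V i)).stronglyMeasurable]
      exact eLpNorm_congr_ae ((hfU i).symm.sub EventuallyEq.rfl)))
  have hki : ∀ i, Integrable (k i) P := fun i =>
    (memLp_of_memLp_trim hm (hk i).2).integrable one_le_two
  have hkS : ∀ i, Integrable (fun ω => k i ω * S i ω) P := fun i =>
    (hw i).integrable_mul (hk i).1 (hki i)
  have hkz : ∀ i, Integrable (fun ω => k i ω * z i ω) P := fun i =>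
    (hki i).mul_bdd (c := 1) ((hw i).measurable_fst.mono hm le_rfl).aestronglyMeasurable
      (ae_of_all _ (hw i).abs_fst_le)
  -- The pull-back multiplies the weights by the Riesz vectors. The second weights need not be
  -- 𝓕_{t+1}-measurable, so they are projected by a conditional expectation, which does not change
  -- integrals against 𝓕_{t+1}-measurable bounded variables.
  let ξ : Ω → ℝ := fun ω => ∑ i, k i ω * z i ω
  let ξ' : Ω → ℝ := P[fun ω => ∑ i, k i ω * S i ω|𝓕 (t + 1)]
  have hξ : Measurable[𝓕 t] ξ := Finset.measurable_fun_sum _ fun i _ =>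
    (hk i).1.mul (hw i).measurable_fst
  have hξi : Integrable ξ P := integrable_finsetSum _ fun i _ => hkz i
  have hξ' : Measurable[𝓕 (t + 1)] ξ' := stronglyMeasurable_condExp.measurable
  have hξi' : Integrable ξ' P := integrable_condExp
  have hkSi : Integrable (fun ω => ∑ i, k i ω * S i ω) P := integrable_finsetSum _ fun i _ => hkS i
  have hint : ∀ U ∈ lpTwoStep 𝓕 P ∞ t, ∑ i, ∫ ω, k i ω * L U i ω ∂P.trim hm =
      ∫ ω, ξ ω * U.1 ω ∂P + ∫ ω, ξ' ω * U.2 ω ∂P := fun U hU => by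
    have h1 : ∀ i, ∫ ω, k i ω * L U i ω ∂P.trim hm =
        ∫ ω, k i ω * z i ω * U.1 ω ∂P + ∫ ω, k i ω * S i ω * U.2 ω ∂P := fun i => by
      rw [← (hw i).integral_mul_weightPairing hU (hk i).1 (hki i)]
      exact (integral_trim hm ((hk i).1.mul (hLm U i)).stronglyMeasurable).symm
    have h2 : ∫ ω, ξ' ω * U.2 ω ∂P = ∫ ω, (∑ i, k i ω * S i ω) * U.2 ω ∂P := by
      rw [← integral_condExp hm' (f := fun ω => (∑ i, k i ω * S i ω) * U.2 ω)]
      exact integral_congr_ae (condExp_mul_of_stronglyMeasurable_right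
        hU.2.2.1.stronglyMeasurable (hkSi.mul_of_top_left hU.2.2.2) hkSi).symm
    simp only [h1, h2, Finset.sum_add_distrib, ξ, Finset.sum_mul]
    rw [integral_finsetSum _ fun i _ => (hkz i).fun_mul_memLp_top hU.2.1,
      integral_finsetSum _ fun i _ => (hkS i).fun_mul_memLp_top hU.2.2.2]
  have hsep' : ∀ U ∈ K, ∫ ω, ξ ω * V.1 ω ∂P + ∫ ω, ξ' ω * V.2 ω ∂P + δ ≤
      ∫ ω, ξ ω * U.1 ω ∂P + ∫ ω, ξ' ω * U.2 ω ∂P := fun U hU => by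
    rw [← hint V hV, ← hint U (hK hU)]
    exact hsep (L U) ⟨hLm U, U, hU, fun i => EventuallyEq.rfl⟩
  obtain ⟨U₀, hU₀⟩ := hne
  -- A nonnegative pair with negative value, added `N` times to `U₀`, would stay in `K` and violate
  -- the separation for large `N`.
  have hpos : ∀ f g : Ω → ℝ, Measurable[𝓕 t] f → MemLp f ∞ P → (∀ ω, 0 ≤ f ω) →
      Measurable[𝓕 (t + 1)] g → MemLp g ∞ P → (∀ ω, 0 ≤ g ω) →
      0 ≤ ∫ ω, ξ ω * f ω ∂P + ∫ ω, ξ' ω * g ω ∂P := fun f g hf hfp hf0 hg hgp hg0 => by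
    by_contra hneg
    push Not at hneg
    set r := ∫ ω, ξ ω * f ω ∂P + ∫ ω, ξ' ω * g ω ∂P with hr
    set r₀ := ∫ ω, ξ ω * U₀.1 ω ∂P + ∫ ω, ξ' ω * U₀.2 ω ∂P with hr₀
    set r₁ := ∫ ω, ξ ω * V.1 ω ∂P + ∫ ω, ξ' ω * V.2 ω ∂P
    obtain ⟨N, hN⟩ := exists_nat_gt ((r₀ - r₁) / (-r))
    rw [div_lt_iff₀ (neg_pos.2 hneg)] at hN
    have h1 := hsep' _ (hup U₀ hU₀ (fun ω => N * f ω) (fun ω => N * g ω) (hf.const_mul _)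
      (hfp.const_mul _) (fun ω => mul_nonneg N.cast_nonneg (hf0 ω)) (hg.const_mul _)
      (hgp.const_mul _) fun ω => mul_nonneg N.cast_nonneg (hg0 ω))
    have e1 : ∫ ω, ξ ω * (U₀.1 + fun ω => N * f ω) ω ∂P =
        ∫ ω, ξ ω * U₀.1 ω ∂P + N * ∫ ω, ξ ω * f ω ∂P := by
      rw [← integral_const_mul, ← integral_add (hξi.fun_mul_memLp_top (hK hU₀).2.1)
        ((hξi.fun_mul_memLp_top hfp).const_mul _)]
      refine integral_congr_ae (ae_of_all _ fun ω => ?_)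
      simp
      ring
    have e2 : ∫ ω, ξ' ω * (U₀.2 + fun ω => N * g ω) ω ∂P =
        ∫ ω, ξ' ω * U₀.2 ω ∂P + N * ∫ ω, ξ' ω * g ω ∂P := by
      rw [← integral_const_mul, ← integral_add (hξi'.fun_mul_memLp_top (hK hU₀).2.2.2)
        ((hξi'.fun_mul_memLp_top hgp).const_mul _)]
      refine integral_congr_ae (ae_of_all _ fun ω => ?_)
      simp
      ring
    simp only [e1, e2] at h1
    nlinarith
  have hξ0 : ∀ᵐ ω ∂P, 0 ≤ ξ ω := ae_nonneg_of_integral_mul_nonneg hm hξ hξi fun f hf hfp hf0 => by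
    simpa using hpos f (fun _ => 0) hf hfp hf0 measurable_const MemLp.zero' fun _ => le_rfl
  have hξ0' : ∀ᵐ ω ∂P, 0 ≤ ξ' ω := ae_nonneg_of_integral_mul_nonneg hm' hξ' hξi' fun f hf hfp hf0 => by
    simpa using hpos (fun _ => 0) f measurable_const MemLp.zero' (fun _ => le_rfl) hf hfp hf0
  have hmax : ∀ {ψ : Ω → ℝ}, (∀ᵐ ω ∂P, 0 ≤ ψ ω) → ∀ f : Ω → ℝ,
      ∫ ω, max (ψ ω) 0 * f ω ∂P = ∫ ω, ψ ω * f ω ∂P := fun hψ f => by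
    refine integral_congr_ae ?_
    filter_upwards [hψ] with ω hω
    rw [max_eq_left hω]
  refine ⟨fun ω => max (ξ ω) 0, fun ω => max (ξ' ω) 0, hξ.max measurable_const,
    hξ'.max measurable_const, fun ω => le_max_right _ _, fun ω => le_max_right _ _,
    memLp_one_iff_integrable.2 hξi.pos_part, memLp_one_iff_integrable.2 hξi'.pos_part, δ, hδ,
    fun U hU => ?_⟩
  simp only [hmax hξ0, hmax hξ0']
  exact hsep' U hU

/-- Closedness gives finitely many `Z i` and a radius `ε` whose weak neighbourhood of `V` misses the
superlevel set. On two-step positions `Z i` acts through the weights `Z_t` and `∑_{s > t} Z_s`. If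
the images of the superlevel set came close to that of `V` in `L²`, pasting would produce an element
of the neighbourhood; so the images are apart and `exists_densities_of_weights` applies. -/
theorem exists_densities_of_eq_top (hφ : IsUSCAssessmentIndex 𝓕 P T ∞ t φ) (ht : t < T)
    (hh : Measurable[𝓕 t] h) (hne : (superlevel 𝓕 P ∞ t φ h).Nonempty)
    {V : (Ω → ℝ) × (Ω → ℝ)}
    (hV : V ∈ lpTwoStep 𝓕 P ∞ t) (hVh : ¬ h ≤ᵐ[P] φ (twoPos t V.1 V.2)) :
    ∃ ζ ζ' : Ω → ℝ, Measurable[𝓕 t] ζ ∧ Measurable[𝓕 (t + 1)] ζ' ∧ (∀ ω, 0 ≤ ζ ω) ∧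
      (∀ ω, 0 ≤ ζ' ω) ∧ MemLp ζ 1 P ∧ MemLp ζ' 1 P ∧ ∃ δ : ℝ, 0 < δ ∧
        ∀ U ∈ superlevel 𝓕 P ∞ t φ h,
          ∫ ω, ζ ω * V.1 ω ∂P + ∫ ω, ζ' ω * V.2 ω ∂P + δ ≤
            ∫ ω, ζ ω * U.1 ω ∂P + ∫ ω, ζ' ω * U.2 ω ∂P := by
  have hm := 𝓕.le t
  have hp1 : (1 : ℝ≥0∞) ≤ ∞ := le_top
  have hVm := memTwoStep_of_mem_lpTwoStep hp1 hV
  obtain ⟨n, Z, hZ, ε, hε, hε0, hno⟩ : ∃ (n : ℕ) (Z : Fin n → ℕ → Ω → ℝ),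
      (∀ i, MemFuture 𝓕 P T 1 t (Z i)) ∧ ∃ ε : Ω → ℝ, Measurable[𝓕 t] ε ∧ (∀ ω, 0 < ε ω) ∧
      ∀ U, h ≤ᵐ[P] φ U → MemFuture 𝓕 P T ∞ t U →
        ¬ ∀ i, ∀ᵐ ω ∂P, |pairing 𝓕 P T t (Z i) (fun s ω => U s ω - twoPos t V.1 V.2 s ω) ω| ≤ ε ω := by
    by_contra hcon
    push Not at hcon
    refine hVh (hφ.usc h hh _ (memFuture_twoPos hp1 hVm) (fun hp => absurd rfl hp)
      fun _ n Z hZ ε hε hε0 => ?_)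
    obtain ⟨U, h1, h2, h3⟩ := hcon n Z hZ ε hε hε0
    exact ⟨U, h1, h2, h3⟩
  simp only [memFuture_iff le_rfl] at hZ
  let z : Fin n → Ω → ℝ := fun i => Z i t
  let S : Fin n → Ω → ℝ := fun i ω => ∑ s ∈ Finset.Ioc t T, Z i s ω
  have hz : ∀ i, Measurable[𝓕 t] (z i) := fun i => (hZ i t le_rfl ht.le).1
  have hZs : ∀ i, ∀ s ∈ Finset.Ioc t T, Measurable[𝓕 s] (Z i s) ∧ LocLp (𝓕 t) P 1 (Z i s) :=
    fun i s hs => hZ i s (Finset.mem_Ioc.1 hs).1.le (Finset.mem_Ioc.1 hs).2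
  have hS : ∀ i, Measurable[m0] (S i) := fun i => Finset.measurable_fun_sum _ fun s hs =>
    (hZs i s hs).1.mono (𝓕.le s) le_rfl
  have hSl : ∀ i, LocLp (𝓕 t) P 1 (S i) := fun i => LocLp.sum hm _ fun s hs => (hZs i s hs).2
  -- Division by this common 𝓕ₜ-measurable factor makes the functionals send bounded positions to
  -- bounded variables, hence into `L²`; the radius is rescaled to `ε / κ`.
  let κ : Ω → ℝ := fun ω => 1 + ∑ i, (|z i ω| + |cE (𝓕 t) P (fun ω => |S i ω|) ω|)
  have habs : Measurable fun r : ℝ => |r| := continuous_abs.measurable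
  have hκ : Measurable[𝓕 t] κ := Measurable.add measurable_const
    (Finset.measurable_fun_sum _ fun i _ => (habs.comp (hz i)).add
      (habs.comp (measurable_cE (𝓕 t) P (fun ω => |S i ω|))))
  have hκi : ∀ i ω, |z i ω| + |cE (𝓕 t) P (fun ω => |S i ω|) ω| ≤ κ ω := fun i ω =>
    (Finset.single_le_sum (f := fun i => |z i ω| + |cE (𝓕 t) P (fun ω => |S i ω|) ω|)
      (fun _ _ => by positivity) (Finset.mem_univ i)).trans (le_add_of_nonneg_left zero_le_one)
  have hκ0 : ∀ ω, 0 < κ ω := fun ω => by positivity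
  let z' : Fin n → Ω → ℝ := fun i ω => (κ ω)⁻¹ * z i ω
  let S' : Fin n → Ω → ℝ := fun i ω => (κ ω)⁻¹ * S i ω
  have hκinv : Measurable[𝓕 t] fun ω => (κ ω)⁻¹ := hκ.inv
  have hw : ∀ i, IsBoundedWeight (𝓕 t) P (z' i) (S' i) := fun i =>
    { measurable_fst := hκinv.mul (hz i)
      abs_fst_le := fun ω => by
        rw [abs_mul, abs_of_pos (inv_pos.2 (hκ0 ω)), inv_mul_le_iff₀ (hκ0 ω), mul_one]
        exact (le_add_of_nonneg_right (abs_nonneg _)).trans (hκi i ω)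
      measurable_snd := (hκinv.mono hm le_rfl).mul (hS i)
      locLp_snd := (hSl i).measurable_mul hm hκinv
      cE_abs_snd_le := by
        have e : (fun ω => |S' i ω|) = fun ω => (κ ω)⁻¹ * |S i ω| := funext fun ω => by
          rw [abs_mul, abs_of_pos (inv_pos.2 (hκ0 ω))]
        rw [e]
        filter_upwards [cE_measurable_mul hm hκinv (hSl i).abs] with ω hω
        rw [hω, inv_mul_le_iff₀ (hκ0 ω), mul_one]
        exact (le_abs_self _).trans ((le_add_of_nonneg_left (abs_nonneg _)).trans (hκi i ω)) }
  have hpair : ∀ (U : (Ω → ℝ) × (Ω → ℝ)) i,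
      pairing 𝓕 P T t (Z i) (fun s ω => twoPos t U.1 U.2 s ω - twoPos t V.1 V.2 s ω) =
      cE (𝓕 t) P fun ω => z i ω * (U.1 ω - V.1 ω) + S i ω * (U.2 ω - V.2 ω) := fun U i => by
    refine congrArg (cE (𝓕 t) P) (funext fun ω => ?_)
    rw [← Finset.sum_Ioc_add_eq_sum_Icc ht.le, add_comm]
    simp only [S, Finset.sum_mul]
    congr 1
    · simp [twoPos, z]
    · refine Finset.sum_congr rfl fun s hs => ?_
      simp [twoPos, (Finset.mem_Ioc.1 hs).1.ne']
  have hcE : ∀ U ∈ lpTwoStep 𝓕 P ∞ t, ∀ i, ∀ᵐ ω ∂P,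
      cE (𝓕 t) P (fun ω => z i ω * (U.1 ω - V.1 ω) + S i ω * (U.2 ω - V.2 ω)) ω =
      κ ω * (weightPairing (𝓕 t) P (z' i) (S' i) U ω - weightPairing (𝓕 t) P (z' i) (S' i) V ω) :=
    fun U hU i => by
      have hD : (1 : ℝ) • U + (-1 : ℝ) • V ∈ lpTwoStep 𝓕 P ∞ t :=
        ⟨(hU.1.const_smul _).add (hV.1.const_smul _), (hU.2.1.const_smul _).add (hV.2.1.const_smul _),
          (hU.2.2.1.const_smul _).add (hV.2.2.1.const_smul _),
          (hU.2.2.2.const_smul _).add (hV.2.2.2.const_smul _)⟩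
      have e : (fun ω => z i ω * (U.1 ω - V.1 ω) + S i ω * (U.2 ω - V.2 ω)) = fun ω =>
          κ ω * (z' i ω * ((1 : ℝ) • U + (-1 : ℝ) • V).1 ω +
            S' i ω * ((1 : ℝ) • U + (-1 : ℝ) • V).2 ω) := funext fun ω => by
        have := (hκ0 ω).ne'
        simp [z', S']
        field_simp
        ring
      have hl : LocLp (𝓕 t) P 1 fun ω => z' i ω * ((1 : ℝ) • U + (-1 : ℝ) • V).1 ω +
            S' i ω * ((1 : ℝ) • U + (-1 : ℝ) • V).2 ω :=
        LocLp.add hm (.of_measurable hm ((hw i).measurable_fst.mul hD.1))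
          (locLp_one_mul_of_memLp_top hm (hw i).locLp_snd hD.2.2.2)
      filter_upwards [cE_measurable_mul hm hκ hl, (hw i).weightPairing_convexComb hU hV 1 (-1)]
        with ω h1 h2
      rw [e, h1]
      unfold weightPairing at h2 ⊢
      rw [h2]
      simp [sub_eq_add_neg]
  obtain ⟨η, hη, hfar⟩ : ∃ η : ℝ≥0∞, η ≠ 0 ∧ ∀ U ∈ superlevel 𝓕 P ∞ t φ h,
      η ≤ ∑ i, eLpNorm (weightPairing (𝓕 t) P (z' i) (S' i) U -
        weightPairing (𝓕 t) P (z' i) (S' i) V) 2 P := by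
    by_contra hcon
    push Not at hcon
    have hwm : ∀ U i, Measurable[𝓕 t] fun ω => ‖weightPairing (𝓕 t) P (z' i) (S' i) U ω -
        weightPairing (𝓕 t) P (z' i) (S' i) V ω‖ₑ := fun U i =>
      measurable_enorm.comp ((measurable_cE (𝓕 t) P _).sub (measurable_cE (𝓕 t) P _))
    obtain ⟨U, hU, j, hj, hjd⟩ := exists_index_le (P := P) (K := superlevel 𝓕 P ∞ t φ h)
      (d := fun U ω => ∑ i, ‖weightPairing (𝓕 t) P (z' i) (S' i) U ω -
        weightPairing (𝓕 t) P (z' i) (S' i) V ω‖ₑ)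
      (fun U _ => Finset.measurable_fun_sum _ fun i _ => hwm U i)
      (fun η hη => by
        obtain ⟨U, hU, hlt⟩ := hcon η hη
        refine ⟨U, hU, lt_of_le_of_lt ?_ hlt⟩
        rw [lintegral_finsetSum _ fun i _ => (hwm U i).mono hm le_rfl]
        refine Finset.sum_le_sum fun i _ => ?_
        have := eLpNorm_le_eLpNorm_of_exponent_le (μ := P) (one_le_two (α := ℝ≥0∞))
          (f := weightPairing (𝓕 t) P (z' i) (S' i) U - weightPairing (𝓕 t) P (z' i) (S' i) V)
          (((measurable_cE _ _ _).mono hm le_rfl).sub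
            ((measurable_cE _ _ _).mono hm le_rfl)).aestronglyMeasurable
        rwa [eLpNorm_one_eq_lintegral_enorm] at this)
      (ε := fun ω => ENNReal.ofReal ((κ ω)⁻¹ * ε ω)) (hκinv.mul hε).ennreal_ofReal
      fun ω => (ENNReal.ofReal_pos.2 (mul_pos (inv_pos.2 (hκ0 ω)) (hε0 ω))).ne'
    have hUm := fun n => memTwoStep_of_mem_lpTwoStep hp1 (hU n).1
    refine hno _ ?_ (memFuture_twoPos hp1 (MemTwoStep.concat hp1 hj hUm)) fun i => ?_
    · filter_upwards [hφ.concat_twoPos hp1 hj hUm, ae_all_iff.2 fun n => (hU n).2] with ω h1 h2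
      exact (h2 (j ω)).trans_eq h1.symm
    · rw [hpair (fun ω => (U (j ω)).1 ω, fun ω => (U (j ω)).2 ω) i]
      refine ae_of_index j fun l => ?_
      filter_upwards [hcE (U l) (hU l).1 i, hjd, cE_congr_on (P := P) hm (measurableSet_index hj l)
        (f := fun ω => z i ω * ((U (j ω)).1 ω - V.1 ω) + S i ω * ((U (j ω)).2 ω - V.2 ω))
        (g := fun ω => z i ω * ((U l).1 ω - V.1 ω) + S i ω * ((U l).2 ω - V.2 ω))
        (ae_of_all _ fun ω hω => by
          have hω : j ω = l := hω
          rw [hω])] with ω h1 h2 h3 hl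
      rw [hl] at h2
      have h4 := (Finset.single_le_sum (f := fun i => ‖weightPairing (𝓕 t) P (z' i) (S' i) (U l) ω -
        weightPairing (𝓕 t) P (z' i) (S' i) V ω‖ₑ) (fun _ _ => zero_le) (Finset.mem_univ i)).trans h2
      rw [Real.enorm_eq_ofReal_abs, ENNReal.ofReal_le_ofReal_iff
        (mul_pos (inv_pos.2 (hκ0 ω)) (hε0 ω)).le, le_inv_mul_iff₀ (hκ0 ω)] at h4
      refine (congrArg abs ((h3 hl).trans h1)).trans_le ?_
      rw [abs_mul, abs_of_pos (hκ0 ω)]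
      exact h4
  exact exists_densities_of_weights hw (fun U hU => hU.1) (hφ.convex_superlevel hp1) hne
    (fun U hU f g hf hfp hf0 hg hgp hg0 => hφ.add_mem_superlevel hp1 hU hf hfp hf0 hg hgp hg0)
    hV hη hfar

end SeparationTop

/-! ### Localization of the separating functional -/

section Localization

variable {Ω : Type*} {m0 : MeasurableSpace Ω} {𝓕 : Filtration ℕ m0} {P : Measure Ω}
  {T t : ℕ} {p q : ℝ≥0∞} {φ : (ℕ → Ω → ℝ) → Ω → EReal}
  {h : Ω → EReal} {x Y ζ ζ' : Ω → ℝ} {U U' V V' : (Ω → ℝ) × (Ω → ℝ)} {a : ℝ} {A : Set Ω}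

/-- The conditional difference of the values of two positions under the densities `ζ`, `ζ'`. -/
noncomputable def condGap (m : MeasurableSpace Ω) {m0 : MeasurableSpace Ω} (P : Measure Ω)
    (ζ ζ' : Ω → ℝ) (V U : (Ω → ℝ) × (Ω → ℝ)) : Ω → ℝ := fun ω =>
  ζ ω * (U.1 ω - V.1 ω) + cE m P (fun ω => ζ' ω * (U.2 ω - V.2 ω)) ω

theorem measurable_condGap (hζ : Measurable[𝓕 t] ζ) (hV : Measurable[𝓕 t] V.1)
    (hU : Measurable[𝓕 t] U.1) : Measurable[𝓕 t] (condGap (𝓕 t) P ζ ζ' V U) :=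
  (hζ.mul (hU.sub hV)).add (measurable_cE _ _ _)

variable [IsProbabilityMeasure P]

theorem exists_densities [ENNReal.HolderConjugate p q]
    (hφ : IsUSCAssessmentIndex 𝓕 P T p t φ) (ht : t < T)
    (hh : Measurable[𝓕 t] h) (hne : (superlevel 𝓕 P p t φ h).Nonempty)
    (hV : V ∈ lpTwoStep 𝓕 P p t) (hVh : ¬ h ≤ᵐ[P] φ (twoPos t V.1 V.2)) :
    ∃ ζ ζ' : Ω → ℝ, Measurable[𝓕 t] ζ ∧ Measurable[𝓕 (t + 1)] ζ' ∧ (∀ ω, 0 ≤ ζ ω) ∧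
      (∀ ω, 0 ≤ ζ' ω) ∧ MemLp ζ q P ∧ MemLp ζ' q P ∧ ∃ δ : ℝ, 0 < δ ∧
        ∀ U ∈ superlevel 𝓕 P p t φ h,
          ∫ ω, ζ ω * V.1 ω ∂P + ∫ ω, ζ' ω * V.2 ω ∂P + δ ≤
            ∫ ω, ζ ω * U.1 ω ∂P + ∫ ω, ζ' ω * U.2 ω ∂P := by
  rcases eq_or_ne p ∞ with rfl | hp
  · obtain rfl : q = 1 := (ENNReal.HolderConjugate.eq_top_iff_eq_one ∞ q).1 rfl
    exact exists_densities_of_eq_top hφ ht hh hne hV hVh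
  · exact exists_densities_of_ne_top hφ hp hh hne hV hVh

/-- The position that equals `(x, Y)` on `A` and `(a, a)` off `A`. -/
noncomputable def cutPos (A : Set Ω) (a : ℝ) (x Y : Ω → ℝ) : (Ω → ℝ) × (Ω → ℝ) :=
  (A.indicator x + Aᶜ.indicator fun _ => a, A.indicator Y + Aᶜ.indicator fun _ => a)

theorem cutPos_of_mem {ω : Ω} (hω : ω ∈ A) :
    (cutPos A a x Y).1 ω = x ω ∧ (cutPos A a x Y).2 ω = Y ω := by
  simp [cutPos, hω]

theorem cutPos_of_notMem {ω : Ω} (hω : ω ∉ A) :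
    (cutPos A a x Y).1 ω = a ∧ (cutPos A a x Y).2 ω = a := by
  simp [cutPos, hω]

theorem twoPos_const : twoPos t (fun _ : Ω => a) (fun _ => a) = cash fun _ => a := by
  ext s ω
  simp [twoPos, cash]

theorem const_mem_lpTwoStep (a : ℝ) :
    ((fun _ => a, fun _ => a) : (Ω → ℝ) × (Ω → ℝ)) ∈ lpTwoStep 𝓕 P p t :=
  ⟨measurable_const, memLp_const a, measurable_const, memLp_const a⟩

/-- A two-step position is in `Lᵖ × Lᵖ` on the pieces of a countable `𝓕ₜ`-measurable cover. -/
theorem exists_cutPos_cover (hp : 1 ≤ p) (hxY : MemTwoStep 𝓕 P p t x Y) (a : ℝ) :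
    ∃ D : ℕ → Set Ω, (∀ n, MeasurableSet[𝓕 t] (D n)) ∧ (∀ ω, ∃ n, ω ∈ D n) ∧
      ∀ n, ∀ C ⊆ D n, MeasurableSet[𝓕 t] C → cutPos C a x Y ∈ lpTwoStep 𝓕 P p t := by
  have hm := 𝓕.le t
  have hxY' := (memTwoStep_iff hp).1 hxY
  obtain ⟨k, hk, hkY⟩ := hxY'.2.2
  obtain ⟨k', hk', hkx⟩ := LocLp.of_measurable (P := P) (p := p) (𝓕.le t) hxY.1
  refine ⟨fun n => {ω | k ω ≤ n} ∩ {ω | k' ω ≤ n}, fun n =>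
    (measurableSet_index_le hk n).inter (measurableSet_index_le hk' n), fun ω =>
    ⟨max (k ω) (k' ω), le_max_left (k ω) (k' ω), le_max_right (k ω) (k' ω)⟩, fun n C hC hCm => ?_⟩
  have hmem : ∀ {f : Ω → ℝ} {s : Set Ω}, C ⊆ s → MemLp (s.indicator f) p P →
      MemLp (C.indicator f + Cᶜ.indicator fun _ => a) p P := fun {f s} hs hf => by
    have e : C.indicator f = C.indicator (s.indicator f) := by
      rw [Set.indicator_indicator, Set.inter_eq_left.2 hs]
    rw [e]
    exact (hf.indicator (hm _ hCm)).add ((memLp_const a).indicator (hm _ hCm).compl)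
  exact ⟨(hxY.1.indicator hCm).add (measurable_const.indicator hCm.compl),
    hmem (fun ω hω => (hC hω).2) (hkx n),
    (hxY.2.1.indicator (𝓕.mono t.le_succ _ hCm)).add
      (measurable_const.indicator (𝓕.mono t.le_succ _ hCm).compl),
    hmem (fun ω hω => (hC hω).1) (hkY n)⟩

theorem IsUSCAssessmentIndex.cutPos_eq (hφ : IsUSCAssessmentIndex 𝓕 P T p t φ) (hp : 1 ≤ p)
    (hA : MeasurableSet[𝓕 t] A) (hxY : MemTwoStep 𝓕 P p t x Y)
    (hc : cutPos A a x Y ∈ lpTwoStep 𝓕 P p t) :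
    (∀ᵐ ω ∂P, ω ∈ A →
      φ (twoPos t (cutPos A a x Y).1 (cutPos A a x Y).2) ω = φ (twoPos t x Y) ω) ∧
    ∀ᵐ ω ∂P, ω ∉ A →
      φ (twoPos t (cutPos A a x Y).1 (cutPos A a x Y).2) ω = φ (cash fun _ => a) ω := by
  have hc' := memFuture_twoPos (T := T) hp (memTwoStep_of_mem_lpTwoStep hp hc)
  refine ⟨hφ.localProp _ _ hc' (memFuture_twoPos hp hxY) A hA fun s _ _ => ae_of_all _ fun ω hω => ?_,
    hφ.localProp _ _ hc' (memFuture_cash hp measurable_const) Aᶜ hA.compl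
      fun s _ _ => ae_of_all _ fun ω hω => ?_⟩
  · by_cases hs : s = t <;> simp [twoPos, hs, cutPos_of_mem hω]
  · by_cases hs : s = t <;> simp [twoPos, cash, hs, cutPos_of_notMem hω]

theorem condGap_congr_on (hA : MeasurableSet[𝓕 t] A)
    (hU : ∀ ω ∈ A, U.1 ω = U'.1 ω ∧ U.2 ω = U'.2 ω) (hV : ∀ ω ∈ A, V.1 ω = V'.1 ω ∧ V.2 ω = V'.2 ω) :
    ∀ᵐ ω ∂P, ω ∈ A → condGap (𝓕 t) P ζ ζ' V U ω = condGap (𝓕 t) P ζ ζ' V' U' ω := by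
  filter_upwards [cE_congr_on (P := P) (𝓕.le t) hA (f := fun ω => ζ' ω * (U.2 ω - V.2 ω))
    (g := fun ω => ζ' ω * (U'.2 ω - V'.2 ω)) (ae_of_all _ fun ω hω => by
      rw [(hU ω hω).2, (hV ω hω).2])] with ω h1 hω
  rw [condGap, h1 hω, (hU ω hω).1, (hV ω hω).1]
  rfl

theorem condGap_self : condGap (𝓕 t) P ζ ζ' V V =ᵐ[P] fun _ => 0 := by
  filter_upwards [cE_of_measurable (P := P) (𝓕.le t) (measurable_const (a := (0 : ℝ)))] with ω hω
  simp only [condGap, sub_self, mul_zero, zero_add]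
  exact hω

theorem condGap_index {j : Ω → ℕ} (hj : Measurable[𝓕 t] j) (U : ℕ → (Ω → ℝ) × (Ω → ℝ)) :
    ∀ᵐ ω ∂P, condGap (𝓕 t) P ζ ζ' V (fun ω => (U (j ω)).1 ω, fun ω => (U (j ω)).2 ω) ω =
      condGap (𝓕 t) P ζ ζ' V (U (j ω)) ω := ae_of_index j fun n => by
  filter_upwards [condGap_congr_on (P := P) (ζ := ζ) (ζ' := ζ') (V := V) (V' := V)
    (U := (fun ω => (U (j ω)).1 ω, fun ω => (U (j ω)).2 ω)) (U' := U n) (measurableSet_index hj n)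
    (fun ω hω => by
      have hω : j ω = n := hω
      simp [hω]) fun ω _ => ⟨rfl, rfl⟩] with ω h1 hn
  rw [h1 hn, hn]

variable [ENNReal.HolderConjugate p q]

theorem condGap_eq (hp : 1 ≤ p) (hζ' : LocLp (𝓕 t) P q ζ') (hV : MemTwoStep 𝓕 P p t V.1 V.2)
    (hU : MemTwoStep 𝓕 P p t U.1 U.2) :
    condGap (𝓕 t) P ζ ζ' V U =ᵐ[P] fun ω =>
      ζ ω * U.1 ω + cE (𝓕 t) P (fun ω => ζ' ω * U.2 ω) ω -
        (ζ ω * V.1 ω + cE (𝓕 t) P (fun ω => ζ' ω * V.2 ω) ω) := by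
  have : ENNReal.HolderConjugate q p := .symm
  have hl : ∀ {U : (Ω → ℝ) × (Ω → ℝ)}, MemTwoStep 𝓕 P p t U.1 U.2 →
      LocLp (𝓕 t) P 1 fun ω => ζ' ω * U.2 ω := fun hU =>
    hζ'.mul (𝓕.le t) ((memTwoStep_iff hp).1 hU).2.2
  filter_upwards [cE_sub (𝓕.le t) (hl hU) (hl hV)] with ω hω
  simp only [condGap, mul_sub, hω]
  ring

theorem integral_condGap (hζ : MemLp ζ q P) (hζ' : MemLp ζ' q P) (hV : V ∈ lpTwoStep 𝓕 P p t)
    (hU : U ∈ lpTwoStep 𝓕 P p t) :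
    Integrable (condGap (𝓕 t) P ζ ζ' V U) P ∧ ∫ ω, condGap (𝓕 t) P ζ ζ' V U ω ∂P =
      ∫ ω, ζ ω * U.1 ω ∂P + ∫ ω, ζ' ω * U.2 ω ∂P -
        (∫ ω, ζ ω * V.1 ω ∂P + ∫ ω, ζ' ω * V.2 ω ∂P) := by
  have hm := 𝓕.le t
  have : ENNReal.HolderConjugate q p := .symm
  have hi : ∀ {f g : Ω → ℝ}, MemLp f q P → MemLp g p P → Integrable (fun ω => f ω * g ω) P :=
    fun hf hg => hf.integrable_mul hg
  have h1 : Integrable (fun ω => ζ ω * (U.1 ω - V.1 ω)) P := hi hζ (hU.2.1.sub hV.2.1)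
  have h2 : Integrable (fun ω => ζ' ω * (U.2 ω - V.2 ω)) P := hi hζ' (hU.2.2.2.sub hV.2.2.2)
  have h3 := cE_of_integrable (m := 𝓕 t) h2
  have h4 : Integrable (cE (𝓕 t) P fun ω => ζ' ω * (U.2 ω - V.2 ω)) P :=
    integrable_condExp.congr h3.symm
  refine ⟨h1.add h4, ?_⟩
  have e : ∫ ω, condGap (𝓕 t) P ζ ζ' V U ω ∂P =
      ∫ ω, ζ ω * (U.1 ω - V.1 ω) ∂P + ∫ ω, ζ' ω * (U.2 ω - V.2 ω) ∂P := by
    rw [← integral_condExp hm (f := fun ω => ζ' ω * (U.2 ω - V.2 ω)), ← integral_congr_ae h3]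
    exact integral_add h1 h4
  simp only [e, mul_sub]
  rw [integral_sub (hi hζ hU.2.1) (hi hζ hV.2.1), integral_sub (hi hζ' hU.2.2.2) (hi hζ' hV.2.2.2)]
  ring

end Localization

/-! ### From separation in the mean to conditional separation -/

section LocalSeparation

variable {Ω : Type*} {m0 : MeasurableSpace Ω} {𝓕 : Filtration ℕ m0} {P : Measure Ω}
  [IsProbabilityMeasure P] {T t : ℕ} {p q : ℝ≥0∞} {φ : (ℕ → Ω → ℝ) → Ω → EReal}
  {x Y ζ ζ' : Ω → ℝ} {U V : (Ω → ℝ) × (Ω → ℝ)} {a : ℝ} {A : Set Ω}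
  [ENNReal.HolderConjugate p q]

/-- A strict separation in the mean is a strict conditional separation on a set of positive
probability. -/
theorem exists_pos_of_integral_condGap (hφ : IsUSCAssessmentIndex 𝓕 P T p t φ)
    (hA : MeasurableSet[𝓕 t] A) (hζ : Measurable[𝓕 t] ζ) (hζq : MemLp ζ q P)
    (hζq' : MemLp ζ' q P) (hV : V ∈ lpTwoStep 𝓕 P p t)
    (hVA : ∀ ω, ω ∉ A → V.1 ω = a ∧ V.2 ω = a) {δ : ℝ} (hδ : 0 < δ)
    (hsep : ∀ U ∈ superlevel 𝓕 P p t φ (φ (cash fun _ => a)),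
      δ ≤ ∫ ω, condGap (𝓕 t) P ζ ζ' V U ω ∂P) :
    ∃ B ⊆ A, MeasurableSet[𝓕 t] B ∧ P B ≠ 0 ∧ ∃ g : Ω → ℝ, Measurable[𝓕 t] g ∧ (∀ ω, 0 < g ω) ∧
      ∀ U ∈ superlevel 𝓕 P p t φ (φ (cash fun _ => a)), ∀ᵐ ω ∂P, ω ∈ B →
        g ω ≤ condGap (𝓕 t) P ζ ζ' V U ω := by
  have hp1 : 1 ≤ p := ENNReal.HolderConjugate.one_le p q
  have hm := 𝓕.le t
  set K := superlevel 𝓕 P p t φ (φ (cash fun _ => a)) with hK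
  let c : (Ω → ℝ) × (Ω → ℝ) := (fun _ => a, fun _ => a)
  have hc : c ∈ lpTwoStep 𝓕 P p t := const_mem_lpTwoStep a
  have hcφ : φ (twoPos t c.1 c.2) = φ (cash fun _ => a) := by rw [← twoPos_const (t := t)]
  have hcK : c ∈ K := ⟨hc, by rw [hcφ]⟩
  let G : (Ω → ℝ) × (Ω → ℝ) → Ω → ℝ := condGap (𝓕 t) P ζ ζ' V
  have hGm : ∀ U ∈ lpTwoStep 𝓕 P p t, Measurable[𝓕 t] (G U) := fun U hU =>
    measurable_condGap hζ hV.1 hU.1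
  -- The essential infimum `g` of the conditional gaps over `K` is positive on the `B` sought. Were
  -- `B` null, elements of `K` with gap below `δ / 2` could be pasted on `A`, with cash `a` off `A`,
  -- and the mean gap would fall below `δ`.
  let S : Set (Ω → EReal) := {f | ∃ U ∈ K, f = fun ω => (G U ω : EReal)}
  have hSm : ∀ f ∈ S, Measurable[𝓕 t] f := by
    rintro _ ⟨U, hU, rfl⟩
    exact (hGm U hU.1).coe_real_ereal
  have hg := isEssInf_essInf (P := P) hm hSm
  set g := essInf (𝓕 t) P S
  obtain ⟨r, hr, hrg⟩ := exists_measurable_between (m := 𝓕 t)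
    (measurable_const (a := (0 : EReal))) hg.1
  have hB : MeasurableSet[𝓕 t] (A ∩ {ω | 0 < g ω}) :=
    hA.inter (measurableSet_lt measurable_const hg.1)
  refine ⟨A ∩ {ω | 0 < g ω}, Set.inter_subset_left, hB, fun h0 => ?_, ?_⟩
  · have h0' : ∀ᵐ ω ∂P, ω ∈ A → g ω ≤ 0 := by
      filter_upwards [measure_eq_zero_iff_ae_notMem.1 h0] with ω hω hωA
      exact not_lt.1 fun h => hω ⟨hωA, h⟩
    obtain ⟨f, hfS, hf⟩ := hg.exists_seq_lt hm hSm ⟨_, c, hcK, rfl⟩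
      (h := fun _ => ((δ / 2 : ℝ) : EReal)) measurable_const
    choose U hUK hUf using hfS
    obtain ⟨j, hj, hjA⟩ := exists_measurable_index (m := 𝓕 t) (P := P)
      (B := fun n => {ω | G (U n) ω < δ / 2} ∪ Aᶜ) (fun n =>
        (measurableSet_lt (hGm _ (hUK n).1) measurable_const).union hA.compl) (by
        filter_upwards [hf, h0'] with ω h1 h2
        by_cases hω : ω ∈ A
        · obtain ⟨n, hn⟩ := h1 ((h2 hω).trans_lt (EReal.coe_pos.2 (half_pos hδ)))
          rw [hUf n] at hn
          exact ⟨n, Or.inl (EReal.coe_lt_coe_iff.1 hn)⟩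
        · exact ⟨0, Or.inr hω⟩)
    let U' : ℕ → (Ω → ℝ) × (Ω → ℝ) := fun n => Nat.casesOn n c U
    have hU'K : ∀ n, U' n ∈ K := fun n => by
      cases n with
      | zero => exact hcK
      | succ n => exact hUK n
    classical
    -- Index 0 stands for cash `a`, used off `A` and where `j > N`. The cut at `N` keeps the pasted
    -- position in `Lᵖ` and costs only a tail of the integrable gap of cash `a`, which vanishes as
    -- `N → ∞`.
    let J : ℕ → Ω → ℕ := fun N ω => if ω ∈ A ∧ j ω ≤ N then j ω + 1 else 0
    have hJ : ∀ N, Measurable[𝓕 t] (J N) := fun N =>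
      Measurable.ite (hA.inter (measurableSet_index_le hj N))
        ((measurable_of_countable fun n : ℕ => n + 1).comp hj) measurable_const
    let W : ℕ → (Ω → ℝ) × (Ω → ℝ) := fun N =>
      (fun ω => (U' (J N ω)).1 ω, fun ω => (U' (J N ω)).2 ω)
    have hWK : ∀ N, W N ∈ K := fun N => hφ.concat_mem_superlevel hp1 (hJ N) (N := N + 1)
      (fun ω => by
        simp only [J]
        split_ifs with h
        · exact Nat.succ_le_succ h.2
        · exact Nat.zero_le _) (fun n => (hU'K n).1) (by
        filter_upwards [ae_all_iff.2 fun n => (hU'K n).2] with ω hω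
        exact hω (J N ω))
    -- Off `A` both `V` and cash `a` pay `a`.
    have hGc : ∀ᵐ ω ∂P, ω ∉ A → G c ω = 0 := by
      filter_upwards [condGap_congr_on (P := P) (ζ := ζ) (ζ' := ζ') (U := c) (U' := V) (V := V)
        (V' := V) hA.compl (fun ω hω => ⟨(hVA ω hω).1.symm, (hVA ω hω).2.symm⟩)
        fun ω _ => ⟨rfl, rfl⟩, condGap_self (𝓕 := 𝓕) (t := t) (P := P) (ζ := ζ) (ζ' := ζ') (V := V)]
        with ω h1 h2 hω
      exact (h1 hω).trans h2
    have hle : ∀ N, ∀ᵐ ω ∂P, G (W N) ω ≤ δ / 2 + {ω | N < j ω}.indicator (fun ω => |G c ω|) ω :=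
      fun N => by
        filter_upwards [condGap_index (P := P) (ζ := ζ) (ζ' := ζ') (V := V) (hJ N) U', hjA, hGc]
          with ω h1 h2 h3
        have hn : 0 ≤ {ω | N < j ω}.indicator (fun ω => |G c ω|) ω :=
          Set.indicator_nonneg (fun _ _ => abs_nonneg _) _
        have h1 : G (W N) ω = G (U' (J N ω)) ω := h1
        rw [h1]
        by_cases hω : ω ∈ A
        · by_cases hN : j ω ≤ N
          · have e : J N ω = j ω + 1 := if_pos ⟨hω, hN⟩
            rw [e]
            have h4 : G (U (j ω)) ω < δ / 2 := h2.resolve_right (not_not.2 hω)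
            exact h4.le.trans (le_add_of_nonneg_right hn)
          · have e : J N ω = 0 := if_neg fun h => hN h.2
            rw [e, Set.indicator_of_mem (by exact not_le.1 hN)]
            exact (le_abs_self _).trans (le_add_of_nonneg_left (half_pos hδ).le)
        · have e : J N ω = 0 := if_neg fun h => hω h.1
          rw [e]
          have h4 : G (U' 0) ω = 0 := h3 hω
          rw [h4]
          exact add_nonneg (half_pos hδ).le hn
    have hci := (integral_condGap hζq hζq' hV hc).1
    have hind : ∀ N, MeasurableSet {ω | N < j ω} := fun N =>
      hm _ (measurableSet_lt measurable_const hj)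
    have hlim : Tendsto (fun N => ∫ ω, {ω | N < j ω}.indicator (fun ω => |G c ω|) ω ∂P) atTop
        (nhds (∫ _, (0 : ℝ) ∂P)) := by
      refine tendsto_integral_of_dominated_convergence (fun ω => |G c ω|)
        (fun N => (hci.abs.indicator (hind N)).aestronglyMeasurable) hci.abs
        (fun N => ae_of_all _ fun ω => ?_) (ae_of_all _ fun ω => ?_)
      · refine (norm_indicator_le_norm_self _ _).trans ?_
        simp
      · refine tendsto_const_nhds.congr' ?_
        filter_upwards [eventually_ge_atTop (j ω)] with N hN
        rw [Set.indicator_of_notMem (by exact not_lt.2 hN)]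
    rw [integral_zero] at hlim
    obtain ⟨N, hN⟩ := (hlim.eventually (gt_mem_nhds (half_pos hδ))).exists
    have h1 := hsep _ (hWK N)
    have h2 := integral_mono_ae (integral_condGap hζq hζq' hV (hWK N).1).1
      ((integrable_const (δ / 2)).add (hci.abs.indicator (hind N))) (hle N)
    have h3 : ∫ ω, (δ / 2 + {ω | N < j ω}.indicator (fun ω => |G c ω|) ω) ∂P =
        δ / 2 + ∫ ω, {ω | N < j ω}.indicator (fun ω => |G c ω|) ω ∂P := by
      rw [integral_add (integrable_const _) (hci.abs.indicator (hind N)), integral_const,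
        probReal_univ, one_smul]
    have h4 := (h1.trans h2).trans_eq h3
    linarith
  · classical
    refine ⟨fun ω => if 0 < g ω then r ω else 1,
      Measurable.ite (measurableSet_lt measurable_const hg.1) hr measurable_const,
      fun ω => ?_, fun U hU => ?_⟩
    · by_cases h : 0 < g ω
      · simpa only [h, if_true] using EReal.coe_pos.1 (hrg ω h).1
      · simp only [h, if_false, one_pos]
    · filter_upwards [hg.2.1 _ ⟨U, hU, rfl⟩] with ω h1 h2
      have h2' : 0 < g ω := h2.2
      simp only [h2', if_true]
      exact (EReal.coe_lt_coe_iff.1 ((hrg ω h2').2.trans_le h1)).le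

/-- Conditional separation of a two-step position from the positions that are at least as good as
the cash position `a`. -/
theorem exists_conditional_separation (hφ : IsUSCAssessmentIndex 𝓕 P T p t φ) (ht : t < T)
    (hV : MemTwoStep 𝓕 P p t V.1 V.2) (hA : MeasurableSet[𝓕 t] A) (hPA : P A ≠ 0)
    (hlt : ∀ᵐ ω ∂P, ω ∈ A → φ (twoPos t V.1 V.2) ω < φ (cash fun _ => a) ω) :
    ∃ B ⊆ A, MeasurableSet[𝓕 t] B ∧ P B ≠ 0 ∧ ∃ ζ ζ' : Ω → ℝ, Measurable[𝓕 t] ζ ∧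
      Measurable[𝓕 (t + 1)] ζ' ∧ (∀ ω, 0 ≤ ζ ω) ∧ (∀ ω, 0 ≤ ζ' ω) ∧ MemLp ζ' q P ∧
      ∃ g : Ω → ℝ, Measurable[𝓕 t] g ∧ (∀ ω, 0 < g ω) ∧
        ∀ U : (Ω → ℝ) × (Ω → ℝ), MemTwoStep 𝓕 P p t U.1 U.2 → ∀ᵐ ω ∂P, ω ∈ B →
          φ (cash fun _ => a) ω ≤ φ (twoPos t U.1 U.2) ω →
          g ω ≤ condGap (𝓕 t) P ζ ζ' V U ω := by
  have hp1 : 1 ≤ p := ENNReal.HolderConjugate.one_le p q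
  have hm := 𝓕.le t
  have hcash := memFuture_cash (𝓕 := 𝓕) (P := P) (T := T) hp1
    (measurable_const (a := a) : Measurable[𝓕 t] fun _ : Ω => a)
  have hh := hφ.measurable _ hcash
  -- `V` is in `Lᵖ` only piecewise. Some piece meets `A` in a non-null set; outside this
  -- intersection `V` is replaced by cash `a`.
  obtain ⟨D, hD, hDcov, hDmem⟩ := exists_cutPos_cover hp1 hV a
  obtain ⟨n, hn⟩ : ∃ n, P (A ∩ D n) ≠ 0 := by
    by_contra hcon
    push Not at hcon
    refine hPA (measure_mono_null (fun ω hω => ?_) (measure_iUnion_null hcon))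
    obtain ⟨n, hn⟩ := hDcov ω
    exact Set.mem_iUnion.2 ⟨n, hω, hn⟩
  have hA' : MeasurableSet[𝓕 t] (A ∩ D n) := hA.inter (hD n)
  set V' := cutPos (A ∩ D n) a V.1 V.2
  have hV' : V' ∈ lpTwoStep 𝓕 P p t := hDmem n _ Set.inter_subset_right hA'
  have hφV' := hφ.cutPos_eq hp1 hA' hV hV'
  have hnot : ¬ φ (cash fun _ => a) ≤ᵐ[P] φ (twoPos t V'.1 V'.2) := fun hcon => by
    refine hn (measure_eq_zero_iff_ae_notMem.2 ?_)
    filter_upwards [hcon, hφV'.1, hlt] with ω h1 h2 h3 hω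
    rw [h2 hω] at h1
    exact absurd (h3 hω.1) (not_lt.2 h1)
  have hcK : ((fun _ => a, fun _ => a) : (Ω → ℝ) × (Ω → ℝ)) ∈
      superlevel 𝓕 P p t φ (φ (cash fun _ => a)) :=
    ⟨const_mem_lpTwoStep a, by rw [← twoPos_const (t := t)]⟩
  obtain ⟨ζ, ζ', h1, h2, h3, h4, h5, h6, δ, hδ, hsep⟩ := exists_densities (q := q) hφ ht hh
    ⟨_, hcK⟩ hV' hnot
  obtain ⟨B, hBA, hB, hPB, g, hg, hg0, hgB⟩ := exists_pos_of_integral_condGap hφ hA' h1 h5 h6 hV'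
    (fun ω hω => cutPos_of_notMem hω) hδ fun U hU => by
      rw [(integral_condGap h5 h6 hV' hU.1).2]
      linarith [hsep U hU]
  refine ⟨B, hBA.trans Set.inter_subset_left, hB, hPB, ζ, ζ', h1, h2, h3, h4, h6, g, hg, hg0,
    fun U hU => ?_⟩
  -- A competitor `U` is cut to the set where it is in `Lᵖ` and at least as good as cash `a`;
  -- completed by cash `a`, it belongs to the superlevel set.
  obtain ⟨C, hC, hCcov, hCmem⟩ := exists_cutPos_cover hp1 hU a
  have hφU := hφ.measurable _ (memFuture_twoPos hp1 hU)
  have hE : MeasurableSet[𝓕 t] {ω | φ (cash fun _ => a) ω ≤ φ (twoPos t U.1 U.2) ω} :=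
    measurableSet_le hh hφU
  have hk : ∀ k, ∀ᵐ ω ∂P, ω ∈ B → φ (cash fun _ => a) ω ≤ φ (twoPos t U.1 U.2) ω → ω ∈ C k →
      g ω ≤ condGap (𝓕 t) P ζ ζ' V U ω := fun k => by
    have hF : MeasurableSet[𝓕 t] (C k ∩ {ω | φ (cash fun _ => a) ω ≤ φ (twoPos t U.1 U.2) ω}) :=
      (hC k).inter hE
    have hU' := hCmem k _ Set.inter_subset_left hF
    have hφU' := hφ.cutPos_eq hp1 hF hU hU'
    have hUK : cutPos (C k ∩ {ω | φ (cash fun _ => a) ω ≤ φ (twoPos t U.1 U.2) ω}) a U.1 U.2 ∈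
        superlevel 𝓕 P p t φ (φ (cash fun _ => a)) := ⟨hU', by
      filter_upwards [hφU'.1, hφU'.2] with ω h1 h2
      by_cases hω : ω ∈ C k ∩ {ω | φ (cash fun _ => a) ω ≤ φ (twoPos t U.1 U.2) ω}
      · exact (show φ (cash fun _ => a) ω ≤ φ (twoPos t U.1 U.2) ω from hω.2).trans_eq (h1 hω).symm
      · exact (h2 hω).symm.le⟩
    filter_upwards [hgB _ hUK, condGap_congr_on (P := P) (ζ := ζ) (ζ' := ζ') (V := V') (V' := V)
      (U := cutPos (C k ∩ {ω | φ (cash fun _ => a) ω ≤ φ (twoPos t U.1 U.2) ω}) a U.1 U.2)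
      (U' := U) (hB.inter hF) (fun ω hω => cutPos_of_mem hω.2)
      (fun ω hω => cutPos_of_mem (hBA hω.1))] with ω h1 h2 hωB hle hωC
    exact (h1 hωB).trans_eq (h2 ⟨hωB, hωC, hle⟩)
  filter_upwards [ae_all_iff.2 hk] with ω hω hωB hle
  obtain ⟨k, hk⟩ := hCcov ω
  exact hω k hωB hle hk

end LocalSeparation

/-! ### One-step measures from densities -/

section Normalization

variable {Ω : Type*} {m m0 : MeasurableSpace Ω} {𝓕 : Filtration ℕ m0} {P : Measure Ω}
  [IsProbabilityMeasure P] {T t : ℕ} {p q : ℝ≥0∞} {φ : (ℕ → Ω → ℝ) → Ω → EReal}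
  {f ζ ζ' : Ω → ℝ} {a : ℝ} {A B : Set Ω}

/-- The integral over the set of nonpositive conditional mean is zero. This disposes of the set on
which `ζ'` cannot be normalized. -/
theorem ae_eq_zero_of_cE_nonpos (hm : m ≤ m0) (hfm : Measurable[m0] f) (hf : LocLp m P 1 f)
    (h0 : ∀ ω, 0 ≤ f ω) : ∀ᵐ ω ∂P, cE m P f ω ≤ 0 → f ω = 0 := by
  have hA : MeasurableSet[m] {ω | cE m P f ω ≤ 0} :=
    measurableSet_le (measurable_cE m P f) measurable_const
  have h1 : ∫⁻ ω in {ω | cE m P f ω ≤ 0}, ENNReal.ofReal (f ω) ∂P = 0 := by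
    rw [← setLIntegral_condLExp hm P _ hA,
      setLIntegral_congr_fun_ae (g := fun _ => 0) (hm _ hA), lintegral_zero]
    filter_upwards [hf.condLExp_ofReal hm h0] with ω h1 h2
    rw [h1]
    exact ENNReal.ofReal_of_nonpos h2
  rw [setLIntegral_eq_zero_iff (hm _ hA) hfm.ennreal_ofReal] at h1
  filter_upwards [h1] with ω hω hle
  exact le_antisymm (ENNReal.ofReal_eq_zero.1 (hω hle)) (h0 ω)

open Classical in
/-- The pair `(Q, D)` obtained from nonnegative densities `ζ` at time `t` and `ζ'` at time `t + 1`
by normalization on `B`. -/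
noncomputable def normalizedQD (m : MeasurableSpace Ω) {m0 : MeasurableSpace Ω} (P : Measure Ω)
    (B : Set Ω) (ζ ζ' : Ω → ℝ) : QD Ω where
  Z ω := if 0 < cE m P ζ' ω then (cE m P ζ' ω)⁻¹ * ζ' ω else 1
  D ω := if ω ∈ B then (ζ ω + max (cE m P ζ' ω) 0)⁻¹ * max (cE m P ζ' ω) 0 else 1

/-- Division of `ζ'` by its conditional mean gives `E[Z | 𝓕ₜ] = 1`. Where that mean is not positive,
`Z = 1` serves; on `B` one has `D = 0` there, so the choice does not affect the pairing. -/
theorem normalizedQD_mem_MD (hq : 1 ≤ q) (ht : t < T) (hB : MeasurableSet[𝓕 t] B)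
    (hζ : Measurable[𝓕 t] ζ) (hζ' : Measurable[𝓕 (t + 1)] ζ') (hζ0 : ∀ ω, 0 ≤ ζ ω)
    (hζ0' : ∀ ω, 0 ≤ ζ' ω) (hζq : LocLp (𝓕 t) P q ζ') :
    normalizedQD (𝓕 t) P B ζ ζ' ∈ MD 𝓕 P T q t := by
  classical
  have hm := 𝓕.le t
  have hmm := 𝓕.mono t.le_succ
  have he := measurable_cE (𝓕 t) P ζ'
  have hG : MeasurableSet[𝓕 t] {ω | 0 < cE (𝓕 t) P ζ' ω} := measurableSet_lt measurable_const he
  have hinv : Measurable[𝓕 t] fun ω => (cE (𝓕 t) P ζ' ω)⁻¹ := he.inv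
  have hmax : Measurable[𝓕 t] fun ω => max (cE (𝓕 t) P ζ' ω) 0 := he.max measurable_const
  have hZ : Measurable[𝓕 (t + 1)] (normalizedQD (𝓕 t) P B ζ ζ').Z :=
    Measurable.ite (hmm _ hG) ((hinv.mono hmm le_rfl).mul hζ') measurable_const
  have hZ0 : ∀ ω, 0 ≤ (normalizedQD (𝓕 t) P B ζ ζ').Z ω := fun ω => by
    by_cases h : 0 < cE (𝓕 t) P ζ' ω
    · simp only [normalizedQD, h, if_true]
      exact mul_nonneg (inv_nonneg.2 h.le) (hζ0' ω)
    · simp only [normalizedQD, h, if_false, zero_le_one]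
  have hl : LocLp (𝓕 t) P q fun ω => (cE (𝓕 t) P ζ' ω)⁻¹ * ζ' ω := hζq.measurable_mul hm hinv
  have hZq : LocLp (𝓕 t) P q (normalizedQD (𝓕 t) P B ζ ζ').Z := by
    refine LocLp.of_le (hZ.mono (𝓕.le _) le_rfl).aestronglyMeasurable hm
      (hl.abs.add hm (.of_measurable hm (measurable_const (a := (1 : ℝ)))))
      (ae_of_all _ fun ω => ?_)
    rw [abs_of_nonneg (a := |_| + 1) (by positivity)]
    by_cases h : 0 < cE (𝓕 t) P ζ' ω
    · simp only [normalizedQD, h, if_true]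
      exact le_add_of_nonneg_right zero_le_one
    · simp only [normalizedQD, h, if_false, abs_one]
      exact le_add_of_nonneg_left (abs_nonneg _)
  have hone : cE (𝓕 t) P (normalizedQD (𝓕 t) P B ζ ζ').Z =ᵐ[P] fun _ => 1 := by
    filter_upwards [cE_congr_on (P := P) hm hG (f := (normalizedQD (𝓕 t) P B ζ ζ').Z)
        (g := fun ω => (cE (𝓕 t) P ζ' ω)⁻¹ * ζ' ω) (ae_of_all _ fun ω hω => if_pos hω),
      cE_congr_on (P := P) hm hG.compl (f := (normalizedQD (𝓕 t) P B ζ ζ').Z) (g := fun _ => 1)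
        (ae_of_all _ fun ω hω => if_neg hω),
      cE_measurable_mul hm hinv (hζq.mono_exponent hq),
      cE_of_measurable (P := P) hm (measurable_const (a := (1 : ℝ)))] with ω h1 h2 h3 h4
    by_cases h : 0 < cE (𝓕 t) P ζ' ω
    · rw [h1 h, h3, inv_mul_cancel₀ h.ne']
    · rw [h2 h, h4]
  rw [mem_MD_iff ht]
  refine ⟨hZ, hZ0, Q_eq_iff.2 ?_, (memCondLp_iff hm (hZ.mono (𝓕.le _) le_rfl)
    (one_pos.trans_le hq).ne').2 hZq, Measurable.ite hB (((hζ.add hmax).inv).mul hmax)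
    measurable_const, fun ω => ?_⟩
  · filter_upwards [(hZq.mono_exponent hq).condLExp_ofReal hm hZ0, hone] with ω h1 h2
    rw [h1, h2, ENNReal.ofReal_one]
  · by_cases h : ω ∈ B
    · simp only [normalizedQD, h, if_true]
      have h1 : 0 ≤ max (cE (𝓕 t) P ζ' ω) 0 := le_max_right _ _
      have h2 : 0 ≤ ζ ω + max (cE (𝓕 t) P ζ' ω) 0 := add_nonneg (hζ0 ω) h1
      exact ⟨mul_nonneg (inv_nonneg.2 h2) h1,
        inv_mul_le_one_of_le₀ (le_add_of_nonneg_left (hζ0 ω)) h2⟩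
    · simp only [normalizedQD, h, if_false]
      exact ⟨zero_le_one, le_rfl⟩

variable [ENNReal.HolderConjugate p q]

/-- On `B` the density `(1 - D, Z D)` is `(ζ, ζ')` divided by `ζ + E[ζ' | 𝓕ₜ]`, so the price is the
separating functional up to a positive 𝓕ₜ-measurable factor. -/
theorem tensorPairing_normalizedQD (hp : 1 ≤ p) (hB : MeasurableSet[𝓕 t] B)
    (hζ : Measurable[𝓕 t] ζ) (hζ' : Measurable[𝓕 (t + 1)] ζ')
    (hζ0' : ∀ ω, 0 ≤ ζ' ω) (hζq : LocLp (𝓕 t) P q ζ')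
    (hN : ∀ᵐ ω ∂P, ω ∈ B → 0 < ζ ω + max (cE (𝓕 t) P ζ' ω) 0) {x Y : Ω → ℝ}
    (hxY : MemTwoStep 𝓕 P p t x Y) :
    ∀ᵐ ω ∂P, ω ∈ B → tensorPairing (𝓕 t) P (normalizedQD (𝓕 t) P B ζ ζ').tensor x Y ω =
      (ζ ω + max (cE (𝓕 t) P ζ' ω) 0)⁻¹ * (ζ ω * x ω + cE (𝓕 t) P (fun ω => ζ' ω * Y ω) ω) := by
  classical
  have hm := 𝓕.le t
  have hq : 1 ≤ q := ENNReal.HolderConjugate.one_le q p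
  have hqp : ENNReal.HolderConjugate q p := .symm
  have hmax : Measurable[𝓕 t] fun ω => max (cE (𝓕 t) P ζ' ω) 0 :=
    (measurable_cE (𝓕 t) P ζ').max measurable_const
  have hinv : Measurable[𝓕 t] fun ω => (ζ ω + max (cE (𝓕 t) P ζ' ω) 0)⁻¹ := (hζ.add hmax).inv
  have hl : LocLp (𝓕 t) P 1 fun ω => ζ' ω * Y ω := hζq.mul hm ((memTwoStep_iff hp).1 hxY).2.2
  have hZ : ∀ᵐ ω ∂P, ω ∈ B → ((normalizedQD (𝓕 t) P B ζ ζ').tensor ω).2 * Y ω =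
      (ζ ω + max (cE (𝓕 t) P ζ' ω) 0)⁻¹ * (ζ' ω * Y ω) := by
    filter_upwards [ae_eq_zero_of_cE_nonpos hm (hζ'.mono (𝓕.le _) le_rfl) (hζq.mono_exponent hq)
      hζ0'] with ω h1 hω
    by_cases h : 0 < cE (𝓕 t) P ζ' ω
    · simp only [QD.tensor, normalizedQD, h, hω, if_true, max_eq_left h.le]
      field_simp
    · simp only [QD.tensor, normalizedQD, h, hω, if_true, if_false, max_eq_right (not_lt.1 h),
        h1 (not_lt.1 h)]
      simp
  filter_upwards [cE_congr_on (P := P) hm hB hZ, cE_measurable_mul hm hinv hl, hN] with ω h1 h2 h3 hω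
  have h4 := (h3 hω).ne'
  rw [tensorPairing, h1 hω, h2]
  simp only [QD.tensor, normalizedQD, hω, if_true]
  field_simp
  ring

/-- Separation of a two-step position, on a set of positive probability, by a one-step measure. -/
theorem exists_MD_of_lt (hφ : IsUSCAssessmentIndex 𝓕 P T p t φ) (ht : t < T) {x Y : Ω → ℝ}
    (hxY : MemTwoStep 𝓕 P p t x Y) (hA : MeasurableSet[𝓕 t] A) (hPA : P A ≠ 0)
    (hlt : ∀ᵐ ω ∂P, ω ∈ A → φ (twoPos t x Y) ω < φ (cash fun _ => a) ω) :
    ∃ B ⊆ A, MeasurableSet[𝓕 t] B ∧ P B ≠ 0 ∧ ∃ w ∈ MD 𝓕 P T q t, ∃ δ : Ω → ℝ,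
      Measurable[𝓕 t] δ ∧ (∀ ω, 0 < δ ω) ∧ ∀ x' Y', MemTwoStep 𝓕 P p t x' Y' →
        ∀ᵐ ω ∂P, ω ∈ B → tensorPairing (𝓕 t) P w.tensor x' Y' ω <
          tensorPairing (𝓕 t) P w.tensor x Y ω + δ ω →
            φ (twoPos t x' Y') ω < φ (cash fun _ => a) ω := by
  classical
  have hp1 : 1 ≤ p := ENNReal.HolderConjugate.one_le p q
  have hq1 : 1 ≤ q := ENNReal.HolderConjugate.one_le q p
  have hm := 𝓕.le t
  obtain ⟨B, hBA, hB, hPB, ζ, ζ', hζ, hζ', hζ0, hζ0', hζq, g, hg, hg0, hsep⟩ :=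
    exists_conditional_separation (q := q) (V := (x, Y)) hφ ht hxY hA hPA hlt
  have hζl : LocLp (𝓕 t) P q ζ' := .of_memLp hζq
  have hmax : Measurable[𝓕 t] fun ω => max (cE (𝓕 t) P ζ' ω) 0 :=
    (measurable_cE (𝓕 t) P ζ').max measurable_const
  have hinv : Measurable[𝓕 t] fun ω => (ζ ω + max (cE (𝓕 t) P ζ' ω) 0)⁻¹ := (hζ.add hmax).inv
  have hconst := const_mem_lpTwoStep (𝓕 := 𝓕) (P := P) (p := p) (t := t) a
  -- Cash `a` is itself one of the separated positions, with gap at least `g > 0`; where `ζ` and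
  -- `E[ζ' | 𝓕ₜ]` both vanish its gap would be 0.
  have hN : ∀ᵐ ω ∂P, ω ∈ B → 0 < ζ ω + max (cE (𝓕 t) P ζ' ω) 0 := by
    have hG : MeasurableSet[𝓕 t] {ω | cE (𝓕 t) P ζ' ω ≤ 0} :=
      measurableSet_le (measurable_cE (𝓕 t) P ζ') measurable_const
    filter_upwards [hsep _ (memTwoStep_of_mem_lpTwoStep hp1 hconst),
      cE_congr_on (P := P) hm hG (f := fun ω => ζ' ω * (a - Y ω)) (g := fun _ => 0) (by
        filter_upwards [ae_eq_zero_of_cE_nonpos hm (hζ'.mono (𝓕.le _) le_rfl)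
          (hζl.mono_exponent hq1) hζ0'] with ω h1 hω
        rw [h1 hω, zero_mul]),
      cE_of_measurable (P := P) hm (measurable_const (a := (0 : ℝ)))] with ω h1 h2 h3 hω
    have h1 := h1 hω (by rw [twoPos_const])
    refine lt_of_le_of_ne (add_nonneg (hζ0 ω) (le_max_right _ _)) fun h0 => ?_
    have h4 : ζ ω = 0 := le_antisymm (by linarith [le_max_right (cE (𝓕 t) P ζ' ω) 0]) (hζ0 ω)
    have h5 : cE (𝓕 t) P ζ' ω ≤ 0 := by
      linarith [le_max_left (cE (𝓕 t) P ζ' ω) 0]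
    rw [condGap, h4, zero_mul, zero_add] at h1
    exact absurd (h1.trans_eq ((h2 h5).trans h3)) (not_le.2 (hg0 ω))
  refine ⟨B, hBA, hB, hPB, normalizedQD (𝓕 t) P B ζ ζ',
    normalizedQD_mem_MD hq1 ht hB hζ hζ' hζ0 hζ0' hζl,
    -- The gap `g` in the units of the normalized measure; the value 1 elsewhere only keeps `δ`
    -- positive.
    fun ω => if 0 < ζ ω + max (cE (𝓕 t) P ζ' ω) 0 then
      (ζ ω + max (cE (𝓕 t) P ζ' ω) 0)⁻¹ * g ω else 1,
    Measurable.ite (measurableSet_lt measurable_const (hζ.add hmax)) (hinv.mul hg)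
      measurable_const, fun ω => ?_, fun x' Y' hxY' => ?_⟩
  · by_cases h : 0 < ζ ω + max (cE (𝓕 t) P ζ' ω) 0
    · simp only [h, if_true]
      exact mul_pos (inv_pos.2 h) (hg0 ω)
    · simp only [h, if_false, one_pos]
  · filter_upwards [hN, hsep (x', Y') hxY', tensorPairing_normalizedQD hp1 hB hζ hζ' hζ0' hζl hN hxY,
      tensorPairing_normalizedQD hp1 hB hζ hζ' hζ0' hζl hN hxY',
      condGap_eq (ζ := ζ) (V := (x, Y)) (U := (x', Y')) hp1 hζl hxY hxY']
      with ω h1 h2 h3 h4 h5 hω hlt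
    by_contra hle
    have h6 := h2 hω (not_lt.1 hle)
    have h1 := h1 hω
    rw [h3 hω, h4 hω] at hlt
    simp only [h1, if_true] at hlt
    rw [← mul_add, mul_lt_mul_iff_right₀ (inv_pos.2 h1)] at hlt
    rw [h5] at h6
    linarith

end Normalization

/-! ### Existence of the one-step risk functions -/

section Existence

variable {Ω : Type*} {m0 : MeasurableSpace Ω} {𝓕 : Filtration ℕ m0} {P : Measure Ω}
  {T t : ℕ} {p q : ℝ≥0∞} {α : ℕ → (ℕ → Ω → ℝ) → Ω → EReal}
  {X X' V : ℕ → Ω → ℝ} {c c' : (Ω → ℝ) → (Ω → ℝ) → Ω → EReal}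

theorem memX_glue (hX : IsPast 𝓕 t X) (hV : MemFuture 𝓕 P T p t V) :
    MemX 𝓕 P T p t (glue t X V) := by
  refine ⟨fun s hs => ?_, fun s hs hsT => ?_⟩
  · by_cases h : s < t
    · simpa only [glue, h, if_true] using hX s h
    · simpa only [glue, h, if_false] using (hV s (not_lt.1 h) hs).1
  · simpa only [glue, not_lt.2 hs, if_false] using hV s hs hsT

variable [IsProbabilityMeasure P]

theorem risk_le_of_le (hc : ∀ x Y, MemTwoStep 𝓕 P p t x Y → Measurable[𝓕 t] (c x Y))
    (hc' : ∀ x Y, MemTwoStep 𝓕 P p t x Y → Measurable[𝓕 t] (c' x Y))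
    (h : ∀ x Y, MemTwoStep 𝓕 P p t x Y → c x Y ≤ᵐ[P] c' x Y) {τ : Ω → ℝ × ℝ}
    (hτ : Measurable[𝓕 t] fun ω => (τ ω).1) {s : Ω → EReal} (hs : Measurable[𝓕 t] s) :
    risk 𝓕 P p t c τ s ≤ᵐ[P] risk 𝓕 P p t c' τ s := by
  have := rightVersion_le_rightVersion (P := P) (𝓕.le t) (preservesMeasurable_lowerRisk hc hτ)
    (locallyIncreasing_lowerRisk hc hτ) (preservesMeasurable_lowerRisk hc' hτ) hs hs
    MeasurableSet.univ (fun n hn => lowerRisk_le_on hc hτ hn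
      (preservesMeasurable_lowerRisk hc' hτ n hn) .univ fun x Y hxY => by
        filter_upwards [le_lowerRisk hc' hτ hn hxY, h x Y hxY] with ω h1 h2 _ hlt
        exact h2.trans (h1 hlt)) (ae_of_all _ fun _ _ => le_rfl)
  exact this.mono fun ω hω => hω trivial

theorem certEquiv_twoStep_congr (hp : 1 ≤ p) (hα : IsPathDependentIndex 𝓕 P T p t (α t))
    (hX : IsPast 𝓕 t X) (hX' : IsPast 𝓕 t X') (h : ∀ s < t, X s =ᵐ[P] X' s) {x Y : Ω → ℝ}
    (hxY : MemTwoStep 𝓕 P p t x Y) :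
    certEquiv 𝓕 P α t (twoStep t X x Y) = certEquiv 𝓕 P α t (twoStep t X' x Y) := by
  have hglue : ∀ V, MemFuture 𝓕 P T p t V → α t (glue t X V) =ᵐ[P] α t (glue t X' V) :=
    fun V hV => hα.congr _ _ (memX_glue hX hV) (memX_glue hX' hV) fun s _ => by
      by_cases hs : s < t
      · simpa only [glue, hs, if_true] using h s hs
      · simp only [glue, hs, if_false]
        exact EventuallyEq.rfl
  rw [certEquiv_twoStep, certEquiv_twoStep]
  congr 1
  ext g
  refine exists_congr fun m => and_congr_right fun hm => and_congr_left fun _ => ?_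
  have h1 : α t (twoStep t X x Y) =ᵐ[P] α t (twoStep t X' x Y) := by
    rw [twoStep_eq_glue, twoStep_eq_glue]
    exact hglue _ (memFuture_twoPos hp hxY)
  have h2 := hglue _ (memFuture_cash hp hm)
  exact ⟨fun H => h1.symm.le.trans (H.trans h2.le), fun H => h1.le.trans (H.trans h2.symm.le)⟩

variable [ENNReal.HolderConjugate p q]

/-- The axioms of a minimal risk function hold for every measurable `c`; the index enters through
the representation. The certainty equivalent is below `a` exactly where the index is below that of
cash `a`, which turns `exists_MD_of_lt` into the separation required by `isEssInf_risk`. -/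
theorem isOneStepRisk_risk (hα : ∀ t ≤ T, IsPathDependentIndex 𝓕 P T p t (α t))
    (hC : ∀ t ≤ T, ∀ X, IsPast 𝓕 t X →
      HasCertaintyAssumptions 𝓕 P T p t (fun V => α t (glue t X V))) :
    IsOneStepRisk 𝓕 P T p q (certEquiv 𝓕 P α)
      fun t X => risk 𝓕 P p t fun x Y => certEquiv 𝓕 P α t (twoStep t X x Y) := by
  have hp : 1 ≤ p := ENNReal.HolderConjugate.one_le p q
  refine ⟨fun t ht X X' hX hX' h w hw s hs => ?_, fun t ht X hX =>
    isMinimalRiskFunction_risk (fun _ _ _ => measurable_certEquiv) ht,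
    fun t ht X hX x Y hxY => isEssInf_risk (fun _ _ _ => measurable_certEquiv) ht hxY ?_⟩
  · have hτ := measurable_tensor_fst ht hw
    have h1 := fun x Y hxY => certEquiv_twoStep_congr (x := x) (Y := Y) hp (hα t ht.le) hX hX' h hxY
    exact (risk_le_of_le (fun _ _ _ => measurable_certEquiv) (fun _ _ _ => measurable_certEquiv)
      (fun x Y hxY => EventuallyEq.le (by rw [h1 x Y hxY])) hτ hs).antisymm
      (risk_le_of_le (fun _ _ _ => measurable_certEquiv) (fun _ _ _ => measurable_certEquiv)
      (fun x Y hxY => EventuallyEq.le (by rw [h1 x Y hxY])) hτ hs)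
  · intro a A hA hPA hlt
    have hφ := (hα t ht.le).index X hX
    have hCX := hC t ht.le X hX
    have key : ∀ x Y, MemTwoStep 𝓕 P p t x Y → ∀ᵐ ω ∂P,
        certEquiv 𝓕 P α t (twoStep t X x Y) ω < a ↔
          α t (glue t X (twoPos t x Y)) ω < α t (glue t X (cash fun _ => a)) ω := fun x Y hxY => by
      obtain ⟨y, hy, -, hinf, hφy⟩ := hφ.exists_certainty hCX hp le_rfl
        ((memFuture_iff hp).1 (memFuture_twoPos (T := T) hp hxY))
      have e : certEquiv 𝓕 P α t (twoStep t X x Y) =ᵐ[P] fun ω => (y ω : EReal) := by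
        refine isEssInf_certEquiv.unique ?_
        simp only [glue_twoStep]
        exact hinf
      filter_upwards [e, hφy, hφ.cash_lt_iff hCX hp hy (measurable_const (a := a))] with ω h1 h2 h3
      rw [h1, ← h2, h3, EReal.coe_lt_coe_iff]
    obtain ⟨B, hBA, hB, hPB, w, hw, δ, hδ, hδ0, hw1⟩ := exists_MD_of_lt (q := q) (a := a) hφ ht hxY
      hA hPA (by
        filter_upwards [hlt, key x Y hxY] with ω h1 h2 hω
        exact h2.1 (h1 hω))
    refine ⟨B, hBA, hB, hPB, w, hw, δ, hδ, hδ0, fun x' Y' hxY' => ?_⟩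
    filter_upwards [hw1 x' Y' hxY', key x' Y' hxY'] with ω h1 h2 hω hlt
    exact (h2.2 (h1 hω hlt)).le

end Existence

end DynIndex

theorem mainTheorem8 {Ω : Type*} {m0 : MeasurableSpace Ω} (P : Measure Ω) [IsProbabilityMeasure P]
    (𝓕 : Filtration ℕ m0) (T : ℕ) (p q : ℝ≥0∞) [ENNReal.HolderConjugate p q]
    (α : ℕ → (ℕ → Ω → ℝ) → Ω → EReal)
    (hα : ∀ t ≤ T, DynIndex.IsPathDependentIndex 𝓕 P T p t (α t))
    (hC : ∀ t ≤ T, ∀ X, DynIndex.IsPast 𝓕 t X →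
      DynIndex.HasCertaintyAssumptions 𝓕 P T p t (fun V => α t (DynIndex.glue t X V)))
    (hstc : DynIndex.StronglyTimeConsistent 𝓕 P T p α) :
    (∃ R, DynIndex.IsOneStepRisk 𝓕 P T p q (DynIndex.certEquiv 𝓕 P α) R) ∧
    ∀ R, DynIndex.IsOneStepRisk 𝓕 P T p q (DynIndex.certEquiv 𝓕 P α) R →
      ∀ t ≤ T, ∀ X, DynIndex.MemX 𝓕 P T p t X →
        DynIndex.IsEssInf (𝓕 t) P
          {g | ∃ w ∈ DynIndex.MD 𝓕 P T q t, g = DynIndex.FVal 𝓕 P T q R t w X}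
          (DynIndex.certEquiv 𝓕 P α t X) := by
  refine ⟨⟨_, DynIndex.isOneStepRisk_risk hα hC⟩, fun R hR t ht X hX => ?_⟩
  exact DynIndex.isEssInf_recF_certEquiv hα hC hstc hR (T - t) t (by omega) hX
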